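/- Let $n\ge 1$ and $0\le p\le n$, and let $A_\lambda,B_\lambda$ be entire functions of $\lambda\in\mathbb C$. For $x\in\mathbb R^n$ let $\varepsilon_x$ and $i_x$ denote exterior and interior multiplication by $x$ on complex-valued constant forms $\Lambda^\bullet(\mathbb R^n)^*\otimes\mathbb C$, let $d=\sum_k\varepsilon_{e_k}\partial_k$ be the exterior differential and $\delta=-\sum_k i_{e_k}\partial_k$ its formal $L^2$-adjoint, acting on form-valued tempered distributions, where $e_1,\dots,e_n$ is the standard basis. For $\operatorname{Re}\lambda>-n$ let $$R^\lambda_{A_\lambda,B_\lambda}(x)=|x|^{\lambda-2}\left(A_\lambda\, i_x\varepsilon_x+B_\lambda\,\varepsilon_x i_x\right),$$ a locally integrable function with values in $\operatorname{End}(\Lambda^p(\mathbb R^n)^*\otimes\mathbb C)$, and put $$C_\lambda=(\lambda+p)A_\lambda-pB_\lambda,\qquad D_\lambda=-(n-p)A_\lambda+(\lambda+n-p)B_\lambda .$$ Differential operators act on an endomorphism-valued distribution after applying it to constant $p$-forms. (a) For $\operatorname{Re}\lambda>-n$, integration against $R^\lambda_{A_\lambda,B_\lambda}$ is a tempered distribution.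 The family extends uniquely to a holomorphic family of tempered distributions on $\mathbb C\setminus(-n-2\mathbb N_0)$, again denoted $R^\lambda_{A_\lambda,B_\lambda}$ (holomorphic: each pairing with a Schwartz function is holomorphic). The extension is meromorphic on $\mathbb C$, and each singularity $\lambda=-n-2k$, $k\in\mathbb N_0$, is either a simple pole or removable; it is a simple pole (non-zero residue) if and only if ($p<n$ and $C_{-n-2k}\neq0$) or ($p>0$ and $D_{-n-2k}\ne0$). (b) For all $\lambda\in\mathbb C\setminus(-n-2\mathbb N_0)$, in particular for $\operatorname{Re}\lambda>-n$, the Bernstein–Sato identity holds: $$\left(C_\lambda D_{\lambda+2}\,\delta d+D_\lambda C_{\lambda+2}\,d\delta\right)R^{\lambda+2}_{A_{\lambda+2},B_{\lambda+2}}=-\lambda(\lambda+n)\,C_{\lambda+2}D_{\lambda+2}\,R^\lambda_{A_\lambda,B_\lambda}.$$ (c) More generally, for every integer $k\ge1$ and all $\lambda\in\mathbb C\setminus(-n-2\mathbb N_0)$, $$\left(C_\lambda D_{\lambda+2k}(\delta d)^k+C_{\lambda+2k}D_\lambda(d\delta)^k\right)R^{\lambda+2k}_{A_{\lambda+2k},B_{\lambda+2k}}=(-1)^k4^k\left(\tfrac\lambda2\right)_k\left(\tfrac{\lambda+n}2\right)_kC_{\lambda+2k}D_{\lambda+2k}\,R^\lambda_{A_\lambda,B_\lambda},$$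 where $(a)_k=a(a+1)\cdots(a+k-1)$. -/

import Mathlib

open Filter Topology MeasureTheory
open scoped SchwartzMap LineDeriv

namespace RieszForms

/-- Euclidean space `ℝⁿ`. -/
abbrev Euc (n : ℕ) : Type := EuclideanSpace ℝ (Fin n)

/-- Complex-valued constant `p`-forms on `ℝⁿ`, that is `Λᵖ(ℝⁿ)* ⊗ ℂ`. -/
def Form (n p : ℕ) : Type := (Euc n) [⋀^Fin p]→L[ℝ] ℂ

noncomputable instance (n p : ℕ) : NormedAddCommGroup (Form n p) :=
  inferInstanceAs (NormedAddCommGroup ((Euc n) [⋀^Fin p]→L[ℝ] ℂ))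

noncomputable instance (n p : ℕ) : NormedSpace ℂ (Form n p) :=
  inferInstanceAs (NormedSpace ℂ ((Euc n) [⋀^Fin p]→L[ℝ] ℂ))

instance (n p : ℕ) : CompleteSpace (Form n p) :=
  inferInstanceAs (CompleteSpace ((Euc n) [⋀^Fin p]→L[ℝ] ℂ))

/-- Endomorphisms of the space of constant `p`-forms. -/
abbrev FormEnd (n p : ℕ) : Type := Form n p →L[ℂ] Form n p

/-- Exterior multiplication by `x`: `ε_x ω = x♭ ∧ ω`, that is
`(ε_x ω)(v₀, …, v_p) = ∑ᵢ (-1)ⁱ ⟪x, vᵢ⟫ ω(v₀, …, v̂ᵢ, …, v_p)`. -/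
noncomputable def extMul {n p : ℕ} (x : Euc n) : Form n p →L[ℂ] Form n (p + 1) :=
  LinearMap.mkContinuous
    { toFun := fun (ω : (Euc n) [⋀^Fin p]→L[ℝ] ℂ) =>
        ContinuousAlternatingMap.alternatizeUncurryFin ((innerSL ℝ x).smulRight ω)
      map_add' := by
        intro (ω : (Euc n) [⋀^Fin p]→L[ℝ] ℂ) (η : (Euc n) [⋀^Fin p]→L[ℝ] ℂ)
        refine ContinuousAlternatingMap.ext fun v => ?_
        change ContinuousAlternatingMap.alternatizeUncurryFin ((innerSL ℝ x).smulRight (ω + η)) v =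
          ContinuousAlternatingMap.alternatizeUncurryFin ((innerSL ℝ x).smulRight ω) v +
            ContinuousAlternatingMap.alternatizeUncurryFin ((innerSL ℝ x).smulRight η) v
        simp [ContinuousAlternatingMap.alternatizeUncurryFin_apply, Finset.sum_add_distrib]
      map_smul' := by
        intro c (ω : (Euc n) [⋀^Fin p]→L[ℝ] ℂ)
        refine ContinuousAlternatingMap.ext fun v => ?_
        change ContinuousAlternatingMap.alternatizeUncurryFin ((innerSL ℝ x).smulRight (c • ω)) v =
          c • ContinuousAlternatingMap.alternatizeUncurryFin ((innerSL ℝ x).smulRight ω) v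
        simp only [ContinuousAlternatingMap.alternatizeUncurryFin_apply,
          ContinuousLinearMap.smulRight_apply, ContinuousAlternatingMap.smul_apply,
          Finset.smul_sum]
        refine Finset.sum_congr rfl fun i _ => ?_
        rw [smul_comm c, smul_comm c] }
    ((p + 1 : ℝ) * ‖x‖) (by
      intro (ω : (Euc n) [⋀^Fin p]→L[ℝ] ℂ)
      refine (ContinuousAlternatingMap.norm_alternatizeUncurryFin_le
        ((innerSL ℝ x).smulRight ω)).trans ?_
      rw [ContinuousLinearMap.norm_smulRight_apply, innerSL_apply_norm, mul_assoc]
      rfl)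

/-- Interior multiplication by `x`: `(i_x ω)(v₁, …, v_p) = ω(x, v₁, …, v_p)`. -/
noncomputable def intMul {n p : ℕ} (x : Euc n) : Form n (p + 1) →L[ℂ] Form n p :=
  LinearMap.mkContinuous
    { toFun := fun (ω : (Euc n) [⋀^Fin (p + 1)]→L[ℝ] ℂ) => ω.curryLeft x
      map_add' := fun _ _ => rfl
      map_smul' := fun _ _ => rfl }
    ‖x‖ (by
      intro (ω : (Euc n) [⋀^Fin (p + 1)]→L[ℝ] ℂ)
      refine (ω.curryLeft.le_opNorm x).trans ?_
      rw [ContinuousAlternatingMap.norm_curryLeft, mul_comm]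
      rfl)

/-- `i_x ε_x` on `p`-forms. -/
noncomputable def intExt (n p : ℕ) (x : Euc n) : FormEnd n p :=
  (intMul x).comp (extMul x)

/-- `ε_x i_x` on `p`-forms; it vanishes on `0`-forms because `i_x` does. -/
noncomputable def extInt (n : ℕ) : (p : ℕ) → Euc n → FormEnd n p
  | 0, _ => 0
  | _ + 1, x => (extMul x).comp (intMul x)

/-- The kernel `|x|^(z-2) (a i_x ε_x + b ε_x i_x)`. -/
noncomputable def rieszKernel (n p : ℕ) (z a b : ℂ) (x : Euc n) : FormEnd n p :=
  ((‖x‖ : ℂ) ^ (z - 2)) • (a • intExt n p x + b • extInt n p x)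

/-- The tempered distribution `T` is given by integration against the function `K`. -/
def IsGivenBy {n p : ℕ}
    (T : 𝓢'(Euc n, FormEnd n p)) (K : Euc n → FormEnd n p) : Prop :=
  ∀ φ : 𝓢(Euc n, ℂ), Integrable (fun x => φ x • K x) ∧ T φ = ∫ x, φ x • K x

/-- The `k`-th partial derivative of a tempered distribution. -/
noncomputable def partialD {n : ℕ} (F : Type*)
    [AddCommGroup F] [Module ℂ F] [TopologicalSpace F] [IsTopologicalAddGroup F]
    [ContinuousConstSMul ℂ F] (k : Fin n) : 𝓢'(Euc n, F) →ₗ[ℂ] 𝓢'(Euc n, F) :=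
  (LineDeriv.lineDerivOpCLM ℂ 𝓢'(Euc n, F) (EuclideanSpace.basisFun (Fin n) ℝ k)).toLinearMap

/-- Applying a linear map of the value spaces to a tempered distribution. -/
noncomputable def mapValues {n : ℕ} {F G : Type*}
    [AddCommGroup F] [Module ℂ F] [TopologicalSpace F] [IsTopologicalAddGroup F]
    [ContinuousConstSMul ℂ F]
    [AddCommGroup G] [Module ℂ G] [TopologicalSpace G] [IsTopologicalAddGroup G]
    [ContinuousConstSMul ℂ G] (L : F →L[ℂ] G) :
    𝓢'(Euc n, F) →ₗ[ℂ] 𝓢'(Euc n, G) :=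
  (PointwiseConvergenceCLM.postcomp 𝓢(Euc n, ℂ) L).toLinearMap

/-- The exterior differential `d = ∑ₖ ε_{eₖ} ∂ₖ` on distributional `p`-forms. -/
noncomputable def extD (n p : ℕ) : 𝓢'(Euc n, Form n p) →ₗ[ℂ] 𝓢'(Euc n, Form n (p + 1)) :=
  ∑ k : Fin n, mapValues (extMul (EuclideanSpace.basisFun (Fin n) ℝ k)) ∘ₗ partialD _ k

/-- The co-differential `δ = -∑ₖ i_{eₖ} ∂ₖ`, the formal `L²`-adjoint of `d`. -/
noncomputable def coD (n p : ℕ) : 𝓢'(Euc n, Form n (p + 1)) →ₗ[ℂ] 𝓢'(Euc n, Form n p) :=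
  -∑ k : Fin n, mapValues (intMul (EuclideanSpace.basisFun (Fin n) ℝ k)) ∘ₗ partialD _ k

/-- `δ d` on distributional `p`-forms. -/
noncomputable def coDextD (n p : ℕ) : Module.End ℂ 𝓢'(Euc n, Form n p) :=
  coD n p ∘ₗ extD n p

/-- `d δ` on distributional `p`-forms; it vanishes on `0`-forms because `δ` does. -/
noncomputable def extDcoD (n : ℕ) : (p : ℕ) → Module.End ℂ 𝓢'(Euc n, Form n p)
  | 0 => 0
  | p + 1 => extD n p ∘ₗ coD n p

/-- The distributional `p`-form `T β` obtained by applying an endomorphism-valued distribution `T`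
to a constant `p`-form `β`. A differential operator `P` on `p`-forms acts on `T` through
`(P T) β = P (T β)`. -/
noncomputable def applyForm {n p : ℕ} (β : Form n p) :
    𝓢'(Euc n, FormEnd n p) →ₗ[ℂ] 𝓢'(Euc n, Form n p) :=
  mapValues (ContinuousLinearMap.apply ℂ (Form n p) β)

/-- `C_z = (z + p) A_z - p B_z`. -/
def coeffC (p : ℕ) (A B : ℂ → ℂ) (z : ℂ) : ℂ := (z + p) * A z - p * B z

/-- `D_z = -(n - p) A_z + (z + n - p) B_z`. -/
def coeffD (n p : ℕ) (A B : ℂ → ℂ) (z : ℂ) : ℂ :=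
  -((n : ℂ) - p) * A z + (z + n - p) * B z

/-- The operator `C_z D_{z+2k} (δd)^k + D_z C_{z+2k} (dδ)^k` of order `2k`, for `k ≥ 1`. -/
noncomputable def bernsteinOp (n p k : ℕ) (A B : ℂ → ℂ) (z : ℂ) :
    Module.End ℂ 𝓢'(Euc n, Form n p) :=
  (coeffC p A B z * coeffD n p A B (z + 2 * k)) • coDextD n p ^ k
    + (coeffD n p A B z * coeffC p A B (z + 2 * k)) • extDcoD n p ^ k

/-- The set `-n - 2ℕ₀`. -/
def poleSet (n : ℕ) : Set ℂ := {z | ∃ k : ℕ, z = -n - 2 * k}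

/-- A family of tempered distributions is holomorphic on `U` if each of its pairings with a
Schwartz function is. -/
def HolomorphicFamilyOn {n p : ℕ}
    (T : ℂ → 𝓢'(Euc n, FormEnd n p)) (U : Set ℂ) : Prop :=
  ∀ φ : 𝓢(Euc n, ℂ), DifferentiableOn ℂ (fun z => T z φ) U

/-- For a family that is holomorphic on a punctured neighbourhood of `z₀`: the family has at most a
simple pole at `z₀`, with residue `S`. It has a genuine pole iff `S ≠ 0`; if `S = 0` the singularity
is removable. -/
def HasSimplePoleResidue {n p : ℕ}
    (T : ℂ → 𝓢'(Euc n, FormEnd n p)) (z₀ : ℂ) (S : 𝓢'(Euc n, FormEnd n p)) : Prop :=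
  ∀ φ : 𝓢(Euc n, ℂ), Tendsto (fun z => (z - z₀) • T z φ) (𝓝[≠] z₀) (𝓝 (S φ))

/-- `R` is a holomorphic continuation of the family `z ↦ |x|^(z-2) (A_z i_x ε_x + B_z ε_x i_x)`
from the half plane `Re z > -n` to `ℂ ∖ (-n - 2ℕ₀)`. -/
def IsRieszContinuation (n p : ℕ) (A B : ℂ → ℂ) (R : ℂ → 𝓢'(Euc n, FormEnd n p)) : Prop :=
  (∀ z : ℂ, -(n : ℝ) < z.re → IsGivenBy (R z) (rieszKernel n p z (A z) (B z))) ∧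
    HolomorphicFamilyOn R (poleSet n)ᶜ

end RieszForms

namespace RieszForms

/-! Continuation. Let `q` be a continuous map, homogeneous of degree two, and `E` the Euler
operator. Differentiating the dilation identity at scale one gives, for Re z > -n, that pairing `E
φ` with |x|^(z-2) q(x) multiplies the pairing with φ by -(z+n) (`kernInt_euler`). Since `q` is even,
only the even part of φ matters. On even functions the product of the operators E - 2i, i < M,
removes the Taylor terms of degree below 2M, so the result is O(|x|^(2M)) (`exists_evenProd_bound`)
and its pairing converges for Re z > -n - 2M. Dividing by the product of the -(z+n+2i) continues the
family with at most simple poles (`exists_rieszDist`, `exists_residue`). Taking `q` to be i_x ε_x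
and ε_x i_x and combining linearly with coefficients A and B gives the Riesz family; uniqueness is
the identity theorem on the connected complement of the pole set.

Bernstein–Sato. For Re z > 2 everything can be differentiated classically. Because i_x ε_x + ε_x i_x
= |x|², δd maps the distribution with coefficients (a, b) at z+2 to a scalar multiple of the one
with coefficients (z+n-p, n-p) at z, and dδ maps it to a multiple of the one with (p, z+p)
(`coDextD_rieszR`, `extDcoD_rieszR`). These two pairs form a matrix of determinant z(z+n), and C_z,
D_z are the Cramer coefficients which recombine them to z(z+n)(A_z, B_z). The pairs also reproduce
themselves under further applications, up to the factor -z(z+n) for the current z, which yields the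
iterates.

Poles. Tested on a homogeneous function of degree 2k times a cutoff, the residue at -n-2k is, up to
log 2, an absolutely convergent integral over an annulus (`log_two_smul_residue`). For k ≥ 1 the
test function may be the conjugate of a component of a i_x ε_x + b ε_x i_x times an even power of
|x|; a vanishing residue then forces that quadratic map to vanish, and the determinant z(z+n) is
nonzero there, so A, B can be traded for C, D. At -n only constants are available; there the
residues of the two basic families are proportional with known ratio, and C and D coincide. -/

/-- Evaluation of constant forms on a tuple of vectors. -/
noncomputable def evalAt {n p : ℕ} (v : Fin p → Euc n) : Form n p →L[ℂ] ℂ :=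
  LinearMap.mkContinuous
    { toFun := fun (ω : (Euc n) [⋀^Fin p]→L[ℝ] ℂ) => ω v
      map_add' := fun _ _ => rfl
      map_smul' := fun _ _ => rfl }
    (∏ i, ‖v i‖) (by
      intro (ω : (Euc n) [⋀^Fin p]→L[ℝ] ℂ)
      rw [mul_comm]
      exact ω.le_opNorm v)

/-! ### Exterior algebra: anticommutation relations, traces and projections. -/

section Algebra

variable {n p : ℕ}

theorem Form.ext {ω η : Form n p} (h : ∀ v, evalAt v ω = evalAt v η) : ω = η :=
  ContinuousAlternatingMap.ext (f := (ω : (Euc n) [⋀^Fin p]→L[ℝ] ℂ)) h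

theorem evalAt_intMul (x : Euc n) (ω : Form n (p + 1)) (v : Fin p → Euc n) :
    evalAt v (intMul x ω) = evalAt (Fin.cons x v : Fin (p + 1) → Euc n) ω := rfl

theorem evalAt_extMul (x : Euc n) (ω : Form n p) (v : Fin (p + 1) → Euc n) :
    evalAt v (extMul x ω) =
      ∑ i : Fin (p + 1), (-1 : ℂ) ^ (i : ℕ) * ((inner ℝ x (v i) : ℝ) : ℂ) * evalAt (Fin.removeNth i v) ω := by
  refine (ContinuousAlternatingMap.alternatizeUncurryFin_apply
    ((innerSL ℝ x).smulRight (ω : (Euc n) [⋀^Fin p]→L[ℝ] ℂ)) v).trans ?_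
  refine Finset.sum_congr rfl fun i _ => ?_
  simp only [zsmul_eq_mul]
  push_cast
  rw [mul_assoc]
  rfl

/-- This is the induction device for the identities below: contraction lowers the degree, and
`intMul_extMul` moves it past exterior products. -/
theorem Form.ext_intMul {ω η : Form n (p + 1)} (h : ∀ u : Euc n, intMul u ω = intMul u η) :
    ω = η := by
  refine Form.ext fun v => ?_
  have := congrArg (evalAt (Fin.tail v)) (h (v 0))
  simpa [evalAt_intMul] using this

theorem intMul_add (x y : Euc n) (ω : Form n (p + 1)) :
    intMul (x + y) ω = intMul x ω + intMul y ω :=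
  map_add (ContinuousAlternatingMap.curryLeft (ω : (Euc n) [⋀^Fin (p + 1)]→L[ℝ] ℂ)) x y

theorem intMul_smul (c : ℝ) (x : Euc n) (ω : Form n (p + 1)) :
    intMul (c • x) ω = (c : ℂ) • intMul x ω :=
  map_smul (ContinuousAlternatingMap.curryLeft (ω : (Euc n) [⋀^Fin (p + 1)]→L[ℝ] ℂ)) c x

theorem extMul_add (x y : Euc n) (ω : Form n p) :
    extMul (x + y) ω = extMul x ω + extMul y ω := by
  refine Form.ext fun v => ?_
  simp only [map_add, evalAt_extMul, ← Finset.sum_add_distrib, inner_add_left]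
  refine Finset.sum_congr rfl fun i _ => ?_
  push_cast
  ring

theorem extMul_smul (c : ℝ) (x : Euc n) (ω : Form n p) :
    extMul (c • x) ω = (c : ℂ) • extMul x ω := by
  refine Form.ext fun v => ?_
  simp only [map_smul, evalAt_extMul, smul_eq_mul, Finset.mul_sum, real_inner_smul_left]
  refine Finset.sum_congr rfl fun i _ => ?_
  push_cast
  ring

theorem intMul_extMul_zero (u x : Euc n) (ω : Form n 0) :
    intMul u (extMul x ω) = ((inner ℝ u x : ℝ) : ℂ) • ω := by
  refine Form.ext fun v => ?_
  rw [evalAt_intMul, evalAt_extMul, map_smul]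
  simp [real_inner_comm]

/-- In the alternating sum for ε_x ω the slot filled by u contributes the inner product; in all
other terms the index is shifted by one, which flips the sign. -/
theorem intMul_extMul (u x : Euc n) (ω : Form n (p + 1)) :
    intMul u (extMul x ω) = ((inner ℝ u x : ℝ) : ℂ) • ω - extMul x (intMul u ω) := by
  refine Form.ext fun v => ?_
  rw [evalAt_intMul, evalAt_extMul, map_sub, map_smul, evalAt_extMul, Fin.sum_univ_succ,
    sub_eq_add_neg, ← Finset.sum_neg_distrib]
  congr 1
  · simp [real_inner_comm]
  · refine Finset.sum_congr rfl fun i _ => ?_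
    rw [evalAt_intMul]
    have : (i.succ.removeNth (Fin.cons u v : Fin (p + 2) → Euc n)) =
        (Fin.cons u (i.removeNth v) : Fin (p + 1) → Euc n) := by
      ext j : 1
      refine Fin.cases ?_ (fun k => ?_) j
      · simp [Fin.removeNth]
      · simp [Fin.removeNth]
    rw [this]
    simp [pow_succ]

/-- Contracting with an arbitrary u produces two equal terms with opposite signs and one covered by
induction on the degree. -/
theorem extMul_extMul_self (x : Euc n) (ω : Form n p) : extMul x (extMul x ω) = 0 := by
  induction p with
  | zero =>
    refine Form.ext_intMul fun u => ?_
    rw [intMul_extMul, intMul_extMul_zero, map_smul, sub_self, map_zero]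
  | succ p ih =>
    refine Form.ext_intMul fun u => ?_
    rw [intMul_extMul, intMul_extMul, map_sub, ih, map_smul, sub_zero, sub_self, map_zero]

theorem intMul_intMul_self (x : Euc n) (ω : Form n (p + 2)) : intMul x (intMul x ω) = 0 :=
  ContinuousAlternatingMap.curryLeft_same (ω : (Euc n) [⋀^Fin (p + 2)]→L[ℝ] ℂ) x

/-- Polarisation of `extMul_extMul_self`. -/
theorem extMul_extMul_comm (x y : Euc n) (ω : Form n p) :
    extMul x (extMul y ω) = -extMul y (extMul x ω) := by
  have h := extMul_extMul_self (x + y) ω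
  simp only [extMul_add, map_add, extMul_extMul_self, zero_add, add_zero] at h
  rw [eq_neg_iff_add_eq_zero]
  exact (add_comm _ _).trans h

theorem intMul_intMul_comm (x y : Euc n) (ω : Form n (p + 2)) :
    intMul x (intMul y ω) = -intMul y (intMul x ω) := by
  have h := intMul_intMul_self (x + y) ω
  simp only [intMul_add, map_add, intMul_intMul_self, zero_add, add_zero] at h
  rw [eq_neg_iff_add_eq_zero]
  exact (add_comm _ _).trans h

/-- The standard basis of `ℝⁿ`. -/
noncomputable abbrev stdB (n : ℕ) (k : Fin n) : Euc n := EuclideanSpace.basisFun (Fin n) ℝ k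

theorem inner_stdB (x : Euc n) (k : Fin n) : inner ℝ x (stdB n k) = x k := by
  simp [EuclideanSpace.inner_single_right]

theorem sum_smul_stdB (x : Euc n) : ∑ k, x k • stdB n k = x := by
  simpa using (EuclideanSpace.basisFun (Fin n) ℝ).sum_repr x

theorem sum_smul_intMul (x : Euc n) (ω : Form n (p + 1)) :
    ∑ k, (x k : ℂ) • intMul (stdB n k) ω = intMul x ω := by
  simp only [← intMul_smul]
  conv_rhs => rw [← sum_smul_stdB x]
  exact (map_sum (ContinuousAlternatingMap.curryLeft (ω : (Euc n) [⋀^Fin (p + 1)]→L[ℝ] ℂ))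
    _ _).symm

theorem sum_smul_extMul (x : Euc n) (ω : Form n p) :
    ∑ k, (x k : ℂ) • extMul (stdB n k) ω = extMul x ω := by
  simp only [← extMul_smul]
  conv_rhs => rw [← sum_smul_stdB x]
  exact (map_sum (⟨⟨fun y => extMul y ω, fun a b => extMul_add a b ω⟩,
    fun c a => extMul_smul c a ω⟩ : Euc n →ₗ[ℝ] Form n (p + 1)) _ _).symm

/-- The operator counting the degree: contracting with u splits off i_u ω once and leaves the same
operator on i_u ω, one degree lower. -/
theorem sum_extMul_intMul (ω : Form n (p + 1)) :
    ∑ k, extMul (stdB n k) (intMul (stdB n k) ω) = ((p : ℂ) + 1) • ω := by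
  induction p with
  | zero =>
    refine Form.ext_intMul fun u => ?_
    rw [map_sum]
    simp only [intMul_extMul_zero, inner_stdB]
    rw [sum_smul_intMul]
    simp
  | succ p ih =>
    refine Form.ext_intMul fun u => ?_
    rw [map_sum]
    simp only [intMul_extMul, inner_stdB]
    rw [Finset.sum_sub_distrib, sum_smul_intMul]
    simp only [intMul_intMul_comm u, map_neg]
    rw [Finset.sum_neg_distrib, ih, map_smul]
    push_cast
    module

theorem sum_intMul_extMul (ω : Form n p) :
    ∑ k, intMul (stdB n k) (extMul (stdB n k) ω) = ((n : ℂ) - p) • ω := by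
  cases p with
  | zero => simp [intMul_extMul_zero, Nat.cast_smul_eq_nsmul]
  | succ p =>
    simp only [intMul_extMul]
    rw [Finset.sum_sub_distrib, sum_extMul_intMul]
    simp only [inner_stdB]
    simp [sub_smul, Nat.cast_smul_eq_nsmul]

/-- `ε_u i_v` on `p`-forms, which vanishes on `0`-forms. -/
noncomputable def extInt₂ (n : ℕ) : (p : ℕ) → Euc n → Euc n → FormEnd n p
  | 0, _, _ => 0
  | _ + 1, u, v => (extMul u).comp (intMul v)

theorem extInt₂_self (x : Euc n) : extInt₂ n p x x = extInt n p x := by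
  cases p <;> rfl

theorem intMul_extMul_add (u x : Euc n) (ω : Form n p) :
    intMul u (extMul x ω) + extInt₂ n p x u ω = ((inner ℝ u x : ℝ) : ℂ) • ω := by
  cases p with
  | zero => simp [extInt₂, intMul_extMul_zero]
  | succ p => simp [extInt₂, intMul_extMul]

theorem intExt_add_extInt (x : Euc n) (ω : Form n p) :
    intExt n p x ω + extInt n p x ω = ((‖x‖ ^ 2 : ℝ) : ℂ) • ω := by
  rw [← extInt₂_self, ← real_inner_self_eq_norm_sq, ← intMul_extMul_add x x ω]
  rfl

theorem sum_extInt (ω : Form n p) :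
    ∑ k, extInt n p (stdB n k) ω = (p : ℂ) • ω := by
  cases p with
  | zero => simp [extInt]
  | succ p => simpa [extInt] using sum_extMul_intMul ω

/-- If every p+1-form vanished, the trace identity `sum_intMul_extMul` would give (n - p) ω = 0 for
the nonzero p-form ω of the previous step. -/
theorem nontrivial_form (hp : p ≤ n) : ∃ ω : Form n p, ω ≠ 0 := by
  induction p with
  | zero =>
    refine ⟨(ContinuousAlternatingMap.constOfIsEmpty ℝ (Euc n) (Fin 0) (1 : ℂ)), fun h => ?_⟩
    have := congrArg (evalAt ![]) h
    rw [map_zero] at this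
    exact one_ne_zero (α := ℂ) this
  | succ p ih =>
    obtain ⟨ω, hω⟩ := ih (by omega)
    by_contra! h
    have h1 := sum_intMul_extMul ω
    simp only [h, map_zero, Finset.sum_const_zero] at h1
    have h2 : (n : ℂ) - p ≠ 0 := by
      rw [sub_ne_zero]
      exact_mod_cast (by omega : n ≠ p)
    exact smul_ne_zero h2 hω h1.symm

theorem form_eq_zero (hp : n < p) (ω : Form n p) : ω = 0 := by
  refine Form.ext fun v => ?_
  rw [map_zero]
  refine AlternatingMap.map_linearDependent
    (ContinuousAlternatingMap.toAlternatingMap (ω : (Euc n) [⋀^Fin p]→L[ℝ] ℂ)) v fun h => ?_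
  have := h.fintype_card_le_finrank
  simp at this
  omega

theorem intExt_top (x : Euc n) : intExt n n x = 0 := by
  ext1 ω
  change intMul x (extMul x ω) = 0
  rw [form_eq_zero (Nat.lt_succ_self n) (extMul x ω), map_zero]

theorem intExt_smul (c : ℝ) (x : Euc n) : intExt n p (c • x) = ((c ^ 2 : ℝ) : ℂ) • intExt n p x := by
  ext1 ω
  change intMul _ (extMul _ ω) = ((c ^ 2 : ℝ) : ℂ) • intMul x (extMul x ω)
  rw [intMul_smul, extMul_smul, map_smul, smul_smul]
  push_cast
  ring_nf

theorem extInt_smul (c : ℝ) (x : Euc n) : extInt n p (c • x) = ((c ^ 2 : ℝ) : ℂ) • extInt n p x := by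
  cases p with
  | zero => simp [extInt]
  | succ p =>
    ext1 ω
    change extMul _ (intMul _ ω) = ((c ^ 2 : ℝ) : ℂ) • extMul x (intMul x ω)
    rw [intMul_smul, extMul_smul, map_smul, smul_smul]
    push_cast
    ring_nf

/-- Together with `intExt_extInt` and `intExt_add_extInt`: on unit vectors i_x ε_x and ε_x i_x are
complementary projections. -/
theorem intExt_intExt (x : Euc n) (ω : Form n p) :
    intExt n p x (intExt n p x ω) = ((‖x‖ ^ 2 : ℝ) : ℂ) • intExt n p x ω := by
  change intMul x (extMul x (intMul x (extMul x ω))) = _ • intMul x (extMul x ω)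
  have := intMul_extMul x x (extMul x ω)
  rw [extMul_extMul_self, map_zero, eq_comm, sub_eq_zero, real_inner_self_eq_norm_sq] at this
  rw [← this, map_smul]

theorem intExt_extInt (x : Euc n) (ω : Form n p) : intExt n p x (extInt n p x ω) = 0 := by
  cases p with
  | zero => simp [extInt]
  | succ p =>
    change intMul x (extMul x (extMul x (intMul x ω))) = 0
    rw [extMul_extMul_self, map_zero]

/-- The endomorphisms `a i_x ε_x + b ε_x i_x` all vanish only for trivial reasons. -/
theorem coeff_eq_zero_of_forall (hp : p ≤ n) {a b : ℂ}
    (h : ∀ x, a • intExt n p x + b • extInt n p x = 0) : (p < n → a = 0) ∧ (0 < p → b = 0) := by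
  obtain ⟨ω, hω⟩ := nontrivial_form hp
  have h' : ∀ k, a • intExt n p (stdB n k) ω + b • extInt n p (stdB n k) ω = 0 := fun k => by
    simpa using congrArg (fun L : FormEnd n p => L ω) (h (stdB n k))
  -- Projecting with i_x ε_x at a unit vector separates the two terms; summing over the basis then
  -- turns them into the traces n - p and p.
  have ha : ∀ k, a • intExt n p (stdB n k) ω = 0 := fun k => by
    have := congrArg (intExt n p (stdB n k)) (h' k)
    simpa [intExt_intExt, intExt_extInt] using this
  have hb : ∀ k, b • extInt n p (stdB n k) ω = 0 := fun k => by
    have := h' k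
    rwa [ha, zero_add] at this
  have hA : a • ((n : ℂ) - p) • ω = 0 := by
    rw [← sum_intMul_extMul, Finset.smul_sum]
    exact Finset.sum_eq_zero fun k _ => ha k
  have hB : b • (p : ℂ) • ω = 0 := by
    rw [← sum_extInt, Finset.smul_sum]
    exact Finset.sum_eq_zero fun k _ => hb k
  constructor
  · intro hpn
    have : (n : ℂ) - p ≠ 0 := by
      rw [sub_ne_zero]
      exact_mod_cast hpn.ne'
    simpa [hω, this] using hA
  · intro hp0
    simpa [hω, hp0.ne'] using hB

end Algebra

/-! ### The Euler operator on Schwartz functions and vanishing at the origin. -/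

section Schwartz

variable {n : ℕ}

/-- The `k`-th complex valued coordinate function. -/
noncomputable def coordC (n : ℕ) (k : Fin n) : Euc n →L[ℝ] ℂ :=
  Complex.ofRealCLM ∘L (EuclideanSpace.proj k)

theorem coordC_apply (k : Fin n) (x : Euc n) : coordC n k x = (x k : ℂ) := rfl

theorem norm_coordC_le (k : Fin n) (x : Euc n) : ‖coordC n k x‖ ≤ ‖x‖ := by
  rw [coordC_apply, Complex.norm_real]
  exact PiLp.norm_apply_le x k

/-- Multiplication of Schwartz functions by the `k`-th coordinate. -/
noncomputable def coordMul (k : Fin n) : 𝓢(Euc n, ℂ) →L[ℂ] 𝓢(Euc n, ℂ) :=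
  SchwartzMap.smulLeftCLM ℂ (coordC n k)

theorem coordMul_apply (k : Fin n) (φ : 𝓢(Euc n, ℂ)) (x : Euc n) :
    coordMul k φ x = coordC n k x * φ x :=
  SchwartzMap.smulLeftCLM_apply_apply (coordC n k).hasTemperateGrowth φ x

/-- The `k`-th partial derivative of Schwartz functions. -/
noncomputable def partialS (k : Fin n) : 𝓢(Euc n, ℂ) →L[ℂ] 𝓢(Euc n, ℂ) :=
  LineDeriv.lineDerivOpCLM ℂ 𝓢(Euc n, ℂ) (stdB n k)

theorem partialS_apply (k : Fin n) (φ : 𝓢(Euc n, ℂ)) (x : Euc n) :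
    partialS k φ x = fderiv ℝ φ x (stdB n k) :=
  SchwartzMap.lineDerivOp_apply_eq_fderiv _ _ _

/-- The Euler operator `∑ₖ xₖ ∂ₖ` on Schwartz functions. -/
noncomputable def euler (n : ℕ) : 𝓢(Euc n, ℂ) →L[ℂ] 𝓢(Euc n, ℂ) :=
  ∑ k, coordMul k ∘L partialS k

theorem euler_eq_sum (φ : 𝓢(Euc n, ℂ)) : euler n φ = ∑ k, coordMul k (partialS k φ) := by
  simp [euler]

theorem schwartz_sum_apply {ι : Type*} (s : Finset ι) (f : ι → 𝓢(Euc n, ℂ)) (x : Euc n) :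
    (∑ i ∈ s, f i) x = ∑ i ∈ s, f i x := by
  classical
  induction s using Finset.induction_on with
  | empty => simp
  | insert a s ha ih => rw [Finset.sum_insert ha, Finset.sum_insert ha, add_apply, ih]

theorem euler_apply (φ : 𝓢(Euc n, ℂ)) (x : Euc n) : euler n φ x = fderiv ℝ φ x x := by
  rw [euler_eq_sum, schwartz_sum_apply]
  conv_rhs => rw [← sum_smul_stdB x, map_sum]
  refine Finset.sum_congr rfl fun k _ => ?_
  rw [coordMul_apply, partialS_apply, sum_smul_stdB, map_smul, Complex.real_smul, coordC_apply]

/-- A coordinate has degree one, so moving `E` past it gives `E + 1`; every shift of the roots by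
one below comes from this. -/
theorem euler_coordMul (k : Fin n) (φ : 𝓢(Euc n, ℂ)) :
    euler n (coordMul k φ) = coordMul k (euler n φ + φ) := by
  ext x
  rw [euler_apply, coordMul_apply, add_apply, euler_apply]
  have h : HasFDerivAt (coordMul k φ)
      (coordC n k x • fderiv ℝ φ x + φ x • coordC n k) x := by
    have := (coordC n k).hasFDerivAt.mul (φ.hasFDerivAt x)
    exact this.congr_of_eventuallyEq (Eventually.of_forall fun y => coordMul_apply k φ y)
  rw [h.fderiv]
  simp only [add_apply, smul_apply, smul_eq_mul]
  ring

/-- The product of the operators `E - c i` for `i < M`, with `E` the Euler operator. -/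
noncomputable def eulerProd (n : ℕ) (c : ℕ → ℂ) : ℕ → 𝓢(Euc n, ℂ) →L[ℂ] 𝓢(Euc n, ℂ)
  | 0 => ContinuousLinearMap.id ℂ _
  | M + 1 => (euler n - c M • ContinuousLinearMap.id ℂ _) ∘L eulerProd n c M

theorem eulerProd_succ (c : ℕ → ℂ) (M : ℕ) (φ : 𝓢(Euc n, ℂ)) :
    eulerProd n c (M + 1) φ = euler n (eulerProd n c M φ) - c M • eulerProd n c M φ := rfl

theorem eulerProd_euler (c : ℕ → ℂ) (M : ℕ) (φ : 𝓢(Euc n, ℂ)) :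
    eulerProd n c M (euler n φ) = euler n (eulerProd n c M φ) := by
  induction M with
  | zero => rfl
  | succ M ih => simp only [eulerProd_succ, ih, map_sub, map_smul]

theorem eulerProd_succ' (c : ℕ → ℂ) (M : ℕ) (φ : 𝓢(Euc n, ℂ)) :
    eulerProd n c (M + 1) φ = eulerProd n (fun i => c (i + 1)) M (euler n φ - c 0 • φ) := by
  induction M with
  | zero => rfl
  | succ M ih => rw [eulerProd_succ, ih, ← eulerProd_succ (fun i => c (i + 1))]

theorem eulerProd_coordMul (c : ℕ → ℂ) (M : ℕ) (k : Fin n) (φ : 𝓢(Euc n, ℂ)) :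
    eulerProd n (fun i => c i + 1) M (coordMul k φ) = coordMul k (eulerProd n c M φ) := by
  induction M with
  | zero => rfl
  | succ M ih =>
    rw [eulerProd_succ, eulerProd_succ, ih, euler_coordMul]
    simp only [map_add, map_sub, map_smul]
    module

/-- `∏_{i<M} (E - 2i)`. -/
noncomputable abbrev evenProd (n M : ℕ) := eulerProd n (fun i => 2 * (i : ℂ)) M

/-- `∏_{i<M} (E - (2i+1))`. -/
noncomputable abbrev oddProd (n M : ℕ) := eulerProd n (fun i => 2 * (i : ℂ) + 1) M

/-- The factor with i = 0 is `E` itself, the sum of x_k ∂_k. Moving the factors E - 2(i+1) past x_k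
turns them into E - (2i+1), so one power of x is gained. -/
theorem evenProd_succ_eq_sum (M : ℕ) (φ : 𝓢(Euc n, ℂ)) :
    evenProd n (M + 1) φ = ∑ k, coordMul k (oddProd n M (partialS k φ)) := by
  rw [evenProd, eulerProd_succ']
  simp only [Nat.cast_zero, mul_zero, zero_smul, sub_zero]
  rw [euler_eq_sum, map_sum]
  refine Finset.sum_congr rfl fun k _ => ?_
  rw [← eulerProd_coordMul]
  congr 2
  ext i
  push_cast
  ring

theorem euler_oddProd_eq_sum (M : ℕ) (φ : 𝓢(Euc n, ℂ)) :
    euler n (oddProd n M φ) = ∑ k, coordMul k (evenProd n M (partialS k φ)) := by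
  rw [← eulerProd_euler, euler_eq_sum, map_sum]
  exact Finset.sum_congr rfl fun k _ => eulerProd_coordMul _ _ _ _

theorem eulerProd_apply_zero (c : ℕ → ℂ) (M : ℕ) {φ : 𝓢(Euc n, ℂ)} (h : φ 0 = 0) :
    eulerProd n c M φ 0 = 0 := by
  induction M with
  | zero => exact h
  | succ M ih =>
    rw [eulerProd_succ, sub_apply, smul_apply, ih, euler_apply]
    simp

/-- Integration along rays: the derivative of f(t x) is (E f)(t x) / t, and the exponent a + 1 ≥ 1
absorbs the division by t. -/
theorem norm_le_of_euler_le {f : 𝓢(Euc n, ℂ)} (h0 : f 0 = 0) {C : ℝ} {a : ℕ} (hC : 0 ≤ C)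
    (h : ∀ x, ‖euler n f x‖ ≤ C * ‖x‖ ^ (a + 1)) (x : Euc n) : ‖f x‖ ≤ C * ‖x‖ ^ (a + 1) := by
  have hder : ∀ t : ℝ, HasDerivAt (fun t : ℝ => f (t • x)) (fderiv ℝ f (t • x) x) t := fun t => by
    have h1 : HasDerivAt (fun t : ℝ => t • x) x t := by
      simpa using (hasDerivAt_id t).smul_const x
    exact (f.hasFDerivAt (t • x)).comp_hasDerivAt t h1
  have hb : ∀ t ∈ Set.Ioc (0 : ℝ) 1, ‖fderiv ℝ f (t • x) x‖ ≤ C * ‖x‖ ^ (a + 1) := fun t ht => by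
    have h1 := h (t • x)
    rw [euler_apply, map_smul, norm_smul, norm_smul, Real.norm_of_nonneg ht.1.le, mul_pow,
      pow_succ t, mul_comm (t ^ a), mul_assoc, mul_left_comm] at h1
    refine (le_of_mul_le_mul_left h1 ht.1).trans ?_
    refine mul_le_mul_of_nonneg_left ?_ hC
    exact mul_le_of_le_one_left (by positivity) (pow_le_one₀ ht.1.le ht.2)
  -- The derivative bound is available for t > 0 only, so the segment starts at s and s tends to 0
  -- afterwards.
  have hs : ∀ s ∈ Set.Ioc (0 : ℝ) 1, ‖f x - f (s • x)‖ ≤ C * ‖x‖ ^ (a + 1) := fun s hs => by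
    have := norm_image_sub_le_of_norm_deriv_le_segment' (f := fun t : ℝ => f (t • x))
      (a := s) (b := 1) (C := C * ‖x‖ ^ (a + 1)) (fun t _ => (hder t).hasDerivWithinAt)
      (fun t ht => hb t ⟨hs.1.trans_le ht.1, ht.2.le⟩) 1 ⟨hs.2, le_rfl⟩
    simp only [one_smul] at this
    refine this.trans (mul_le_of_le_one_right (by positivity) (by linarith [hs.1]))
  have hcont : Continuous fun s : ℝ => ‖f x - f (s • x)‖ := by
    have := f.continuous
    fun_prop
  have hlim : Tendsto (fun s : ℝ => ‖f x - f (s • x)‖) (𝓝[>] 0) (𝓝 ‖f x‖) := by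
    have := (hcont.tendsto 0).mono_left (nhdsWithin_le_nhds (s := Set.Ioi 0))
    simpa [h0] using this
  refine le_of_tendsto hlim ?_
  filter_upwards [Ioc_mem_nhdsGT (zero_lt_one' ℝ)] with s hs' using hs s hs'

theorem norm_sum_coordMul_le (f : Fin n → 𝓢(Euc n, ℂ)) (p : Fin n → ℝ) (a : ℕ) (x : Euc n)
    (h : ∀ k, ‖f k x‖ ≤ p k * ‖x‖ ^ a) :
    ‖(∑ k, coordMul k (f k)) x‖ ≤ (∑ k, p k) * ‖x‖ ^ (a + 1) := by
  rw [schwartz_sum_apply, Finset.sum_mul]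
  refine norm_sum_le_of_le _ fun k _ => ?_
  rw [coordMul_apply, norm_mul]
  calc _ ≤ ‖x‖ * (p k * ‖x‖ ^ a) :=
        mul_le_mul (norm_coordC_le k x) (h k) (norm_nonneg _) (norm_nonneg _)
    _ = _ := by ring

/-- Pulling back Schwartz functions along `x ↦ -x`. -/
noncomputable def reflS (n : ℕ) : 𝓢(Euc n, ℂ) →L[ℂ] 𝓢(Euc n, ℂ) :=
  SchwartzMap.compCLMOfContinuousLinearEquiv ℂ (ContinuousLinearEquiv.neg ℝ)

theorem reflS_apply (φ : 𝓢(Euc n, ℂ)) (x : Euc n) : reflS n φ x = φ (-x) := rfl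

theorem partialS_reflS (k : Fin n) (φ : 𝓢(Euc n, ℂ)) :
    reflS n (partialS k φ) = -partialS k (reflS n φ) := by
  have h := SchwartzMap.lineDerivOp_compCLMOfContinuousLinearEquiv ℂ (stdB n k)
    (ContinuousLinearEquiv.neg ℝ) φ
  change partialS k (reflS n φ) = reflS n (∂_{-stdB n k} φ) at h
  rw [h, LineDeriv.lineDerivOp_left_neg, map_neg, neg_neg]
  rfl

/-- The sum of the pullbacks of a seminorm along the partial derivatives. -/
noncomputable def sumPartial (p : Seminorm ℂ 𝓢(Euc n, ℂ)) : Seminorm ℂ 𝓢(Euc n, ℂ) :=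
  ∑ k : Fin n, p.comp (partialS k).toLinearMap

theorem seminorm_sum_apply {ι : Type*} (s : Finset ι) (p : ι → Seminorm ℂ 𝓢(Euc n, ℂ))
    (ψ : 𝓢(Euc n, ℂ)) : (∑ k ∈ s, p k) ψ = ∑ k ∈ s, p k ψ := by
  classical
  induction s using Finset.induction_on with
  | empty => simp
  | insert a s ha ih => rw [Finset.sum_insert ha, Finset.sum_insert ha, add_apply, ih]

theorem sumPartial_apply (p : Seminorm ℂ 𝓢(Euc n, ℂ)) (ψ : 𝓢(Euc n, ℂ)) :
    sumPartial p ψ = ∑ k, p (partialS k ψ) :=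
  seminorm_sum_apply _ _ _

theorem continuous_sumPartial {p : Seminorm ℂ 𝓢(Euc n, ℂ)} (hp : Continuous p) :
    Continuous (sumPartial p) := by
  rw [show (⇑(sumPartial p) : 𝓢(Euc n, ℂ) → ℝ) = fun ψ => ∑ k, p (partialS k ψ) from
    funext fun ψ => sumPartial_apply p ψ]
  exact continuous_finsetSum _ fun k _ => hp.comp (partialS k).continuous

theorem continuous_sup_seminorm (m : ℕ × ℕ) {s : Seminorm ℂ 𝓢(Euc n, ℂ)}
    (hs : s = (Finset.Iic m).sup fun m => SchwartzMap.seminorm ℂ m.1 m.2) : Continuous s := by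
  have h := Seminorm.finset_sup_le_sum
    (fun m : ℕ × ℕ => SchwartzMap.seminorm ℂ (E := Euc n) (F := ℂ) m.1 m.2) (Finset.Iic m)
  rw [← hs] at h
  refine Seminorm.continuous_of_le (q := ∑ i ∈ Finset.Iic m, SchwartzMap.seminorm ℂ i.1 i.2) ?_ h
  set t : Seminorm ℂ 𝓢(Euc n, ℂ) := ∑ i ∈ Finset.Iic m, SchwartzMap.seminorm ℂ i.1 i.2 with ht
  rw [show (⇑t : 𝓢(Euc n, ℂ) → ℝ) = fun ψ => ∑ i ∈ Finset.Iic m, SchwartzMap.seminorm ℂ i.1 i.2 ψ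
    from funext fun ψ => seminorm_sum_apply _ _ ψ]
  exact continuous_finsetSum _ fun i _ =>
    (schwartz_withSeminorms ℂ (Euc n) ℂ).continuous_seminorm i

/-- The partial derivatives of an odd function are even, so `euler_oddProd_eq_sum` bounds `E` of the
function, and integration along rays recovers the function itself; it vanishes at 0 by oddness. -/
theorem oddProd_bound_of_evenProd_bound {M : ℕ}
    (h : ∃ p : Seminorm ℂ 𝓢(Euc n, ℂ), Continuous p ∧ ∀ ψ, reflS n ψ = ψ → ∀ x,
      ‖evenProd n M ψ x‖ ≤ p ψ * ‖x‖ ^ (2 * M)) :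
    ∃ p : Seminorm ℂ 𝓢(Euc n, ℂ), Continuous p ∧ ∀ ψ, reflS n ψ = -ψ → ∀ x,
      ‖oddProd n M ψ x‖ ≤ p ψ * ‖x‖ ^ (2 * M + 1) := by
  obtain ⟨p, hp, h⟩ := h
  refine ⟨_, continuous_sumPartial hp, fun ψ hψ x => ?_⟩
  rw [sumPartial_apply]
  refine norm_le_of_euler_le ?_ (Finset.sum_nonneg fun k _ => apply_nonneg p _) (fun y => ?_) x
  · refine eulerProd_apply_zero _ _ ?_
    have h0 : ψ 0 = -ψ 0 := by simpa [reflS_apply] using congrArg (fun f => f 0) hψ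
    exact self_eq_neg.mp h0
  · rw [euler_oddProd_eq_sum]
    refine norm_sum_coordMul_le _ _ _ _ fun k => h _ ?_ _
    rw [partialS_reflS, hψ, map_neg, neg_neg]

/-- Induction alternating with odd functions, gaining one power of |x| at each of the two steps;
this replaces Taylor expansion. The constant is a continuous seminorm because it must later give
continuity of a distribution. -/
theorem exists_evenProd_bound (M : ℕ) :
    ∃ p : Seminorm ℂ 𝓢(Euc n, ℂ), Continuous p ∧ ∀ ψ, reflS n ψ = ψ → ∀ x,
      ‖evenProd n M ψ x‖ ≤ p ψ * ‖x‖ ^ (2 * M) := by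
  induction M with
  | zero =>
    refine ⟨SchwartzMap.seminorm ℂ 0 0,
      (schwartz_withSeminorms ℂ (Euc n) ℂ).continuous_seminorm (0, 0), fun ψ _ x => ?_⟩
    simpa [evenProd, eulerProd] using SchwartzMap.norm_le_seminorm ℂ ψ x
  | succ M ih =>
    obtain ⟨p, hp, h⟩ := oddProd_bound_of_evenProd_bound ih
    refine ⟨_, continuous_sumPartial hp, fun ψ hψ x => ?_⟩
    rw [sumPartial_apply, evenProd_succ_eq_sum]
    refine norm_sum_coordMul_le _ _ (2 * M + 1) _ fun k => h _ ?_ _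
    rw [partialS_reflS, hψ]

/-- The even part of a Schwartz function. -/
noncomputable def evenPart (n : ℕ) : 𝓢(Euc n, ℂ) →L[ℂ] 𝓢(Euc n, ℂ) :=
  (2⁻¹ : ℂ) • (ContinuousLinearMap.id ℂ _ + reflS n)

theorem evenPart_apply (φ : 𝓢(Euc n, ℂ)) (x : Euc n) :
    evenPart n φ x = 2⁻¹ * (φ x + φ (-x)) := rfl

theorem reflS_evenPart (φ : 𝓢(Euc n, ℂ)) : reflS n (evenPart n φ) = evenPart n φ := by
  ext x
  rw [reflS_apply, evenPart_apply, evenPart_apply, neg_neg, add_comm]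

/-- The functions `f` of modulus at most `c ‖x‖ᵃ (1 + ‖x‖)⁻ᴺ`. -/
def DecayBound (f : Euc n → ℂ) (c : ℝ) (a N : ℕ) : Prop :=
  ∀ x, ‖f x‖ * (1 + ‖x‖) ^ N ≤ c * ‖x‖ ^ a

/-- In the unit ball the assumed vanishing order suffices; outside it |x|^a ≥ 1 and Schwartz decay
takes over. -/
theorem exists_seminorm_decay (L : 𝓢(Euc n, ℂ) →L[ℂ] 𝓢(Euc n, ℂ)) (a N : ℕ)
    (p : Seminorm ℂ 𝓢(Euc n, ℂ)) (hp : Continuous p) :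
    ∃ q : Seminorm ℂ 𝓢(Euc n, ℂ), Continuous q ∧
      ∀ φ, (∀ x, ‖L φ x‖ ≤ p φ * ‖x‖ ^ a) → DecayBound (L φ) (q φ) a N := by
  set s : Seminorm ℂ 𝓢(Euc n, ℂ) :=
    (Finset.Iic (N, 0)).sup fun m => SchwartzMap.seminorm ℂ m.1 m.2 with hs
  have hsc : Continuous s := continuous_sup_seminorm (N, 0) hs
  refine ⟨(2 ^ N : NNReal) • p + (2 ^ N : NNReal) • s.comp L.toLinearMap, ?_, fun φ hφ x => ?_⟩
  · change Continuous fun φ => (2 ^ N : NNReal) • p φ + (2 ^ N : NNReal) • s (L φ)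
    have := hsc.comp L.continuous
    fun_prop
  · change _ ≤ ((2 ^ N : NNReal) • p φ + (2 ^ N : NNReal) • s (L φ)) * ‖x‖ ^ a
    simp only [NNReal.smul_def, NNReal.coe_pow, NNReal.coe_ofNat, smul_eq_mul]
    have h1 : 0 ≤ p φ := apply_nonneg _ _
    have h2 : 0 ≤ s (L φ) := apply_nonneg _ _
    rcases le_total ‖x‖ 1 with hx | hx
    · calc ‖L φ x‖ * (1 + ‖x‖) ^ N ≤ (p φ * ‖x‖ ^ a) * 2 ^ N := by
            gcongr
            · exact hφ x
            · linarith
        _ ≤ _ := by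
            rw [add_mul]
            have : 0 ≤ 2 ^ N * s (L φ) * ‖x‖ ^ a := by positivity
            linarith
    · have h3 := SchwartzMap.one_add_le_sup_seminorm_apply (𝕜 := ℂ) (m := (N, 0)) (k := N) (n := 0)
        le_rfl le_rfl (L φ) x
      rw [norm_iteratedFDeriv_zero] at h3
      rw [mul_comm]
      refine h3.trans ?_
      calc 2 ^ N * s (L φ) ≤ 2 ^ N * p φ + 2 ^ N * s (L φ) := by
            have : 0 ≤ 2 ^ N * p φ := by positivity
            linarith
        _ ≤ _ := le_mul_of_one_le_right (by positivity) (one_le_pow₀ hx)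

/-- `∏_{i<M} (E - 2i)` applied to the even part. -/
noncomputable def evenCut (n M : ℕ) : 𝓢(Euc n, ℂ) →L[ℂ] 𝓢(Euc n, ℂ) :=
  evenProd n M ∘L evenPart n

theorem exists_evenCut_bound (n M N : ℕ) :
    ∃ q : Seminorm ℂ 𝓢(Euc n, ℂ), Continuous q ∧
      ∀ φ, DecayBound (evenCut n M φ) (q φ) (2 * M) N := by
  obtain ⟨p, hp, h⟩ := exists_evenProd_bound (n := n) M
  obtain ⟨q, hq, h'⟩ := exists_seminorm_decay (evenCut n M) (2 * M) N
    (p.comp (evenPart n).toLinearMap) (hp.comp (evenPart n).continuous)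
  exact ⟨q, hq, fun φ => h' φ fun x => h _ (reflS_evenPart φ) x⟩

theorem exists_decayBound (φ : 𝓢(Euc n, ℂ)) {c : ℝ} {a : ℕ} (h : ∀ x, ‖φ x‖ ≤ c * ‖x‖ ^ a)
    (N : ℕ) : ∃ C, 0 ≤ C ∧ DecayBound φ C a N := by
  have h3 := fun x => SchwartzMap.one_add_le_sup_seminorm_apply (𝕜 := ℂ) (m := (N, 0)) (k := N)
    (n := 0) le_rfl le_rfl φ x
  set s := ((Finset.Iic (N, 0)).sup fun m => SchwartzMap.seminorm ℂ m.1 m.2) φ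
  have h2 : 0 ≤ s := apply_nonneg _ _
  refine ⟨2 ^ N * |c| + 2 ^ N * s, by positivity, fun x => ?_⟩
  rcases le_total ‖x‖ 1 with hx | hx
  · calc ‖φ x‖ * (1 + ‖x‖) ^ N ≤ (|c| * ‖x‖ ^ a) * 2 ^ N := by
          gcongr
          · exact (h x).trans (by gcongr; exact le_abs_self c)
          · linarith
      _ ≤ _ := by
          rw [add_mul]
          have : 0 ≤ 2 ^ N * s * ‖x‖ ^ a := by positivity
          linarith
  · have h3 := h3 x
    rw [norm_iteratedFDeriv_zero] at h3
    rw [mul_comm]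
    refine h3.trans ?_
    calc 2 ^ N * s ≤ 2 ^ N * |c| + 2 ^ N * s := by
          have : 0 ≤ 2 ^ N * |c| := by positivity
          linarith
      _ ≤ _ := le_mul_of_one_le_right (by positivity) (one_le_pow₀ hx)

end Schwartz

/-! ### Integrals against homogeneous kernels: convergence, holomorphy, scaling. -/

section Kernel

variable {n : ℕ} {V : Type*} [NormedAddCommGroup V] [NormedSpace ℂ V]

/-- Continuous functions that are homogeneous of degree two. -/
structure IsQuad (q : Euc n → V) : Prop where
  cont : Continuous q
  hom : ∀ (c : ℝ) (x : Euc n), q (c • x) = ((c ^ 2 : ℝ) : ℂ) • q x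

/-- The kernel `|x|^(z-2) q(x)`. -/
noncomputable def kern (q : Euc n → V) (z : ℂ) (x : Euc n) : V := ((‖x‖ : ℂ) ^ (z - 2)) • q x

theorem IsQuad.zero {q : Euc n → V} (hq : IsQuad q) : q 0 = 0 := by
  simpa using hq.hom 0 0

theorem IsQuad.bound {q : Euc n → V} (hq : IsQuad q) : ∃ C, 0 ≤ C ∧ ∀ x, ‖q x‖ ≤ C * ‖x‖ ^ 2 := by
  obtain ⟨C, hC⟩ := (isCompact_closedBall (0 : Euc n) 1).exists_bound_of_continuousOn
    hq.cont.continuousOn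
  have h0 : 0 ≤ C := (norm_nonneg _).trans (hC 0 (by simp))
  refine ⟨C, h0, fun x => ?_⟩
  rcases eq_or_ne x 0 with rfl | hx
  · simp [hq.zero]
  · have hx' : 0 < ‖x‖ := norm_pos_iff.mpr hx
    have h1 : x = ‖x‖ • (‖x‖⁻¹ • x) := by rw [smul_smul, mul_inv_cancel₀ hx'.ne', one_smul]
    have h2 : ‖q (‖x‖⁻¹ • x)‖ ≤ C := hC _ (by
      rw [mem_closedBall_zero_iff, norm_smul, norm_inv, norm_norm, inv_mul_cancel₀ hx'.ne'])
    calc ‖q x‖ = ‖((‖x‖ ^ 2 : ℝ) : ℂ) • q (‖x‖⁻¹ • x)‖ := by rw [← hq.hom, ← h1]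
      _ = ‖x‖ ^ 2 * ‖q (‖x‖⁻¹ • x)‖ := by
          rw [norm_smul, Complex.norm_real, Real.norm_of_nonneg (by positivity)]
      _ ≤ ‖x‖ ^ 2 * C := by gcongr
      _ = _ := mul_comm _ _

theorem kern_zero {q : Euc n → V} (hq : IsQuad q) (z : ℂ) : kern q z 0 = 0 := by
  simp [kern, hq.zero]

theorem norm_kern_le {q : Euc n → V} {C : ℝ} (hC : ∀ x, ‖q x‖ ≤ C * ‖x‖ ^ 2)
    (z : ℂ) {x : Euc n} (hx : x ≠ 0) : ‖kern q z x‖ ≤ C * ‖x‖ ^ z.re := by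
  have hx' : 0 < ‖x‖ := norm_pos_iff.mpr hx
  rw [kern, norm_smul, Complex.norm_cpow_eq_rpow_re_of_pos hx']
  calc ‖x‖ ^ (z - 2).re * ‖q x‖ ≤ ‖x‖ ^ (z - 2).re * (C * ‖x‖ ^ 2) := by
        gcongr
        exact hC x
    _ = C * (‖x‖ ^ (z - 2).re * ‖x‖ ^ (2 : ℝ)) := by
        rw [Real.rpow_two]; ring
    _ = _ := by
        rw [← Real.rpow_add hx']
        simp

theorem kern_smul {q : Euc n → V} (hq : IsQuad q) (z : ℂ) {t : ℝ} (ht : 0 < t) (x : Euc n) :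
    kern q z (t • x) = ((t : ℂ) ^ z) • kern q z x := by
  rw [kern, kern, hq.hom, norm_smul, Real.norm_of_nonneg ht.le, Complex.ofReal_mul,
    Complex.mul_cpow_ofReal_nonneg ht.le (norm_nonneg x), smul_smul, smul_smul]
  congr 1
  have h : (t : ℂ) ^ z = (t : ℂ) ^ (z - 2) * (t : ℂ) ^ 2 := by
    rw [← Complex.cpow_ofNat, ← Complex.cpow_add _ _ (by exact_mod_cast ht.ne')]
    simp
  rw [h]
  push_cast
  ring

theorem stronglyMeasurable_kern {q : Euc n → V} (hq : IsQuad q) (z : ℂ) :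
    StronglyMeasurable (kern q z) := by
  have h : Measurable fun x : Euc n => (‖x‖ : ℂ) ^ (z - 2) :=
    (Complex.measurable_ofReal.comp measurable_norm).pow_const _
  exact h.stronglyMeasurable.smul hq.cont.stronglyMeasurable

/-- The function `‖x‖^σ (1 + ‖x‖)⁻ᴺ`. -/
noncomputable def weight (n : ℕ) (σ : ℝ) (N : ℕ) (x : Euc n) : ℝ := ‖x‖ ^ σ * ((1 + ‖x‖) ^ N)⁻¹

theorem weight_nonneg (σ : ℝ) (N : ℕ) (x : Euc n) : 0 ≤ weight n σ N x := by
  unfold weight; positivity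

/-- In polar coordinates the radial density is r^(n-1+σ) (1+r)^(-N): the first hypothesis gives
convergence at 0, the second at infinity. -/
theorem integrable_weight [NeZero n] {σ : ℝ} {N : ℕ} (h1 : -(n : ℝ) < σ) (h2 : σ + n < N) :
    Integrable (weight n σ N) := by
  have hn : 1 ≤ n := NeZero.one_le
  have : Integrable (fun x : Euc n => (fun r : ℝ => r ^ σ * ((1 + r) ^ N)⁻¹) ‖x‖) := by
    rw [integrable_fun_norm_addHaar volume (f := fun r : ℝ => r ^ σ * ((1 + r) ^ N)⁻¹)]
    rw [← Set.Ioc_union_Ioi_eq_Ioi zero_le_one]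
    have hm : AEStronglyMeasurable
        (fun y : ℝ => y ^ (Module.finrank ℝ (Euc n) - 1) • (y ^ σ * ((1 + y) ^ N)⁻¹)) := by
      have : Measurable
        (fun y : ℝ => y ^ (Module.finrank ℝ (Euc n) - 1) • (y ^ σ * ((1 + y) ^ N)⁻¹)) := by
        fun_prop
      exact this.aestronglyMeasurable
    have key : ∀ y : ℝ, 0 < y → ‖y ^ (Module.finrank ℝ (Euc n) - 1) • (y ^ σ * ((1 + y) ^ N)⁻¹)‖
        = y ^ ((n : ℝ) - 1 + σ) * ((1 + y) ^ N)⁻¹ := fun y hy => by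
      rw [Real.norm_of_nonneg (by positivity), finrank_euclideanSpace_fin, smul_eq_mul,
        Real.rpow_add hy, ← mul_assoc, ← Real.rpow_natCast y (n - 1), Nat.cast_sub hn, Nat.cast_one]
    refine IntegrableOn.union ?_ ?_
    · refine Integrable.mono' (g := fun y => y ^ ((n : ℝ) - 1 + σ)) ?_ hm.restrict ?_
      · have := (intervalIntegral.intervalIntegrable_rpow' (a := 0) (b := 1)
          (by linarith : -1 < (n : ℝ) - 1 + σ)).1
        exact this
      · refine (ae_restrict_mem measurableSet_Ioc).mono fun y hy => ?_
        rw [key y hy.1]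
        have := hy.1
        refine mul_le_of_le_one_right (by positivity) (inv_le_one_of_one_le₀ ?_)
        exact one_le_pow₀ (by linarith)
    · refine Integrable.mono' (g := fun y => y ^ ((n : ℝ) - 1 + σ - N)) ?_ hm.restrict ?_
      · exact integrableOn_Ioi_rpow_of_lt (by linarith) one_pos
      · refine (ae_restrict_mem measurableSet_Ioi).mono fun y (hy : 1 < y) => ?_
        have hy0 : 0 < y := by linarith
        rw [key y hy0, Real.rpow_sub hy0, Real.rpow_natCast, div_eq_mul_inv]
        gcongr
        linarith
  exact this

theorem norm_smul_kern_le {q : Euc n → V} (hq : IsQuad q) {C : ℝ} (hC0 : 0 ≤ C)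
    (hC : ∀ x, ‖q x‖ ≤ C * ‖x‖ ^ 2) {f : Euc n → ℂ} {c : ℝ} (hc : 0 ≤ c) {a N : ℕ}
    (hf : DecayBound f c a N) (z : ℂ) (x : Euc n) :
    ‖f x • kern q z x‖ ≤ c * C * weight n (a + z.re) N x := by
  rcases eq_or_ne x 0 with rfl | hx
  · rw [kern_zero hq, smul_zero, norm_zero]
    have := weight_nonneg (n := n) (a + z.re) N 0
    positivity
  · have hx' : 0 < ‖x‖ := norm_pos_iff.mpr hx
    have h1 : ‖f x‖ ≤ c * ‖x‖ ^ a * ((1 + ‖x‖) ^ N)⁻¹ := by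
      rw [← div_eq_mul_inv, le_div_iff₀ (by positivity)]
      exact hf x
    rw [norm_smul]
    calc ‖f x‖ * ‖kern q z x‖ ≤ (c * ‖x‖ ^ a * ((1 + ‖x‖) ^ N)⁻¹) * (C * ‖x‖ ^ z.re) := by
          gcongr
          exact norm_kern_le hC z hx
      _ = _ := by
          rw [weight, Real.rpow_add hx', Real.rpow_natCast]
          ring

/-- The pairing `∫ f(x) |x|^(z-2) q(x) dx`. -/
noncomputable def kernInt (q : Euc n → V) (z : ℂ) (f : Euc n → ℂ) : V := ∫ x, f x • kern q z x

theorem integrable_smul_kern [NeZero n] {q : Euc n → V} (hq : IsQuad q) {f : Euc n → ℂ}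
    (hfc : Continuous f) {c : ℝ} (hc : 0 ≤ c) {a N : ℕ} (hf : DecayBound f c a N) {z : ℂ}
    (h1 : -(n : ℝ) - a < z.re) (h2 : a + z.re + n < N) :
    Integrable fun x => f x • kern q z x := by
  obtain ⟨C, hC0, hC⟩ := hq.bound
  refine ((integrable_weight (by linarith) h2).const_mul (c * C)).mono'
    (hfc.stronglyMeasurable.smul (stronglyMeasurable_kern hq z)).aestronglyMeasurable
    (Eventually.of_forall fun x => norm_smul_kern_le hq hC0 hC hc hf z x)

theorem exists_norm_kernInt_le [NeZero n] {q : Euc n → V} (hq : IsQuad q) {a N : ℕ} {z : ℂ}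
    (h1 : -(n : ℝ) - a < z.re) (h2 : a + z.re + n < N) :
    ∃ K, 0 ≤ K ∧ ∀ (f : Euc n → ℂ) (c : ℝ), 0 ≤ c → DecayBound f c a N →
      ‖kernInt q z f‖ ≤ K * c := by
  obtain ⟨C, hC0, hC⟩ := hq.bound
  refine ⟨C * ∫ x, weight n (a + z.re) N x,
    mul_nonneg hC0 (integral_nonneg fun x => weight_nonneg _ _ _), fun f c hc hf => ?_⟩
  refine (norm_integral_le_of_norm_le
    ((integrable_weight (σ := a + z.re) (N := N) (by linarith) h2).const_mul (c * C))
    (Eventually.of_forall fun x => norm_smul_kern_le hq hC0 hC hc hf z x)).trans ?_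
  rw [integral_const_mul]
  exact le_of_eq (by ring)

theorem abs_log_le_rpow {r ε : ℝ} (hr : 0 < r) (hε : 0 < ε) :
    |Real.log r| ≤ (r ^ ε + r ^ (-ε)) / ε := by
  have h1 := Real.log_le_rpow_div hr.le hε
  have h2 := Real.log_le_rpow_div (inv_nonneg.mpr hr.le) hε
  rw [Real.log_inv, Real.inv_rpow hr.le, ← Real.rpow_neg hr.le] at h2
  have p1 : 0 < r ^ ε / ε := by positivity
  have p2 : 0 < r ^ (-ε) / ε := by positivity
  rw [add_div, abs_le]
  constructor <;> linarith

theorem rpow_le_add_rpow {r s σ τ : ℝ} (hr : 0 < r) (h1 : σ ≤ s) (h2 : s ≤ τ) :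
    r ^ s ≤ r ^ σ + r ^ τ := by
  rcases le_total r 1 with h | h
  · have := Real.rpow_le_rpow_of_exponent_ge hr h h1
    have p : 0 < r ^ τ := by positivity
    linarith
  · have := Real.rpow_le_rpow_of_exponent_le h h2
    have p : 0 < r ^ σ := by positivity
    linarith

/-- The logarithm costs an arbitrarily small power in either direction; this dominates the
z-derivative of the kernel uniformly in a strip. -/
theorem abs_log_mul_weight_le {σ τ s ε : ℝ} (hε : 0 < ε) (h1 : σ + ε ≤ s) (h2 : s ≤ τ - ε) (N : ℕ)
    {x : Euc n} (hx : x ≠ 0) :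
    |Real.log ‖x‖| * weight n s N x ≤ (2 / ε) * (weight n σ N x + weight n τ N x) := by
  have hx' : 0 < ‖x‖ := norm_pos_iff.mpr hx
  simp only [weight]
  rw [← mul_assoc, ← add_mul, ← mul_assoc]
  refine mul_le_mul_of_nonneg_right ?_ (by positivity)
  calc |Real.log ‖x‖| * ‖x‖ ^ s ≤ (‖x‖ ^ ε + ‖x‖ ^ (-ε)) / ε * ‖x‖ ^ s := by
        gcongr
        exact abs_log_le_rpow hx' hε
    _ = (‖x‖ ^ (ε + s) + ‖x‖ ^ (-ε + s)) / ε := by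
        rw [Real.rpow_add hx', Real.rpow_add hx']; ring
    _ ≤ ((‖x‖ ^ σ + ‖x‖ ^ τ) + (‖x‖ ^ σ + ‖x‖ ^ τ)) / ε := by
        gcongr
        · exact rpow_le_add_rpow hx' (by linarith) (by linarith)
        · exact rpow_le_add_rpow hx' (by linarith) (by linarith)
    _ = _ := by ring

theorem differentiableAt_kernInt [NeZero n] [CompleteSpace V] {q : Euc n → V} (hq : IsQuad q)
    {f : Euc n → ℂ} (hfc : Continuous f) {a : ℕ}
    (hf : ∀ N, ∃ c, 0 ≤ c ∧ DecayBound f c a N) {z₀ : ℂ} (h : -(n : ℝ) - a < z₀.re) :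
    DifferentiableAt ℂ (fun z => kernInt q z f) z₀ := by
  obtain ⟨C, hC0, hC⟩ := hq.bound
  -- A quarter of the distance to the edge of the half plane: z moves by ε, the logarithm costs
  -- another ε, and the outer exponents at distance 2ε are still integrable.
  set ε : ℝ := (n + a + z₀.re) / 4 with hε
  have hε0 : 0 < ε := by rw [hε]; linarith
  obtain ⟨N, hN⟩ := exists_nat_gt (a + z₀.re + 2 * ε + n)
  obtain ⟨c, hc, hfN⟩ := hf N
  have hre : ∀ z ∈ Metric.ball z₀ ε, z₀.re - ε < z.re ∧ z.re < z₀.re + ε := fun z hz => by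
    have := (Complex.abs_re_le_norm (z - z₀)).trans_lt (mem_ball_iff_norm.mp hz)
    rw [Complex.sub_re, abs_lt] at this
    constructor <;> linarith [this.1, this.2]
  have hlog : StronglyMeasurable fun x : Euc n => ((Real.log ‖x‖ : ℝ) : ℂ) :=
    (Complex.measurable_ofReal.comp (Real.measurable_log.comp measurable_norm)).stronglyMeasurable
  refine (hasDerivAt_integral_of_dominated_loc_of_deriv_le (𝕜 := ℂ)
    (F := fun z x => f x • kern q z x)
    (F' := fun z x => ((Real.log ‖x‖ : ℝ) : ℂ) • (f x • kern q z x))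
    (bound := fun x => c * C * ((2 / ε) *
      (weight n (a + z₀.re - 2 * ε) N x + weight n (a + z₀.re + 2 * ε) N x)))
    (Metric.ball_mem_nhds z₀ hε0) ?_ ?_ ?_ ?_ ?_ ?_).2.differentiableAt
  · exact Eventually.of_forall fun z =>
      (hfc.stronglyMeasurable.smul (stronglyMeasurable_kern hq z)).aestronglyMeasurable
  · exact integrable_smul_kern hq hfc hc hfN h (by linarith)
  · exact (hlog.smul (hfc.stronglyMeasurable.smul
      (stronglyMeasurable_kern hq z₀))).aestronglyMeasurable
  · filter_upwards [compl_mem_ae_iff.mpr (measure_singleton (0 : Euc n))] with x hx z hz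
    obtain ⟨hz1, hz2⟩ := hre z hz
    rw [norm_smul, Complex.norm_real]
    calc _ ≤ |Real.log ‖x‖| * (c * C * weight n (a + z.re) N x) := by
          rw [Real.norm_eq_abs]
          gcongr
          exact norm_smul_kern_le hq hC0 hC hc hfN z x
      _ = c * C * (|Real.log ‖x‖| * weight n (a + z.re) N x) := by ring
      _ ≤ _ := mul_le_mul_of_nonneg_left (abs_log_mul_weight_le hε0
          (σ := a + z₀.re - 2 * ε) (τ := a + z₀.re + 2 * ε) (by linarith) (by linarith) N hx)
          (by positivity)
  · refine Integrable.const_mul (Integrable.const_mul (Integrable.add ?_ ?_) _) _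
    · exact integrable_weight (by linarith) (by linarith)
    · exact integrable_weight (by linarith) (by linarith)
  · filter_upwards [compl_mem_ae_iff.mpr (measure_singleton (0 : Euc n))] with x hx z _
    have hx' : ‖x‖ ≠ 0 := norm_ne_zero_iff.mpr hx
    have h1 : HasDerivAt (fun z : ℂ => (‖x‖ : ℂ) ^ (z - 2))
        ((‖x‖ : ℂ) ^ (z - 2) * Complex.log ‖x‖) z := by
      have := ((hasDerivAt_id z).sub_const 2).const_cpow (c := (‖x‖ : ℂ))
        (Or.inl (by exact_mod_cast hx'))
      simpa using this
    have h2 := (h1.smul_const (q x)).const_smul (f x)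
    refine h2.congr_deriv ?_
    rw [kern, Complex.ofReal_log (norm_nonneg x), smul_smul, smul_smul, smul_smul]
    congr 1
    ring

theorem kernInt_comp_smul {q : Euc n → V} (hq : IsQuad q) (z : ℂ) (f : Euc n → ℂ) {t : ℝ}
    (ht : 0 < t) :
    kernInt q z (fun x => f (t • x)) = ((t : ℂ) ^ (-(z + n))) • kernInt q z f := by
  have ht' : (t : ℂ) ≠ 0 := by exact_mod_cast ht.ne'
  have h1 : ∀ x, kern q z x = ((t : ℂ) ^ (-z)) • kern q z (t • x) := fun x => by
    rw [kern_smul hq z ht, smul_smul, ← Complex.cpow_add _ _ ht']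
    simp
  have h2 := Measure.integral_comp_smul (volume : Measure (Euc n))
    (fun y => f y • kern q z y) t
  unfold kernInt
  calc ∫ x, f (t • x) • kern q z x
      = ∫ x, ((t : ℂ) ^ (-z)) • (f (t • x) • kern q z (t • x)) := by
        refine integral_congr_ae (Eventually.of_forall fun x => ?_)
        change f (t • x) • kern q z x = _
        rw [h1 x, smul_comm]
    _ = ((t : ℂ) ^ (-z)) • |(t ^ Module.finrank ℝ (Euc n))⁻¹| • ∫ y, f y • kern q z y := by
        rw [integral_smul, h2]
    _ = _ := by
        rw [finrank_euclideanSpace_fin, abs_of_pos (by positivity), ← Complex.coe_smul, smul_smul]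
        congr 1
        rw [neg_add, Complex.cpow_add _ _ ht', Complex.cpow_neg _ (n : ℂ), Complex.cpow_natCast]
        push_cast
        rfl

theorem one_add_norm_le {t : ℝ} (ht : 1 / 2 < t) (x : Euc n) :
    1 + ‖x‖ ≤ 2 * (1 + ‖t • x‖) := by
  rw [norm_smul, Real.norm_of_nonneg (by linarith)]
  nlinarith [norm_nonneg x]

/-- Homogeneity in infinitesimal form: both sides are the derivative at t = 1 of
`kernInt_comp_smul`, the left one computed under the integral sign. -/
theorem kernInt_euler [NeZero n] [CompleteSpace V] {q : Euc n → V} (hq : IsQuad q)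
    (φ : 𝓢(Euc n, ℂ)) {z : ℂ} (hz : -(n : ℝ) < z.re) :
    kernInt q z (euler n φ) = -(z + n) • kernInt q z φ := by
  obtain ⟨C, hC0, hC⟩ := hq.bound
  obtain ⟨N, hN⟩ := exists_nat_gt (z.re + n)
  have hb : ∀ ψ : 𝓢(Euc n, ℂ), ∃ c, 0 ≤ c ∧ DecayBound ψ c 0 N := fun ψ =>
    exists_decayBound ψ (c := SchwartzMap.seminorm ℂ 0 0 ψ) (a := 0)
      (fun x => by simpa using SchwartzMap.norm_le_seminorm ℂ ψ x) N
  obtain ⟨c, hc, hφ⟩ := hb φ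
  obtain ⟨c', hc', hE⟩ := hb (euler n φ)
  have hder : ∀ x (t : ℝ), HasDerivAt (fun t : ℝ => φ (t • x)) (fderiv ℝ φ (t • x) x) t :=
    fun x t => by
      have h1 : HasDerivAt (fun t : ℝ => t • x) x t := by
        simpa using (hasDerivAt_id t).smul_const x
      exact (φ.hasFDerivAt (t • x)).comp_hasDerivAt t h1
  have hcont : ∀ t : ℝ, Continuous fun x => φ (t • x) := fun t => by
    have := φ.continuous
    fun_prop
  have hEc : Continuous fun x => fderiv ℝ φ x x :=
    (euler n φ).continuous.congr fun x => euler_apply φ x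
  have key := (hasDerivAt_integral_of_dominated_loc_of_deriv_le (𝕜 := ℝ) (x₀ := (1 : ℝ))
    (μ := volume)
    (F := fun (t : ℝ) x => φ (t • x) • kern q z x)
    (F' := fun (t : ℝ) x => (fderiv ℝ φ (t • x) x) • kern q z x)
    (bound := fun x => (2 ^ (N + 1) * c') * C * weight n ((0 : ℕ) + z.re) N x)
    -- Keeping t above 1/2 makes the decay of (E φ)(t x) / t uniform in t, at the cost of a factor
    -- 2^(N+1).
    (s := Set.Ioi (1 / 2)) (Ioi_mem_nhds (by norm_num)) ?_ ?_ ?_ ?_ ?_ ?_).2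
  · have h3 : (fun t : ℝ => ∫ x, φ (t • x) • kern q z x) =ᶠ[𝓝 1]
        fun t : ℝ => ((t : ℂ) ^ (-(z + n))) • kernInt q z φ := by
      filter_upwards [Ioi_mem_nhds (zero_lt_one' ℝ)] with t ht
      exact kernInt_comp_smul hq z φ ht
    have h4 : HasDerivAt (fun t : ℝ => (t : ℂ) ^ (-(z + n))) (-(z + n)) 1 := by
      have := (hasDerivAt_id ((1 : ℝ) : ℂ)).cpow_const (c := -(z + n)) (by simp)
      simpa using this.comp_ofReal
    have h5 := (key.congr_of_eventuallyEq h3.symm).unique (h4.smul_const _)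
    rw [← h5]
    refine integral_congr_ae (Eventually.of_forall fun x => ?_)
    simp only [one_smul, euler_apply]
  · exact Eventually.of_forall fun t =>
      ((hcont t).stronglyMeasurable.smul (stronglyMeasurable_kern hq z)).aestronglyMeasurable
  · simpa using integrable_smul_kern hq φ.continuous hc hφ (z := z) (by simpa using hz)
      (by simpa using hN)
  · simp only [one_smul]
    exact (hEc.stronglyMeasurable.smul (stronglyMeasurable_kern hq z)).aestronglyMeasurable
  · refine Eventually.of_forall fun x t (ht : 1 / 2 < t) => ?_
    refine norm_smul_kern_le hq hC0 hC (f := fun x => fderiv ℝ φ (t • x) x) (by positivity)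
      (fun y => ?_) z x
    have ht0 : 0 < t := by linarith
    have h1 : fderiv ℝ φ (t • y) y = (t⁻¹ : ℝ) • euler n φ (t • y) := by
      rw [euler_apply, ← map_smul, smul_smul, inv_mul_cancel₀ ht0.ne', one_smul]
    simp only [h1]
    rw [norm_smul, Real.norm_of_nonneg (by positivity)]
    have h2 : t⁻¹ ≤ 2 := by
      rw [inv_le_comm₀ ht0 two_pos]
      linarith
    calc t⁻¹ * ‖euler n φ (t • y)‖ * (1 + ‖y‖) ^ N
        ≤ 2 * ‖euler n φ (t • y)‖ * (2 * (1 + ‖t • y‖)) ^ N := by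
          gcongr
          exact one_add_norm_le ht y
      _ = 2 ^ (N + 1) * (‖euler n φ (t • y)‖ * (1 + ‖t • y‖) ^ N) := by rw [mul_pow]; ring
      _ ≤ 2 ^ (N + 1) * (c' * ‖t • y‖ ^ 0) := by
          exact mul_le_mul_of_nonneg_left (hE (t • y)) (by positivity)
      _ = _ := by simp
  · exact (integrable_weight (by simpa using hz) (by simpa using hN)).const_mul _
  · exact Eventually.of_forall fun x t _ => (hder x t).smul_const _

theorem kernInt_refl {q : Euc n → V} (hq : IsQuad q) (z : ℂ) (f : Euc n → ℂ) :
    kernInt q z (fun x => f (-x)) = kernInt q z f := by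
  unfold kernInt
  rw [← integral_neg_eq_self]
  refine integral_congr_ae (Eventually.of_forall fun x => ?_)
  have : kern q z (-x) = kern q z x := by
    have := hq.hom (-1) x
    rw [kern, kern, norm_neg]
    simpa using congrArg _ this
  simp only [neg_neg, this]

end Kernel

/-! ### The pole set and the identity theorem on its complement. -/

section PoleSet

variable {n : ℕ} {V : Type*} [NormedAddCommGroup V] [NormedSpace ℂ V]

/-- The pole set is the zero set of the entire function 1/Γ((z+n)/2), hence closed. -/
theorem isOpen_compl_poleSet (n : ℕ) : IsOpen (poleSet n)ᶜ := by
  have h : poleSet n = (fun z : ℂ => (Complex.Gamma ((z + n) / 2))⁻¹) ⁻¹' {0} := by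
    ext z
    simp only [poleSet, Set.mem_ofPred_eq, Set.mem_preimage, Set.mem_singleton_iff, inv_eq_zero,
      Complex.Gamma_eq_zero_iff]
    refine exists_congr fun k => ⟨fun hz => ?_, fun hz => ?_⟩
    · rw [hz]; ring
    · linear_combination 2 * hz
  rw [isOpen_compl_iff, h]
  refine isClosed_singleton.preimage ?_
  exact Complex.differentiable_one_div_Gamma.continuous.comp (by fun_prop)

theorem countable_poleSet (n : ℕ) : (poleSet n).Countable := by
  have : poleSet n = Set.range fun k : ℕ => (-n - 2 * k : ℂ) := by
    ext z
    simp [poleSet, eq_comm]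
  rw [this]
  exact Set.countable_range _

theorem isPreconnected_compl_poleSet (n : ℕ) : IsPreconnected (poleSet n)ᶜ :=
  ((countable_poleSet n).isConnected_compl_of_one_lt_rank
    (by rw [Complex.rank_real_complex]; norm_num)).isPreconnected

theorem notMem_poleSet_of_re {z : ℂ} (hz : -(n : ℝ) < z.re) : z ∉ poleSet n := by
  rintro ⟨k, rfl⟩
  simp at hz
  have : (0 : ℝ) ≤ k := Nat.cast_nonneg k
  linarith

theorem add_two_notMem_poleSet {z : ℂ} (hz : z ∉ poleSet n) : z + 2 ∉ poleSet n := by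
  rintro ⟨k, hk⟩
  exact hz ⟨k + 1, by push_cast; linear_combination hk⟩

theorem isOpen_re_gt (α : ℝ) : IsOpen {z : ℂ | α < z.re} :=
  isOpen_lt continuous_const Complex.continuous_re

theorem eqOn_of_eqOn_re_gt [CompleteSpace V] {U : Set ℂ} (hU : IsOpen U) (hc : IsPreconnected U)
    {f g : ℂ → V} (hf : DifferentiableOn ℂ f U) (hg : DifferentiableOn ℂ g U) {β : ℝ}
    (hβ : {z : ℂ | β < z.re} ⊆ U) (h : ∀ z : ℂ, β < z.re → f z = g z) : Set.EqOn f g U := by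
  have hmem : ((β + 1 : ℝ) : ℂ) ∈ {z : ℂ | β < z.re} := by simp
  refine (hf.analyticOnNhd hU).eqOn_of_preconnected_of_eventuallyEq (hg.analyticOnNhd hU) hc
    (hβ hmem) ?_
  filter_upwards [(isOpen_re_gt β).mem_nhds hmem] with z hz using h z hz

/-- The product `∏_{i<M} (-(z + n + 2i))`. -/
noncomputable def poleProd (n M : ℕ) (z : ℂ) : ℂ := ∏ i ∈ Finset.range M, (-(z + n + 2 * i))

theorem poleProd_succ (n M : ℕ) (z : ℂ) :
    poleProd n (M + 1) z = poleProd n M z * -(z + n + 2 * M) := Finset.prod_range_succ _ _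

theorem differentiable_poleProd (n M : ℕ) : Differentiable ℂ (poleProd n M) := by
  unfold poleProd
  fun_prop

theorem poleProd_ne_zero {z : ℂ} (hz : z ∉ poleSet n) (M : ℕ) : poleProd n M z ≠ 0 := by
  refine Finset.prod_ne_zero_iff.mpr fun i _ h => hz ⟨i, ?_⟩
  linear_combination -h

theorem poleProd_ne_zero' (n k : ℕ) : poleProd n k (-n - 2 * k) ≠ 0 := by
  refine Finset.prod_ne_zero_iff.mpr fun i hi h => ?_
  have h1 : (k : ℂ) = i := by linear_combination h / 2
  have h2 : k = i := by exact_mod_cast h1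
  exact (Finset.mem_range.mp hi).ne h2.symm

theorem eventually_notMem_poleSet (n k : ℕ) :
    ∀ᶠ z : ℂ in 𝓝[≠] (-n - 2 * k), z ∉ poleSet n := by
  filter_upwards [self_mem_nhdsWithin,
    mem_nhdsWithin_of_mem_nhds (Metric.ball_mem_nhds (-n - 2 * k : ℂ) one_pos)] with z hz hb
  rintro ⟨j, rfl⟩
  refine hz ?_
  rw [mem_ball_iff_norm, show (-n - 2 * j - (-n - 2 * k) : ℂ) = ((2 * (k - j) : ℤ) : ℂ) by
    push_cast; ring, Complex.norm_intCast, ← Int.cast_abs] at hb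
  have h1 : |(2 * ((k : ℤ) - j))| < 1 := by exact_mod_cast hb
  rw [abs_lt] at h1
  have : j = k := by omega
  rw [this]
  rfl

end PoleSet

/-! ### Holomorphic continuation and existence of residues. -/

section Continuation

variable {n : ℕ}

theorem schwartz_decayBound (φ : 𝓢(Euc n, ℂ)) (N : ℕ) : ∃ c, 0 ≤ c ∧ DecayBound φ c 0 N :=
  exists_decayBound φ (c := SchwartzMap.seminorm ℂ 0 0 φ) (a := 0)
    (fun x => by simpa using SchwartzMap.norm_le_seminorm ℂ φ x) N

theorem evenCut_decayBound (M : ℕ) (φ : 𝓢(Euc n, ℂ)) (N : ℕ) :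
    ∃ c, 0 ≤ c ∧ DecayBound (evenCut n M φ) c (2 * M) N := by
  obtain ⟨p, -, h⟩ := exists_evenCut_bound n M N
  exact ⟨p φ, apply_nonneg _ _, h φ⟩

variable [NeZero n] {V : Type*} [NormedAddCommGroup V] [NormedSpace ℂ V]
  {q : Euc n → V}

theorem integrable_schwartz_smul_kern (hq : IsQuad q) (φ : 𝓢(Euc n, ℂ)) {z : ℂ}
    (hz : -(n : ℝ) < z.re) : Integrable fun x => φ x • kern q z x := by
  obtain ⟨N, hN⟩ := exists_nat_gt (z.re + n)
  obtain ⟨c, hc, h⟩ := schwartz_decayBound φ N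
  exact integrable_smul_kern hq φ.continuous hc h (by simpa using hz) (by simpa using hN)

/-- The kernel is even, so the odd part of a test function integrates to zero. -/
theorem kernInt_evenCut_zero (hq : IsQuad q) (φ : 𝓢(Euc n, ℂ)) {z : ℂ} (hz : -(n : ℝ) < z.re) :
    kernInt q z (evenCut n 0 φ) = kernInt q z φ := by
  have h1 := integrable_schwartz_smul_kern hq φ hz
  have h2 := integrable_schwartz_smul_kern hq (reflS n φ) hz
  have h3 : kernInt q z (evenCut n 0 φ) =
      (2⁻¹ : ℂ) • (kernInt q z φ + kernInt q z (reflS n φ)) := by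
    unfold kernInt
    rw [← integral_add h1 h2, ← integral_smul]
    refine integral_congr_ae (Eventually.of_forall fun x => ?_)
    change (2⁻¹ * (φ x + φ (-x))) • _ = (2⁻¹ : ℂ) • (φ x • _ + φ (-x) • _)
    rw [mul_smul, add_smul]
  have h4 : kernInt q z (reflS n φ) = kernInt q z φ := kernInt_refl hq z φ
  rw [h3, h4, ← two_smul ℂ, smul_smul, inv_mul_cancel₀ two_ne_zero, one_smul]

/-- The tempered distribution `φ ↦ ∫ (evenCut M φ) |x|^(z-2) q(x) dx`. -/
theorem exists_evenCut_distribution (hq : IsQuad q) {M : ℕ} {z : ℂ}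
    (hz : -(n : ℝ) - 2 * M < z.re) :
    ∃ T : 𝓢'(Euc n, V), ∀ φ, T φ = kernInt q z (evenCut n M φ) := by
  obtain ⟨N, hN⟩ := exists_nat_gt (((2 * M : ℕ) : ℝ) + z.re + n)
  have hz' : -(n : ℝ) - ((2 * M : ℕ) : ℝ) < z.re := by push_cast; exact hz
  obtain ⟨K, hK, hb⟩ := exists_norm_kernInt_le hq hz' hN
  obtain ⟨p, hp, hpb⟩ := exists_evenCut_bound n M N
  have hint : ∀ φ, Integrable fun x => evenCut n M φ x • kern q z x := fun φ =>
    integrable_smul_kern hq (evenCut n M φ).continuous (apply_nonneg p φ) (hpb φ) hz' hN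
  let L : 𝓢(Euc n, ℂ) →ₗ[ℂ] V :=
    { toFun := fun φ => kernInt q z (evenCut n M φ)
      map_add' := fun φ ψ => by
        unfold kernInt
        rw [← integral_add (hint φ) (hint ψ)]
        refine integral_congr_ae (Eventually.of_forall fun x => ?_)
        simp only [map_add, add_apply, add_smul]
      map_smul' := fun c φ => by
        unfold kernInt
        rw [← integral_smul]
        refine integral_congr_ae (Eventually.of_forall fun x => ?_)
        simp only [map_smul, smul_apply, smul_assoc, RingHom.id_apply] }
  have hL : Continuous L := by
    have hle : (normSeminorm ℂ V).comp L ≤ K.toNNReal • p := fun φ => by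
      change _ ≤ (K.toNNReal : ℝ) * p φ
      rw [Real.coe_toNNReal K hK]
      exact
      hb _ _ (apply_nonneg p φ) (hpb φ)
    have hc : Continuous (K.toNNReal • p) := by
      change Continuous fun φ => K.toNNReal • p φ
      fun_prop
    have h1 : Continuous ((normSeminorm ℂ V).comp L) := Seminorm.continuous_of_le hc hle
    refine continuous_of_continuousAt_zero L ?_
    rw [ContinuousAt, map_zero, tendsto_zero_iff_norm_tendsto_zero]
    have := h1.tendsto 0
    rwa [map_zero] at this
  exact ⟨ContinuousLinearMap.toPointwiseConvergenceCLM _ _ _ _ ⟨L, hL⟩, fun φ => rfl⟩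

variable [CompleteSpace V]

theorem differentiableAt_kernInt_evenCut (hq : IsQuad q) {M : ℕ} (φ : 𝓢(Euc n, ℂ)) {z : ℂ}
    (hz : -(n : ℝ) - 2 * M < z.re) :
    DifferentiableAt ℂ (fun z => kernInt q z (evenCut n M φ)) z :=
  differentiableAt_kernInt hq (evenCut n M φ).continuous (evenCut_decayBound M φ)
    (by push_cast; exact hz)

/-- For Re z > -n this is `kernInt_euler` for the factor E - 2M. Both sides are holomorphic for Re z
> -n - 2M, so it persists there. -/
theorem kernInt_evenCut_succ (hq : IsQuad q) (M : ℕ) (φ : 𝓢(Euc n, ℂ)) {z : ℂ}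
    (hz : -(n : ℝ) - 2 * M < z.re) :
    kernInt q z (evenCut n (M + 1) φ) = -(z + n + 2 * M) • kernInt q z (evenCut n M φ) := by
  refine eqOn_of_eqOn_re_gt (isOpen_re_gt (-(n : ℝ) - 2 * M))
    (convex_halfSpace_re_gt _).isPreconnected
    (f := fun z => kernInt q z (evenCut n (M + 1) φ))
    (g := fun z => -(z + n + 2 * M) • kernInt q z (evenCut n M φ)) (β := -(n : ℝ))
    (fun w hw => (differentiableAt_kernInt_evenCut hq φ ?_).differentiableWithinAt)
    (fun w hw => ?_) (fun w hw => ?_) (fun w hw => ?_) hz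
  · have : -(n : ℝ) - 2 * M < w.re := hw
    push_cast
    linarith
  · exact (DifferentiableAt.smul (by fun_prop)
      (differentiableAt_kernInt_evenCut hq φ hw)).differentiableWithinAt
  · have h1 : -(n : ℝ) < w.re := hw
    have : (0 : ℝ) ≤ M := Nat.cast_nonneg M
    change -(n : ℝ) - 2 * M < w.re
    linarith
  · set ψ := evenCut n M φ
    have h1 := integrable_schwartz_smul_kern hq (euler n ψ) hw
    have h2 := integrable_schwartz_smul_kern hq ψ hw
    have h3 : kernInt q w (evenCut n (M + 1) φ) =
        kernInt q w (euler n ψ) - (2 * M : ℂ) • kernInt q w ψ := by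
      unfold kernInt
      rw [← integral_smul]
      refine Eq.trans ?_ (integral_sub h1 (h2.smul (2 * M : ℂ)))
      refine integral_congr_ae (Eventually.of_forall fun x => ?_)
      change (euler n ψ x - (2 * M) * ψ x) • _ = _
      rw [sub_smul, mul_smul]
    change kernInt q w (evenCut n (M + 1) φ) = _
    rw [h3, kernInt_euler hq ψ hw]
    module

theorem kernInt_evenCut_eq (hq : IsQuad q) (M : ℕ) (φ : 𝓢(Euc n, ℂ)) {z : ℂ}
    (hz : -(n : ℝ) < z.re) :
    kernInt q z (evenCut n M φ) = poleProd n M z • kernInt q z φ := by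
  induction M with
  | zero => simp [kernInt_evenCut_zero hq φ hz, poleProd]
  | succ M ih =>
    have : (0 : ℝ) ≤ M := Nat.cast_nonneg M
    rw [kernInt_evenCut_succ hq M φ (by linarith), ih, poleProd_succ, smul_smul, mul_comm]

theorem exists_rieszDist (hq : IsQuad q) : ∃ T : ℂ → 𝓢'(Euc n, V),
    ∀ z ∉ poleSet n, ∀ M : ℕ, -(n : ℝ) - 2 * M < z.re → ∀ φ,
      poleProd n M z • T z φ = kernInt q z (evenCut n M φ) := by
  -- Any sufficiently large number of factors would do; this choice uses n ≥ 1 for strictness when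
  -- Re z = 0.
  have hM : ∀ z : ℂ, -(n : ℝ) - 2 * (⌈|z.re|⌉₊ : ℕ) < z.re := fun z => by
    have h1 := Nat.le_ceil |z.re|
    have h2 := neg_abs_le z.re
    have h3 : (1 : ℝ) ≤ n := by exact_mod_cast NeZero.one_le
    have := abs_nonneg z.re
    linarith
  choose T hT using fun z => exists_evenCut_distribution hq (hM z)
  refine ⟨fun z => (poleProd n ⌈|z.re|⌉₊ z)⁻¹ • T z, fun z hz M hzM φ => ?_⟩
  -- The quotient by `poleProd` does not depend on the number of factors; cross-multiplying avoids
  -- the inverses.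
  have hstep : ∀ M M' : ℕ, M ≤ M' → -(n : ℝ) - 2 * M < z.re →
      poleProd n M z • kernInt q z (evenCut n M' φ) =
        poleProd n M' z • kernInt q z (evenCut n M φ) := fun M M' hMM' hM => by
    induction M', hMM' using Nat.le_induction with
    | base => rfl
    | succ k hk ih =>
      have : (M : ℝ) ≤ k := by exact_mod_cast hk
      rw [kernInt_evenCut_succ hq k φ (by linarith), poleProd_succ, smul_comm, ih, smul_smul,
        mul_comm]
  have h0 := poleProd_ne_zero hz ⌈|z.re|⌉₊
  change poleProd n M z • (poleProd n ⌈|z.re|⌉₊ z)⁻¹ • T z φ = _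
  rw [hT, smul_comm, inv_smul_eq_iff₀ h0]
  rcases le_total M ⌈|z.re|⌉₊ with h | h
  · exact hstep _ _ h hzM
  · exact (hstep _ _ h (hM z)).symm

/-- The holomorphic continuation of the family of distributions `|x|^(z-2) q(x)`. -/
noncomputable def rieszDist (hq : IsQuad q) : ℂ → 𝓢'(Euc n, V) := (exists_rieszDist hq).choose

theorem poleProd_smul_rieszDist (hq : IsQuad q) {z : ℂ} (hz : z ∉ poleSet n) {M : ℕ}
    (hM : -(n : ℝ) - 2 * M < z.re) (φ : 𝓢(Euc n, ℂ)) :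
    poleProd n M z • rieszDist hq z φ = kernInt q z (evenCut n M φ) :=
  (exists_rieszDist hq).choose_spec z hz M hM φ

/-- Where the integral converges it is the value of the continuation. -/
theorem rieszDist_eq_kernInt (hq : IsQuad q) {z : ℂ} (hz : z ∉ poleSet n) {M : ℕ}
    (hM : -(n : ℝ) - 2 * M < z.re) (φ : 𝓢(Euc n, ℂ))
    (hφ : ∀ N, ∃ c, 0 ≤ c ∧ DecayBound φ c (2 * M) N) :
    rieszDist hq z φ = kernInt q z φ := by
  have h1 := eqOn_of_eqOn_re_gt (isOpen_re_gt (-(n : ℝ) - 2 * M))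
    (convex_halfSpace_re_gt _).isPreconnected
    (f := fun z => kernInt q z (evenCut n M φ))
    (g := fun z => poleProd n M z • kernInt q z φ) (β := -(n : ℝ))
    (fun w hw => (differentiableAt_kernInt_evenCut hq φ hw).differentiableWithinAt)
    (fun w hw => ((differentiable_poleProd n M w).smul (differentiableAt_kernInt hq φ.continuous hφ
      (by push_cast; exact hw))).differentiableWithinAt)
    (fun w hw => ?_) (fun w hw => kernInt_evenCut_eq hq M φ hw) hM
  · have h2 := poleProd_smul_rieszDist hq hz hM φ
    exact smul_right_injective V (poleProd_ne_zero hz M) (h2.trans h1)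
  · have h1 : -(n : ℝ) < w.re := hw
    have : (0 : ℝ) ≤ M := Nat.cast_nonneg M
    change -(n : ℝ) - 2 * M < w.re
    linarith

theorem rieszDist_apply (hq : IsQuad q) {z : ℂ} (hz : -(n : ℝ) < z.re) (φ : 𝓢(Euc n, ℂ)) :
    rieszDist hq z φ = kernInt q z φ :=
  rieszDist_eq_kernInt hq (notMem_poleSet_of_re hz) (M := 0) (by simpa using hz) φ
    (schwartz_decayBound φ)

theorem differentiableOn_rieszDist (hq : IsQuad q) (φ : 𝓢(Euc n, ℂ)) :
    DifferentiableOn ℂ (fun z => rieszDist hq z φ) (poleSet n)ᶜ := by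
  intro z hz
  obtain ⟨M, hM⟩ := exists_nat_gt (-(n : ℝ) - z.re)
  have hM' : -(n : ℝ) - 2 * M < z.re := by
    have : (0 : ℝ) ≤ M := Nat.cast_nonneg M
    linarith
  have h1 : DifferentiableAt ℂ
      (fun z => (poleProd n M z)⁻¹ • kernInt q z (evenCut n M φ)) z :=
    ((differentiable_poleProd n M z).inv (poleProd_ne_zero hz M)).smul
      (differentiableAt_kernInt_evenCut hq φ hM')
  refine (h1.congr_of_eventuallyEq ?_).differentiableWithinAt
  filter_upwards [(isOpen_compl_poleSet n).mem_nhds hz, (isOpen_re_gt _).mem_nhds hM'] with w hw hwM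
  rw [eq_inv_smul_iff₀ (poleProd_ne_zero hw M)]
  exact poleProd_smul_rieszDist hq hw hwM φ

/-- With k + 1 factors the integral is regular at -n-2k, and only the last factor -(z+n+2k) of
`poleProd` vanishes there, to first order; its sign is the minus in the residue. -/
theorem exists_residue (hq : IsQuad q) (k : ℕ) : ∃ S : 𝓢'(Euc n, V), ∀ φ,
    Tendsto (fun z : ℂ => (z - (-n - 2 * k)) • rieszDist hq z φ) (𝓝[≠] (-n - 2 * k)) (𝓝 (S φ)) := by
  have hre : -(n : ℝ) - 2 * ((k + 1 : ℕ) : ℝ) < (-n - 2 * k : ℂ).re := by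
    simp
  obtain ⟨T, hT⟩ := exists_evenCut_distribution hq hre
  refine ⟨(-(poleProd n k (-n - 2 * k))⁻¹) • T, fun φ => ?_⟩
  have h1 : ContinuousAt
      (fun z => (-(poleProd n k z)⁻¹) • kernInt q z (evenCut n (k + 1) φ)) (-n - 2 * k : ℂ) := by
    refine ContinuousAt.smul ?_ (differentiableAt_kernInt_evenCut hq φ hre).continuousAt
    exact ((differentiable_poleProd n k _).continuousAt.inv₀ (poleProd_ne_zero' n k)).neg
  have h2 := h1.tendsto.mono_left (nhdsWithin_le_nhds (s := {(-n - 2 * k : ℂ)}ᶜ))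
  change Tendsto _ _ (𝓝 ((-(poleProd n k (-n - 2 * k))⁻¹) • T φ))
  rw [hT]
  refine h2.congr' ?_
  filter_upwards [eventually_notMem_poleSet n k,
    mem_nhdsWithin_of_mem_nhds ((isOpen_re_gt _).mem_nhds hre)] with z hz hzr
  rw [← poleProd_smul_rieszDist hq hz hzr, poleProd_succ, smul_smul]
  congr 1
  have := poleProd_ne_zero hz k
  field_simp
  ring

end Continuation

/-! ### Residues as integrals over an annulus. -/

section Bump

variable {n : ℕ}

/-- A smooth radial cutoff function that equals `1` on the unit ball. -/
noncomputable def bump (x : Euc n) : ℝ := Real.smoothTransition (2 - ‖x‖ ^ 2)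

theorem bump_eq_one {x : Euc n} (hx : ‖x‖ ≤ 1) : bump x = 1 :=
  Real.smoothTransition.one_of_one_le (by nlinarith [norm_nonneg x])

theorem bump_eq_zero {x : Euc n} (hx : 2 ≤ ‖x‖) : bump x = 0 :=
  Real.smoothTransition.zero_of_nonpos (by nlinarith)

theorem bump_mem (x : Euc n) : bump x ∈ Set.Icc (0 : ℝ) 1 :=
  ⟨Real.smoothTransition.nonneg _, Real.smoothTransition.le_one _⟩

theorem contDiff_bump : ContDiff ℝ (↑(⊤ : ℕ∞)) (bump : Euc n → ℝ) :=
  Real.smoothTransition.contDiff.comp (contDiff_const.sub (contDiff_norm_sq ℝ))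

theorem bump_two_smul_le (x : Euc n) : bump ((2 : ℝ) • x) ≤ bump x := by
  refine Real.smoothTransition.monotone ?_
  rw [norm_smul]
  norm_num
  nlinarith [norm_nonneg x]

/-- A smooth function times the cutoff function, as a Schwartz function. -/
noncomputable def bumpMul (h : Euc n → ℂ) (hh : ContDiff ℝ (↑(⊤ : ℕ∞)) h) : 𝓢(Euc n, ℂ) :=
  HasCompactSupport.toSchwartzMap (f := fun x => h x * (bump x : ℂ))
    (HasCompactSupport.intro (isCompact_closedBall (0 : Euc n) 2) fun x hx => by
      rw [mem_closedBall_zero_iff, not_le] at hx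
      simp [bump_eq_zero hx.le])
    (hh.mul (Complex.ofRealCLM.contDiff.comp contDiff_bump))

theorem bumpMul_apply (h : Euc n → ℂ) (hh : ContDiff ℝ (↑(⊤ : ℕ∞)) h) (x : Euc n) :
    bumpMul h hh x = h x * (bump x : ℂ) := rfl

/-- The difference of `bump` and its dilation by two, a nonnegative function supported in an
annulus. -/
noncomputable def annulus (x : Euc n) : ℝ := bump x - bump ((2 : ℝ) • x)

theorem annulus_nonneg (x : Euc n) : 0 ≤ annulus x := sub_nonneg.mpr (bump_two_smul_le x)

theorem annulus_eq_one {x : Euc n} (hx : ‖x‖ = 1) : annulus x = 1 := by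
  rw [annulus, bump_eq_one hx.le, bump_eq_zero (by rw [norm_smul, hx]; norm_num), sub_zero]

theorem annulus_eq_zero {x : Euc n} (hx : ‖x‖ ≤ 1 / 2) : annulus x = 0 := by
  rw [annulus, bump_eq_one (by linarith), bump_eq_one, sub_self]
  rw [norm_smul]
  norm_num
  linarith

theorem annulus_eq_zero' {x : Euc n} (hx : 2 ≤ ‖x‖) : annulus x = 0 := by
  rw [annulus, bump_eq_zero hx, bump_eq_zero, sub_self]
  rw [norm_smul]
  norm_num
  linarith

theorem continuous_annulus : Continuous (annulus : Euc n → ℝ) := by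
  have := (contDiff_bump (n := n)).continuous
  unfold annulus
  fun_prop

theorem homogeneous_bound {k : ℕ} {h : Euc n → ℂ} (hc : Continuous h)
    (hh : ∀ (c : ℝ) x, h (c • x) = (c : ℂ) ^ (2 * k) * h x) :
    ∃ C, 0 ≤ C ∧ ∀ x, ‖h x‖ ≤ C * ‖x‖ ^ (2 * k) := by
  obtain ⟨C, hC⟩ := (isCompact_closedBall (0 : Euc n) 1).exists_bound_of_continuousOn
    hc.continuousOn
  have h0 : 0 ≤ C := (norm_nonneg _).trans (hC 0 (by simp))
  have key : ∀ x : Euc n, x ≠ 0 → ‖h x‖ ≤ C * ‖x‖ ^ (2 * k) := fun x hx => by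
    have hx' : 0 < ‖x‖ := norm_pos_iff.mpr hx
    have h1 : x = ‖x‖ • (‖x‖⁻¹ • x) := by rw [smul_smul, mul_inv_cancel₀ hx'.ne', one_smul]
    have h2 : ‖h (‖x‖⁻¹ • x)‖ ≤ C := hC _ (by
      rw [mem_closedBall_zero_iff, norm_smul, norm_inv, norm_norm, inv_mul_cancel₀ hx'.ne'])
    rw [h1, hh, norm_mul, norm_pow, Complex.norm_real, norm_norm, ← h1, mul_comm]
    gcongr
  refine ⟨C, h0, fun x => ?_⟩
  rcases eq_or_ne x 0 with rfl | hx
  · rcases Nat.eq_zero_or_pos k with rfl | hk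
    · simpa using hC 0 (by simp)
    · have := hh 0 0
      rw [zero_smul, Complex.ofReal_zero, zero_pow (by omega), zero_mul] at this
      rw [this, norm_zero]
      positivity
  · exact key x hx

/-- The support lies in 1/2 ≤ |x| ≤ 2, so one more power of |x| than the degree of h is free. This
extra power makes the pairing converge at the pole -n-2k itself. -/
theorem annulus_decayBound {k : ℕ} {h : Euc n → ℂ} (hc : Continuous h)
    (hh : ∀ (c : ℝ) x, h (c • x) = (c : ℂ) ^ (2 * k) * h x) (N : ℕ) :
    ∃ c, 0 ≤ c ∧ DecayBound (fun x => h x * ((annulus x : ℝ) : ℂ)) c (2 * k + 1) N := by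
  obtain ⟨C, hC0, hC⟩ := homogeneous_bound hc hh
  set g : Euc n → ℂ := fun x => h x * ((annulus x : ℝ) : ℂ) with hg
  refine ⟨2 * C * 3 ^ N, by positivity, fun x => ?_⟩
  rcases le_total ‖x‖ (1 / 2) with hx | hx
  · rw [hg]
    simp only [annulus_eq_zero hx, Complex.ofReal_zero, mul_zero, norm_zero, zero_mul]
    positivity
  rcases le_total 2 ‖x‖ with hx2 | hx2
  · rw [hg]
    simp only [annulus_eq_zero' hx2, Complex.ofReal_zero, mul_zero, norm_zero, zero_mul]
    positivity
  · have h1 : ‖g x‖ ≤ C * ‖x‖ ^ (2 * k) := by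
      rw [hg]
      simp only
      rw [norm_mul, Complex.norm_real, Real.norm_of_nonneg (annulus_nonneg x)]
      refine (mul_le_of_le_one_right (norm_nonneg _) ?_).trans (hC x)
      have := (bump_mem x).2
      have := (bump_mem ((2 : ℝ) • x)).1
      unfold annulus
      linarith
    calc ‖g x‖ * (1 + ‖x‖) ^ N ≤ (C * ‖x‖ ^ (2 * k)) * 3 ^ N := by
          gcongr
          linarith
      _ ≤ (C * ‖x‖ ^ (2 * k)) * 3 ^ N * (2 * ‖x‖) :=
          le_mul_of_one_le_right (by positivity) (by linarith)
      _ = _ := by ring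

variable [NeZero n] {V : Type*} [NormedAddCommGroup V] [NormedSpace ℂ V]
  [CompleteSpace V] {q : Euc n → V}

/-- The residue at `-n-2k`, tested on `h` times the cutoff with `h` homogeneous of degree `2k`. -/
theorem log_two_smul_residue (hq : IsQuad q) {k : ℕ} {h : Euc n → ℂ}
    (hs : ContDiff ℝ (↑(⊤ : ℕ∞)) h) (hh : ∀ (c : ℝ) x, h (c • x) = (c : ℂ) ^ (2 * k) * h x) {S : V}
    (hS : Tendsto (fun z : ℂ => (z - (-n - 2 * k)) • rieszDist hq z (bumpMul h hs))
      (𝓝[≠] (-n - 2 * k)) (𝓝 S)) :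
    ((Real.log 2 : ℝ) : ℂ) • S =
      kernInt q (-n - 2 * k) (fun x => h x * ((annulus x : ℝ) : ℂ)) := by
  set φ := bumpMul h hs
  obtain ⟨C, hC0, hC⟩ := homogeneous_bound hs.continuous hh
  have hφ : ∀ N, ∃ c, 0 ≤ c ∧ DecayBound φ c (2 * k) N :=
    exists_decayBound φ (c := C) fun x => by
      rw [bumpMul_apply, norm_mul, Complex.norm_real, Real.norm_of_nonneg (bump_mem x).1]
      exact (mul_le_of_le_one_right (norm_nonneg _) (bump_mem x).2).trans (hC x)
  set g : Euc n → ℂ := fun x => h x * ((annulus x : ℝ) : ℂ) with hg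
  have hgc : Continuous g := hs.continuous.mul
    (Complex.continuous_ofReal.comp continuous_annulus)
  have hgd := annulus_decayBound hs.continuous hh
  -- The pole is approached along z = -n-2k+t with t decreasing to 0, where the integral against φ
  -- still converges because φ is O(|x|^(2k)).
  have hmap : Tendsto (fun t : ℝ => (-n - 2 * k + t : ℂ)) (𝓝[>] 0) (𝓝 (-n - 2 * k)) := by
    have : Continuous fun t : ℝ => (-n - 2 * k + t : ℂ) := by fun_prop
    simpa using (this.tendsto 0).mono_left (nhdsWithin_le_nhds (s := Set.Ioi 0))
  have hmap' : Tendsto (fun t : ℝ => (-n - 2 * k + t : ℂ)) (𝓝[>] 0) (𝓝[≠] (-n - 2 * k)) := by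
    refine tendsto_nhdsWithin_iff.mpr ⟨hmap, ?_⟩
    filter_upwards [self_mem_nhdsWithin] with t ht
    simpa using (Set.mem_Ioi.mp ht).ne'
  have h1 : Tendsto (fun t : ℝ => kernInt q (-n - 2 * k + t) g) (𝓝[>] 0)
      (𝓝 (kernInt q (-n - 2 * k) g)) :=
    (differentiableAt_kernInt hq hgc hgd (by simp)).continuousAt.tendsto.comp hmap
  have h2 : Tendsto (fun t : ℝ => (((1 - (2 : ℝ) ^ (-t)) / t : ℝ) : ℂ)) (𝓝[>] 0)
      (𝓝 (Real.log 2 : ℝ)) := by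
    refine (Complex.continuous_ofReal.tendsto _).comp ?_
    have hd : HasDerivAt (fun t : ℝ => -(2 : ℝ) ^ (-t)) (Real.log 2) 0 := by
      exact ((hasDerivAt_neg (0 : ℝ)).const_rpow (a := 2) two_pos).fun_neg.congr_deriv (by simp)
    have := (hasDerivAt_iff_tendsto_slope.mp hd).mono_left
      (nhdsWithin_mono (0 : ℝ) (fun t (ht : 0 < t) => ht.ne'))
    refine this.congr fun t => ?_
    rw [slope_def_field]
    simp
    ring
  refine tendsto_nhds_unique ((h2.smul (hS.comp hmap')).congr' ?_) h1
  filter_upwards [self_mem_nhdsWithin, hmap'.eventually (eventually_notMem_poleSet n k)] with t ht htp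
  have ht0 : (0 : ℝ) < t := ht
  have hre : -(n : ℝ) - 2 * k < (-n - 2 * k + t : ℂ).re := by simpa using ht0
  obtain ⟨N, hN⟩ := exists_nat_gt (((2 * k : ℕ) : ℝ) + (-n - 2 * k + t : ℂ).re + n)
  obtain ⟨c, hc, hφN⟩ := hφ N
  have hint := integrable_smul_kern hq φ.continuous hc hφN (by push_cast; exact hre) hN
  have hsc := kernInt_comp_smul hq (-n - 2 * k + t : ℂ) φ two_pos
  -- Homogeneity of h turns the difference of the two cutoffs into a difference of φ and its
  -- dilation.
  have hφ2 : ∀ x : Euc n, g x = φ x - ((2 : ℂ) ^ (2 * k))⁻¹ * φ ((2 : ℝ) • x) := fun x => by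
    rw [bumpMul_apply, bumpMul_apply, hh, hg]
    simp only [annulus]
    push_cast
    have : (2 : ℂ) ^ (2 * k) ≠ 0 := pow_ne_zero _ two_ne_zero
    field_simp
  have hint2 : Integrable fun x => φ ((2 : ℝ) • x) • kern q (-n - 2 * k + t) x := by
    have h3 := (hint.comp_smul (two_ne_zero (α := ℝ))).smul
      (((2 : ℝ) : ℂ) ^ (-n - 2 * k + t : ℂ))⁻¹
    refine h3.congr (Eventually.of_forall fun x => ?_)
    simp only [Pi.smul_apply]
    rw [kern_smul hq _ two_pos, smul_comm (φ _), smul_smul, inv_mul_cancel₀, one_smul]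
    simp [Complex.cpow_eq_zero_iff]
  -- Dilation scales the integral by 2^(2k-t), so the pairing with g is (1 - 2^(-t)) times that with
  -- φ; dividing by t produces log 2 in the limit.
  have hgi : kernInt q (-n - 2 * k + t) g = ((1 - (2 : ℝ) ^ (-t) : ℝ) : ℂ) •
      kernInt q (-n - 2 * k + t) φ := by
    have h3 : kernInt q (-n - 2 * k + t) g = kernInt q (-n - 2 * k + t) φ -
        ((2 : ℂ) ^ (2 * k))⁻¹ • kernInt q (-n - 2 * k + t) (fun x => φ ((2 : ℝ) • x)) := by
      unfold kernInt
      rw [← integral_smul]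
      refine Eq.trans ?_ (integral_sub hint (hint2.smul ((2 : ℂ) ^ (2 * k))⁻¹))
      refine integral_congr_ae (Eventually.of_forall fun x => ?_)
      change g x • _ = _
      rw [hφ2, sub_smul, mul_smul]
    rw [h3, hsc, smul_smul]
    have h4 : ((2 : ℂ) ^ (2 * k))⁻¹ * ((2 : ℝ) : ℂ) ^ (-(-n - 2 * k + t + n) : ℂ) =
        (((2 : ℝ) ^ (-t) : ℝ) : ℂ) := by
      rw [Complex.ofReal_cpow two_pos.le, show (-(-n - 2 * k + t + n) : ℂ) =
        ((2 * k : ℕ) : ℂ) + ((-t : ℝ) : ℂ) by push_cast; ring, Complex.cpow_add _ _ (by norm_num),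
        Complex.cpow_natCast, ← mul_assoc]
      norm_num
    rw [h4, Complex.ofReal_sub, sub_smul, Complex.ofReal_one, one_smul]
  change _ • ((-n - 2 * k + t - (-n - 2 * k) : ℂ) • rieszDist hq _ φ) = _
  rw [hgi, rieszDist_eq_kernInt hq htp hre φ hφ, smul_smul]
  congr 1
  push_cast
  have : (t : ℂ) ≠ 0 := by exact_mod_cast ht0.ne'
  field_simp
  ring

end Bump

/-! ### Functions of polynomial growth. -/

section PolyBdd

variable {n : ℕ} {F : Type*} [NormedAddCommGroup F]

/-- Functions of at most polynomial growth. -/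
def PolyBdd (f : Euc n → F) : Prop := ∃ (C : ℝ) (N : ℕ), ∀ x, ‖f x‖ ≤ C * (1 + ‖x‖) ^ N

theorem PolyBdd.nonneg_const {f : Euc n → F} (h : PolyBdd f) :
    ∃ (C : ℝ) (N : ℕ), 0 ≤ C ∧ ∀ x, ‖f x‖ ≤ C * (1 + ‖x‖) ^ N := by
  obtain ⟨C, N, hf⟩ := h
  refine ⟨C, N, ?_, hf⟩
  simpa using (norm_nonneg _).trans (hf 0)

theorem PolyBdd.add {f g : Euc n → F} (hf : PolyBdd f) (hg : PolyBdd g) :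
    PolyBdd fun x => f x + g x := by
  obtain ⟨C, N, hC, hf⟩ := hf.nonneg_const
  obtain ⟨D, M, hD, hg⟩ := hg.nonneg_const
  refine ⟨C + D, max N M, fun x => (norm_add_le _ _).trans ?_⟩
  have h1 : 1 ≤ 1 + ‖x‖ := by linarith [norm_nonneg x]
  calc ‖f x‖ + ‖g x‖ ≤ C * (1 + ‖x‖) ^ N + D * (1 + ‖x‖) ^ M := add_le_add (hf x) (hg x)
    _ ≤ C * (1 + ‖x‖) ^ max N M + D * (1 + ‖x‖) ^ max N M := by
        gcongr
        · exact le_max_left _ _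
        · exact le_max_right _ _
    _ = _ := by ring

theorem PolyBdd.of_le_mul {G H : Type*} [NormedAddCommGroup G] [NormedAddCommGroup H]
    {f : Euc n → F} {g : Euc n → G} {h : Euc n → H}
    (hf : PolyBdd f) (hg : PolyBdd g) (hle : ∀ x, ‖h x‖ ≤ ‖f x‖ * ‖g x‖) : PolyBdd h := by
  obtain ⟨C, N, hC, hf⟩ := hf.nonneg_const
  obtain ⟨D, M, hD, hg⟩ := hg.nonneg_const
  refine ⟨C * D, N + M, fun x => (hle x).trans ?_⟩
  calc ‖f x‖ * ‖g x‖ ≤ (C * (1 + ‖x‖) ^ N) * (D * (1 + ‖x‖) ^ M) := by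
        gcongr
        · exact hf x
        · exact hg x
    _ = _ := by ring

end PolyBdd

/-! ### Distributions given by functions, and their classical derivatives. -/

section GivenBy

variable {n : ℕ} {F G : Type*} [NormedAddCommGroup F] [NormedSpace ℂ F]
  [NormedAddCommGroup G] [NormedSpace ℂ G]

theorem partialD_apply (k : Fin n) (T : 𝓢'(Euc n, F)) (φ : 𝓢(Euc n, ℂ)) :
    partialD F k T φ = -T (partialS k φ) := by
  rw [← map_neg]
  rfl

theorem extD_apply {p : ℕ} (T : 𝓢'(Euc n, Form n p)) (φ : 𝓢(Euc n, ℂ)) :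
    extD n p T φ = ∑ k, extMul (stdB n k) (partialD _ k T φ) := by
  simp only [extD, LinearMap.sum_apply, LinearMap.comp_apply]
  rw [sum_apply]
  rfl

theorem coD_apply {p : ℕ} (T : 𝓢'(Euc n, Form n (p + 1))) (φ : 𝓢(Euc n, ℂ)) :
    coD n p T φ = -∑ k, intMul (stdB n k) (partialD _ k T φ) := by
  simp only [coD, LinearMap.neg_apply, LinearMap.sum_apply, LinearMap.comp_apply]
  rw [neg_apply, sum_apply]
  rfl

/-- The tempered distribution `T` is given by integration against `K`. -/
def GivenBy (T : 𝓢'(Euc n, F)) (K : Euc n → F) : Prop :=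
  ∀ φ : 𝓢(Euc n, ℂ), Integrable (fun x => φ x • K x) ∧ T φ = ∫ x, φ x • K x

theorem GivenBy.eq {T T' : 𝓢'(Euc n, F)} {K : Euc n → F} (h : GivenBy T K) (h' : GivenBy T' K) :
    T = T' := by
  ext φ
  rw [(h φ).2, (h' φ).2]

theorem PolyBdd.integrable [NeZero n] {f : Euc n → F} (hf : PolyBdd f) (hc : Continuous f)
    (φ : 𝓢(Euc n, ℂ)) : Integrable fun x => φ x • f x := by
  obtain ⟨C, N, hC, hf⟩ := hf.nonneg_const
  obtain ⟨c, hc0, hφ⟩ := schwartz_decayBound φ (N + (n + 1))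
  refine ((integrable_weight (n := n) (σ := 0) (N := n + 1) ?_ ?_).const_mul (c * C)).mono'
    (φ.continuous.smul hc).aestronglyMeasurable (Eventually.of_forall fun x => ?_)
  · have : (0 : ℝ) < n := by exact_mod_cast NeZero.pos n
    linarith
  · push_cast; linarith
  · have h1 := hφ x
    have h0 : 0 < 1 + ‖x‖ := by linarith [norm_nonneg x]
    rw [pow_zero, mul_one, ← le_div_iff₀ (by positivity)] at h1
    rw [norm_smul, weight, Real.rpow_zero, one_mul]
    calc ‖φ x‖ * ‖f x‖ ≤ (c / (1 + ‖x‖) ^ (N + (n + 1))) * (C * (1 + ‖x‖) ^ N) := by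
          gcongr
          exact hf x
      _ = _ := by
          rw [pow_add]
          field_simp

theorem GivenBy.congr {T : 𝓢'(Euc n, F)} {K K' : Euc n → F} (h : GivenBy T K)
    (hK : ∀ x, K x = K' x) : GivenBy T K' := funext hK ▸ h

/-- Continuously differentiable functions which together with their derivative have polynomial
growth. -/
structure TempC1 (K : Euc n → F) (K' : Euc n → Euc n →L[ℝ] F) : Prop where
  hasFDerivAt : ∀ x, HasFDerivAt K (K' x) x
  cont : Continuous K'
  bdd : PolyBdd K
  bdd' : PolyBdd K'

theorem TempC1.continuous {K : Euc n → F} {K' : Euc n → Euc n →L[ℝ] F} (h : TempC1 K K') :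
    Continuous K :=
  continuous_iff_continuousAt.mpr fun x => (h.hasFDerivAt x).continuousAt

theorem TempC1.integrable_deriv [NeZero n] {K : Euc n → F} {K' : Euc n → Euc n →L[ℝ] F}
    (h : TempC1 K K') (v : Euc n) (φ : 𝓢(Euc n, ℂ)) : Integrable fun x => φ x • K' x v := by
  have hb : PolyBdd fun x => K' x v :=
    h.bdd'.of_le_mul (g := fun _ => ((‖v‖ : ℝ) : ℂ)) ⟨‖v‖, 0, fun x => by simp⟩ fun x => by
      simpa using (K' x).le_opNorm v
  exact hb.integrable (h.cont.clm_apply continuous_const) φ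

/-- Integration by parts; polynomial growth of the function and its derivative against a Schwartz
function provides integrability and removes boundary terms. -/
theorem givenBy_partialD [NeZero n] {T : 𝓢'(Euc n, F)} {K : Euc n → F}
    {K' : Euc n → Euc n →L[ℝ] F} (hT : GivenBy T K) (h : TempC1 K K') (k : Fin n) :
    GivenBy (partialD F k T) fun x => K' x (stdB n k) := by
  intro φ
  have h1 := h.integrable_deriv (stdB n k) φ
  refine ⟨h1, ?_⟩
  rw [partialD_apply, (hT _).2]
  have h2 := integral_bilinear_hasLineDerivAt_right_eq_neg_left_of_integrable (μ := volume)
    (f := φ) (f' := partialS k φ) (g := K) (g' := fun x => K' x (stdB n k)) (v := stdB n k)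
    (B := ContinuousLinearMap.lsmul ℝ ℂ) (hT _).1 h1 (hT φ).1
    (fun x _ => by
      rw [partialS_apply]
      exact (φ.hasFDerivAt x).hasLineDerivAt _)
    (fun x _ => (h.hasFDerivAt x).hasLineDerivAt _)
  exact h2.symm

theorem givenBy_extD [NeZero n] {p : ℕ} {T : 𝓢'(Euc n, Form n p)} {K : Euc n → Form n p}
    {K' : Euc n → Euc n →L[ℝ] Form n p} (hT : GivenBy T K) (h : TempC1 K K') :
    GivenBy (extD n p T) fun x => ∑ k, extMul (stdB n k) (K' x (stdB n k)) := by
  intro φ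
  have h1 : ∀ k, Integrable fun x => extMul (stdB n k) (φ x • K' x (stdB n k)) := fun k =>
    (extMul (stdB n k)).integrable_comp (givenBy_partialD hT h k φ).1
  have h2 : (fun x => φ x • ∑ k, extMul (stdB n k) (K' x (stdB n k))) =
      fun x => ∑ k, extMul (stdB n k) (φ x • K' x (stdB n k)) := by
    ext1 x
    simp only [Finset.smul_sum, map_smul]
  rw [h2]
  refine ⟨integrable_finsetSum _ fun k _ => h1 k, ?_⟩
  rw [extD_apply, integral_finsetSum _ fun k _ => h1 k]
  refine Finset.sum_congr rfl fun k _ => ?_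
  rw [(givenBy_partialD hT h k φ).2, ContinuousLinearMap.integral_comp_comm]
  exact (givenBy_partialD hT h k φ).1

theorem givenBy_coD [NeZero n] {p : ℕ} {T : 𝓢'(Euc n, Form n (p + 1))} {K : Euc n → Form n (p + 1)}
    {K' : Euc n → Euc n →L[ℝ] Form n (p + 1)} (hT : GivenBy T K) (h : TempC1 K K') :
    GivenBy (coD n p T) fun x => -∑ k, intMul (stdB n k) (K' x (stdB n k)) := by
  intro φ
  have h1 : ∀ k, Integrable fun x => intMul (stdB n k) (φ x • K' x (stdB n k)) := fun k =>
    (intMul (stdB n k)).integrable_comp (givenBy_partialD hT h k φ).1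
  have h2 : (fun x => φ x • -∑ k, intMul (stdB n k) (K' x (stdB n k))) =
      fun x => -∑ k, intMul (stdB n k) (φ x • K' x (stdB n k)) := by
    ext1 x
    simp only [smul_neg, Finset.smul_sum, map_smul]
  rw [h2]
  refine ⟨(integrable_finsetSum _ fun k _ => h1 k).neg, ?_⟩
  rw [coD_apply, integral_neg, integral_finsetSum _ fun k _ => h1 k]
  congr 1
  refine Finset.sum_congr rfl fun k _ => ?_
  rw [(givenBy_partialD hT h k φ).2, ContinuousLinearMap.integral_comp_comm]
  exact (givenBy_partialD hT h k φ).1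

end GivenBy

/-! ### Derivatives of complex powers of the norm. -/

section NormPow

variable {n : ℕ} {F : Type*} [NormedAddCommGroup F] [NormedSpace ℂ F]

theorem continuous_norm_cpow {w : ℂ} (hw : 0 < w.re) :
    Continuous fun x : Euc n => (‖x‖ : ℂ) ^ w :=
  (Complex.continuous_ofReal_cpow_const hw).comp continuous_norm

theorem norm_norm_cpow (x : Euc n) {w : ℂ} (hw : 0 < w.re) : ‖(‖x‖ : ℂ) ^ w‖ = ‖x‖ ^ w.re :=
  Complex.norm_cpow_eq_rpow_re_of_nonneg (norm_nonneg x) hw.ne'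

theorem polyBdd_norm_cpow {w : ℂ} (hw : 0 < w.re) : PolyBdd fun x : Euc n => (‖x‖ : ℂ) ^ w := by
  refine ⟨1, ⌈w.re⌉₊, fun x => ?_⟩
  rw [norm_norm_cpow x hw, one_mul, ← Real.rpow_natCast]
  have h0 := norm_nonneg x
  calc ‖x‖ ^ w.re ≤ (1 + ‖x‖) ^ w.re := by
        gcongr
        linarith
    _ ≤ _ := Real.rpow_le_rpow_of_exponent_le (by linarith) (Nat.le_ceil _)

/-- At the origin the function is O(|x|²). Elsewhere it is (|x|²)^(w/2), a power of a smooth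
positive function. -/
theorem hasFDerivAt_norm_cpow {w : ℂ} (hw : 2 < w.re) (x : Euc n) :
    HasFDerivAt (fun x : Euc n => (‖x‖ : ℂ) ^ w)
      ((innerSL ℝ x).smulRight (w * (‖x‖ : ℂ) ^ (w - 2))) x := by
  rcases eq_or_ne x 0 with rfl | hx
  · have h0 : ((innerSL ℝ (0 : Euc n)).smulRight (w * (‖(0 : Euc n)‖ : ℂ) ^ (w - 2))) = 0 := by
      ext v
      simp
    rw [h0]
    refine Asymptotics.IsBigO.hasFDerivAt (n := 2) ?_ one_lt_two
    refine Asymptotics.IsBigO.of_bound 1 ?_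
    filter_upwards [Metric.ball_mem_nhds (0 : Euc n) one_pos] with y hy
    rw [mem_ball_zero_iff] at hy
    rw [norm_norm_cpow y (by linarith), sub_zero, one_mul, norm_pow, norm_norm,
      ← Real.rpow_natCast]
    exact Real.rpow_le_rpow_of_exponent_ge' (norm_nonneg y) hy.le (by norm_num)
      (by push_cast; exact hw.le)
  · have hx' : 0 < ‖x‖ := norm_pos_iff.mpr hx
    have hw0 : w ≠ 0 := by
      rintro rfl
      simp at hw
      linarith
    have hsq : ∀ y : Euc n, y ≠ 0 → ∀ u : ℂ,
        (((‖y‖ ^ 2 : ℝ) : ℂ)) ^ (u / 2) = (‖y‖ : ℂ) ^ u := fun y hy u => by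
      have hy' : 0 < ‖y‖ := norm_pos_iff.mpr hy
      rw [Complex.cpow_def_of_ne_zero (by exact_mod_cast (pow_pos hy' 2).ne'),
        Complex.cpow_def_of_ne_zero (by exact_mod_cast hy'.ne'), ← Complex.ofReal_log (by positivity),
        ← Complex.ofReal_log hy'.le, Real.log_pow]
      push_cast
      ring_nf
    have h1 : HasDerivAt (fun s : ℝ => (s : ℂ) ^ (w / 2))
        (w / 2 * ((‖x‖ ^ 2 : ℝ) : ℂ) ^ (w / 2 - 1)) (‖x‖ ^ 2) := by
      have := (hasDerivAt_id ((‖x‖ ^ 2 : ℝ) : ℂ)).cpow_const (c := w / 2)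
        (Complex.ofReal_mem_slitPlane.mpr (by positivity))
      simpa using this.comp_ofReal
    have h2 := h1.hasFDerivAt.comp x (hasStrictFDerivAt_norm_sq x).hasFDerivAt
    refine (h2.congr_fderiv ?_).congr_of_eventuallyEq ?_
    · ext v
      rw [show w / 2 - 1 = (w - 2) / 2 by ring, hsq x hx]
      simp
      ring
    · filter_upwards [isOpen_compl_singleton.mem_nhds hx] with y hy using (hsq y hy w).symm

/-- The derivative of `|x|^w Q(x)`. -/
noncomputable def normPowDeriv (w : ℂ) (Q : Euc n → F) (Q' : Euc n → Euc n →L[ℝ] F) (x : Euc n) :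
    Euc n →L[ℝ] F :=
  ((‖x‖ : ℂ) ^ w) • Q' x + (innerSL ℝ x).smulRight ((w * (‖x‖ : ℂ) ^ (w - 2)) • Q x)

theorem normPowDeriv_apply (w : ℂ) (Q : Euc n → F) (Q' : Euc n → Euc n →L[ℝ] F) (x : Euc n)
    (k : Fin n) : normPowDeriv w Q Q' x (stdB n k) =
      ((‖x‖ : ℂ) ^ w) • Q' x (stdB n k) + (x k : ℂ) • (w * (‖x‖ : ℂ) ^ (w - 2)) • Q x := by
  simp only [normPowDeriv, add_apply, smul_apply, ContinuousLinearMap.smulRight_apply,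
    innerSL_apply_apply, inner_stdB, Complex.coe_smul]

theorem tempC1_normPow {w : ℂ} (hw : 2 < w.re) {Q : Euc n → F} {Q' : Euc n → Euc n →L[ℝ] F}
    (h : TempC1 Q Q') :
    TempC1 (fun x => ((‖x‖ : ℂ) ^ w) • Q x) (normPowDeriv w Q Q') where
  hasFDerivAt x := by
    refine ((hasFDerivAt_norm_cpow hw x).smul (h.hasFDerivAt x)).congr_fderiv ?_
    ext v
    simp [normPowDeriv, mul_smul]
  cont := by
    have h1 := continuous_norm_cpow (n := n) (w := w) (by linarith)
    have h2 := continuous_norm_cpow (n := n) (w := w - 2) (by simpa using hw)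
    have h3 := h.continuous
    refine (h1.smul h.cont).add ?_
    have h4 : Continuous fun x : Euc n => (w * (‖x‖ : ℂ) ^ (w - 2)) • Q x :=
      (continuous_const.mul h2).smul h3
    exact ((ContinuousLinearMap.smulRightL ℝ (Euc n) F).continuous.comp
      (innerSL ℝ).continuous).clm_apply h4
  bdd := (polyBdd_norm_cpow (by linarith)).of_le_mul h.bdd fun x => (norm_smul_le _ _)
  bdd' := by
    refine PolyBdd.add ?_ ?_
    · exact (polyBdd_norm_cpow (by linarith)).of_le_mul h.bdd' fun x => (norm_smul _ _).le
    · have h2 := polyBdd_norm_cpow (n := n) (w := w - 2) (by simpa using hw)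
      have h3 : PolyBdd fun x : Euc n => (w * (‖x‖ : ℂ) ^ (w - 2)) • Q x :=
        (PolyBdd.of_le_mul (h := fun x : Euc n => (w * (‖x‖ : ℂ) ^ (w - 2)))
          (f := fun _ => w) ⟨‖w‖, 0, fun x => by simp⟩ h2
          fun x => norm_mul_le _ _).of_le_mul h.bdd fun x => norm_smul_le _ _
      have h4 : PolyBdd fun x : Euc n => (‖x‖ : ℂ) := ⟨1, 1, fun x => by simp⟩
      refine h4.of_le_mul h3 fun x => ?_
      rw [ContinuousLinearMap.norm_smulRight_apply, innerSL_apply_norm]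
      simp

theorem sum_extMul_normPowDeriv {p : ℕ} (w : ℂ) (Q : Euc n → Form n p)
    (Q' : Euc n → Euc n →L[ℝ] Form n p) (x : Euc n) :
    ∑ k, extMul (stdB n k) (normPowDeriv w Q Q' x (stdB n k)) =
      ((‖x‖ : ℂ) ^ w) • ∑ k, extMul (stdB n k) (Q' x (stdB n k)) +
        (w * (‖x‖ : ℂ) ^ (w - 2)) • extMul x (Q x) := by
  simp only [normPowDeriv_apply, map_add, map_smul, Finset.sum_add_distrib, ← Finset.smul_sum]
  congr 1
  rw [← sum_smul_extMul x, Finset.smul_sum]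
  exact Finset.sum_congr rfl fun k _ => smul_comm _ _ _

theorem sum_intMul_normPowDeriv {p : ℕ} (w : ℂ) (Q : Euc n → Form n (p + 1))
    (Q' : Euc n → Euc n →L[ℝ] Form n (p + 1)) (x : Euc n) :
    ∑ k, intMul (stdB n k) (normPowDeriv w Q Q' x (stdB n k)) =
      ((‖x‖ : ℂ) ^ w) • ∑ k, intMul (stdB n k) (Q' x (stdB n k)) +
        (w * (‖x‖ : ℂ) ^ (w - 2)) • intMul x (Q x) := by
  simp only [normPowDeriv_apply, map_add, map_smul, Finset.sum_add_distrib, ← Finset.smul_sum]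
  congr 1
  rw [← sum_smul_intMul x, Finset.smul_sum]
  exact Finset.sum_congr rfl fun k _ => smul_comm _ _ _

theorem norm_cpow_sub_two {w : ℂ} (hw : 2 < w.re) (x : Euc n) :
    (‖x‖ : ℂ) ^ w = (‖x‖ : ℂ) ^ (w - 2) * ((‖x‖ ^ 2 : ℝ) : ℂ) := by
  rcases eq_or_ne x 0 with rfl | hx
  · have : w ≠ 0 := by
      rintro rfl
      simp at hw
      linarith
    simp [this]
  · have hx' : (‖x‖ : ℂ) ≠ 0 := by exact_mod_cast norm_ne_zero_iff.mpr hx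
    rw [Complex.cpow_sub _ _ hx', Complex.cpow_ofNat]
    push_cast
    field_simp

end NormPow

/-! ### d and δ of the kernels, computed pointwise. -/

section Derivatives

variable {n p : ℕ}

theorem Form.real_smul (c : ℝ) (ω : Form n p) : c • ω = (c : ℂ) • ω := (Complex.coe_smul c ω).symm

theorem extInt₂_add_left (u v x : Euc n) (ω : Form n p) :
    extInt₂ n p (u + v) x ω = extInt₂ n p u x ω + extInt₂ n p v x ω := by
  cases p with
  | zero => simp [extInt₂]
  | succ p => exact extMul_add _ _ _

theorem extInt₂_smul_left (c : ℝ) (u x : Euc n) (ω : Form n p) :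
    extInt₂ n p (c • u) x ω = (c : ℂ) • extInt₂ n p u x ω := by
  cases p with
  | zero => simp [extInt₂]
  | succ p => exact extMul_smul _ _ _

theorem extInt₂_add_right (u v x : Euc n) (ω : Form n p) :
    extInt₂ n p x (u + v) ω = extInt₂ n p x u ω + extInt₂ n p x v ω := by
  cases p with
  | zero => simp [extInt₂]
  | succ p => simp [extInt₂, intMul_add]

theorem extInt₂_smul_right (c : ℝ) (u x : Euc n) (ω : Form n p) :
    extInt₂ n p x (c • u) ω = (c : ℂ) • extInt₂ n p x u ω := by
  cases p with
  | zero => simp [extInt₂]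
  | succ p => simp [extInt₂, intMul_smul]

/-- `ε_x β` as a function of `x`. -/
noncomputable def extMulFlip (β : Form n p) : Euc n →L[ℝ] Form n (p + 1) :=
  LinearMap.toContinuousLinearMap
    { toFun := fun x => extMul x β
      map_add' := fun x y => extMul_add x y β
      map_smul' := fun c x => by rw [extMul_smul, RingHom.id_apply, Form.real_smul] }

/-- `i_x β` as a function of `x`. -/
noncomputable def intMulFlip (β : Form n (p + 1)) : Euc n →L[ℝ] Form n p :=
  LinearMap.toContinuousLinearMap
    { toFun := fun x => intMul x β
      map_add' := fun x y => intMul_add x y β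
      map_smul' := fun c x => by rw [intMul_smul, RingHom.id_apply, Form.real_smul] }

theorem extMulFlip_apply (c : ℂ) (β : Form n p) (x : Euc n) :
    (c • extMulFlip β) x = c • extMul x β := rfl

theorem intMulFlip_apply (c : ℂ) (β : Form n (p + 1)) (x : Euc n) :
    (c • intMulFlip β) x = c • intMul x β := rfl

/-- `a i_u ε_v β + b ε_u i_v β` as a bilinear function of `u` and `v`. -/
noncomputable def quadBilin (a b : ℂ) (β : Form n p) : Euc n →L[ℝ] Euc n →L[ℝ] Form n p :=
  LinearMap.toContinuousLinearMap
    (LinearMap.toContinuousLinearMap.toLinearMap ∘ₗ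
      LinearMap.mk₂ ℝ (fun u v => a • intMul u (extMul v β) + b • extInt₂ n p u v β)
        (fun u v x => by rw [intMul_add, extInt₂_add_left]; module)
        (fun c u x => by
          rw [intMul_smul, extInt₂_smul_left, Form.real_smul]; module)
        (fun u v x => by rw [extMul_add, extInt₂_add_right, map_add]; module)
        (fun c u x => by
          rw [extMul_smul, extInt₂_smul_right, Form.real_smul, map_smul]; module))

theorem quadBilin_apply (a b : ℂ) (β : Form n p) (u v : Euc n) :
    quadBilin a b β u v = a • intMul u (extMul v β) + b • extInt₂ n p u v β := rfl

/-- `(a i_x ε_x + b ε_x i_x) β`. -/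
noncomputable def quadForm (a b : ℂ) (β : Form n p) (x : Euc n) : Form n p :=
  a • intExt n p x β + b • extInt n p x β

theorem quadBilin_self (a b : ℂ) (β : Form n p) (x : Euc n) :
    quadBilin a b β x x = quadForm a b β x := by
  rw [quadBilin_apply, extInt₂_self]
  rfl

theorem polyBdd_clm {F : Type*} [NormedAddCommGroup F] [NormedSpace ℝ F] (L : Euc n →L[ℝ] F) :
    PolyBdd L :=
  ⟨‖L‖, 1, fun x => (L.le_opNorm x).trans (by gcongr; simp)⟩

theorem tempC1_clm {F : Type*} [NormedAddCommGroup F] [NormedSpace ℂ F] (L : Euc n →L[ℝ] F) :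
    TempC1 L fun _ => L where
  hasFDerivAt x := L.hasFDerivAt
  cont := continuous_const
  bdd := polyBdd_clm L
  bdd' := ⟨‖L‖, 0, fun x => by simp⟩

theorem tempC1_quadForm (a b : ℂ) (β : Form n p) :
    TempC1 (quadForm a b β) fun x => quadBilin a b β x + (quadBilin a b β).flip x where
  hasFDerivAt x := by
    have h := (quadBilin a b β).hasFDerivAt_of_bilinear (hasFDerivAt_id x) (hasFDerivAt_id x)
    refine (h.congr_fderiv ?_).congr_of_eventuallyEq
      (Eventually.of_forall fun y => (quadBilin_self a b β y).symm)
    ext v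
    simp
  cont := by fun_prop
  bdd := by
    refine (polyBdd_clm (quadBilin a b β)).of_le_mul
      (polyBdd_clm (ContinuousLinearMap.id ℝ (Euc n))) fun x => ?_
    rw [← quadBilin_self]
    exact (quadBilin a b β x).le_opNorm x
  bdd' := (polyBdd_clm _).add (polyBdd_clm _)

theorem extMul_extInt₂ (u v x : Euc n) (β : Form n p) :
    extMul u (extInt₂ n p x v β) = -extMul x (extInt₂ n p u v β) := by
  cases p with
  | zero => simp [extInt₂]
  | succ p => exact extMul_extMul_comm _ _ _

theorem extMul_extInt₂_self (u v : Euc n) (β : Form n p) :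
    extMul u (extInt₂ n p u v β) = 0 := by
  cases p with
  | zero => simp [extInt₂]
  | succ p => exact extMul_extMul_self _ _

theorem extInt₂_intMul_self (u v : Euc n) (β : Form n (p + 1)) :
    extInt₂ n p u v (intMul v β) = 0 := by
  cases p with
  | zero => simp [extInt₂]
  | succ p => simp [extInt₂, intMul_intMul_self]

theorem sum_extInt₂_basis (β : Form n p) :
    ∑ k, extInt₂ n p (stdB n k) (stdB n k) β = (p : ℂ) • β := by
  simp only [extInt₂_self]
  exact sum_extInt β

/-- This is d of the quadratic part alone. After i_x ε_{e_k} is rewritten by anticommutation, terms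
with a repeated ε_{e_k} vanish and the rest are degree counts: p for β and p + 1 for ε_x β. -/
theorem sum_extMul_quadBilin (a b : ℂ) (β : Form n p) (x : Euc n) :
    ∑ k, extMul (stdB n k)
      ((quadBilin a b β x + (quadBilin a b β).flip x) (stdB n k)) =
      ((p + 2) * a - p * b) • extMul x β := by
  have h1 : ∀ k, extMul (stdB n k)
      ((quadBilin a b β x + (quadBilin a b β).flip x) (stdB n k)) =
      a • ((x k : ℂ) • extMul (stdB n k) β) -
        b • extMul x (extInt₂ n p (stdB n k) (stdB n k) β) +
        a • extMul (stdB n k) (intMul (stdB n k) (extMul x β)) := fun k => by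
    have h2 : intMul x (extMul (stdB n k) β) =
        (x k : ℂ) • β - extInt₂ n p (stdB n k) x β := by
      rw [eq_sub_iff_add_eq, intMul_extMul_add, inner_stdB]
    rw [add_apply, ContinuousLinearMap.flip_apply, quadBilin_apply, quadBilin_apply, h2]
    simp only [map_add, map_sub, map_smul, extMul_extInt₂_self, extMul_extInt₂ (stdB n k) _ x]
    module
  simp only [h1, Finset.sum_add_distrib, Finset.sum_sub_distrib, ← Finset.smul_sum,
    sum_smul_extMul, sum_extMul_intMul, ← map_sum, sum_extInt₂_basis, map_smul]
  module

theorem extMul_quadForm (a b : ℂ) (β : Form n p) (x : Euc n) :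
    extMul x (quadForm a b β x) = (a * ((‖x‖ ^ 2 : ℝ) : ℂ)) • extMul x β := by
  have h := congrArg (extMul x) (intExt_add_extInt x β)
  rw [map_add, map_smul] at h
  rw [quadForm, map_add, map_smul, map_smul, ← extInt₂_self, extMul_extInt₂_self] at *
  rw [add_zero] at h
  rw [h]
  module

/-- Dual to `sum_extMul_quadBilin`: repeated contractions vanish, and the traces are n minus the
degree. -/
theorem sum_intMul_quadBilin (a b : ℂ) (β : Form n (p + 1)) (x : Euc n) :
    ∑ k, intMul (stdB n k)
      ((quadBilin a b β x + (quadBilin a b β).flip x) (stdB n k)) =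
      (-((n : ℂ) - (p + 1)) * a + (n - (p + 1) + 2) * b) • intMul x β := by
  have h1 : ∀ k, intMul (stdB n k)
      ((quadBilin a b β x + (quadBilin a b β).flip x) (stdB n k)) =
      b • ((x k : ℂ) • intMul (stdB n k) β) -
        a • intMul x (intMul (stdB n k) (extMul (stdB n k) β)) +
        b • intMul (stdB n k) (extMul (stdB n k) (intMul x β)) := fun k => by
    have h2 : intMul (stdB n k) (extMul x (intMul (stdB n k) β)) =
        (x k : ℂ) • intMul (stdB n k) β := by
      have := intMul_extMul_add (stdB n k) x (intMul (stdB n k) β)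
      rwa [extInt₂_intMul_self, add_zero, real_inner_comm, inner_stdB] at this
    rw [add_apply, ContinuousLinearMap.flip_apply, quadBilin_apply, quadBilin_apply]
    simp only [map_add, map_smul, intMul_intMul_self, intMul_intMul_comm (stdB n k) x]
    change a • -_ + b • intMul (stdB n k) (extMul x (intMul (stdB n k) β)) +
      (a • 0 + b • intMul (stdB n k) (extMul (stdB n k) (intMul x β))) = _
    rw [h2]
    module
  simp only [h1, Finset.sum_add_distrib, Finset.sum_sub_distrib, ← Finset.smul_sum,
    sum_smul_intMul, sum_intMul_extMul, ← map_sum, map_smul]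
  push_cast
  module

theorem intMul_quadForm (a b : ℂ) (β : Form n (p + 1)) (x : Euc n) :
    intMul x (quadForm a b β x) = (b * ((‖x‖ ^ 2 : ℝ) : ℂ)) • intMul x β := by
  have h := congrArg (intMul x) (intExt_add_extInt x β)
  have h0 : intMul x (intExt n (p + 1) x β) = 0 := intMul_intMul_self x (extMul x β)
  rw [map_add, map_smul, h0, zero_add] at h
  rw [quadForm, map_add, map_smul, map_smul, h0, h]
  module

variable [NeZero n]

/-- Differentiating |x|^w contributes w ε_x, which kills the ε_x i_x part and sees the other as
|x|². The total coefficient is the expression defining C at w + 2. -/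
theorem givenBy_extD_quadForm {w : ℂ} (hw : 2 < w.re) {a b : ℂ} {β : Form n p}
    {T : 𝓢'(Euc n, Form n p)} (hT : GivenBy T fun x => ((‖x‖ : ℂ) ^ w) • quadForm a b β x) :
    GivenBy (extD n p T) fun x => ((‖x‖ : ℂ) ^ w) •
      (((w + 2 + p) * a - p * b) • extMulFlip β) x := by
  have h := givenBy_extD hT (tempC1_normPow hw (tempC1_quadForm a b β))
  refine h.congr fun x => ?_
  rw [sum_extMul_normPowDeriv, sum_extMul_quadBilin, extMul_quadForm, extMulFlip_apply,
    norm_cpow_sub_two hw x]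
  module

theorem givenBy_coD_quadForm {w : ℂ} (hw : 2 < w.re) {a b : ℂ} {β : Form n (p + 1)}
    {T : 𝓢'(Euc n, Form n (p + 1))}
    (hT : GivenBy T fun x => ((‖x‖ : ℂ) ^ w) • quadForm a b β x) :
    GivenBy (coD n p T) fun x => ((‖x‖ : ℂ) ^ w) •
      (-(-((n : ℂ) - (p + 1)) * a + (w + 2 + n - (p + 1)) * b) • intMulFlip β) x := by
  have h := givenBy_coD hT (tempC1_normPow hw (tempC1_quadForm a b β))
  refine h.congr fun x => ?_
  rw [sum_intMul_normPowDeriv, sum_intMul_quadBilin, intMul_quadForm, intMulFlip_apply,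
    norm_cpow_sub_two hw x]
  module

/-- The trace term is (n-p) |x|^w β; splitting |x|² β by `intExt_add_extInt` brings it to the form
of the other term, w |x|^(w-2) i_x ε_x β. -/
theorem givenBy_coD_extMulFlip {w : ℂ} (hw : 2 < w.re) {c : ℂ} {β : Form n p}
    {T : 𝓢'(Euc n, Form n (p + 1))}
    (hT : GivenBy T fun x => ((‖x‖ : ℂ) ^ w) • (c • extMulFlip β) x) :
    GivenBy (coD n p T) fun x => ((‖x‖ : ℂ) ^ (w - 2)) •
      (-c) • quadForm (w + n - p) (n - p) β x := by
  have h := givenBy_coD hT (tempC1_normPow hw (tempC1_clm (c • extMulFlip β)))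
  refine h.congr fun x => ?_
  have h2 : ((‖x‖ ^ 2 : ℝ) : ℂ) • β = intMul x (extMul x β) + extInt n p x β :=
    (intExt_add_extInt x β).symm
  rw [sum_intMul_normPowDeriv, norm_cpow_sub_two hw x]
  simp only [extMulFlip_apply, map_smul, ← Finset.smul_sum, sum_intMul_extMul]
  rw [mul_smul, smul_comm _ c, smul_comm _ ((n : ℂ) - p), h2, quadForm]
  change _ = _ • -c • (_ • intMul x (extMul x β) + _)
  module

theorem givenBy_extD_intMulFlip {w : ℂ} (hw : 2 < w.re) {c : ℂ} {β : Form n (p + 1)}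
    {T : 𝓢'(Euc n, Form n p)}
    (hT : GivenBy T fun x => ((‖x‖ : ℂ) ^ w) • (c • intMulFlip β) x) :
    GivenBy (extD n p T) fun x => ((‖x‖ : ℂ) ^ (w - 2)) •
      c • quadForm (p + 1) (w + (p + 1)) β x := by
  have h := givenBy_extD hT (tempC1_normPow hw (tempC1_clm (c • intMulFlip β)))
  refine h.congr fun x => ?_
  have h2 : ((‖x‖ ^ 2 : ℝ) : ℂ) • β = intExt n (p + 1) x β + extMul x (intMul x β) :=
    (intExt_add_extInt x β).symm
  rw [sum_extMul_normPowDeriv, norm_cpow_sub_two hw x]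
  simp only [intMulFlip_apply, map_smul, ← Finset.smul_sum, sum_extMul_intMul]
  rw [mul_smul, smul_comm _ c, smul_comm _ ((p : ℂ) + 1), h2, quadForm]
  change _ = _ • c • (_ + _ • extMul x (intMul x β))
  module

end Derivatives

/-! ### The continued Riesz family under δd and dδ. -/

section Families

variable {n p : ℕ}

theorem contDiff_extMul :
    ContDiff ℝ (↑(⊤ : ℕ∞)) fun x : Euc n => (extMul x : Form n p →L[ℂ] Form n (p + 1)) :=
  (LinearMap.toContinuousLinearMap
    ({ toFun := fun x => extMul x
       map_add' := fun x y => ContinuousLinearMap.ext fun ω => extMul_add x y ω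
       map_smul' := fun c x => ContinuousLinearMap.ext fun ω => by
        rw [extMul_smul, RingHom.id_apply, smul_apply, Form.real_smul] } :
      Euc n →ₗ[ℝ] (Form n p →L[ℂ] Form n (p + 1)))).contDiff

theorem contDiff_intMul :
    ContDiff ℝ (↑(⊤ : ℕ∞)) fun x : Euc n => (intMul x : Form n (p + 1) →L[ℂ] Form n p) :=
  (LinearMap.toContinuousLinearMap
    ({ toFun := fun x => intMul x
       map_add' := fun x y => ContinuousLinearMap.ext fun ω => intMul_add x y ω
       map_smul' := fun c x => ContinuousLinearMap.ext fun ω => by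
        rw [intMul_smul, RingHom.id_apply, smul_apply, Form.real_smul] } :
      Euc n →ₗ[ℝ] (Form n (p + 1) →L[ℂ] Form n p))).contDiff

theorem contDiff_clm_comp {m n' l : ℕ} {f : Euc n → (Form n n' →L[ℂ] Form n l)}
    {g : Euc n → (Form n m →L[ℂ] Form n n')} (hf : ContDiff ℝ (↑(⊤ : ℕ∞)) f)
    (hg : ContDiff ℝ (↑(⊤ : ℕ∞)) g) : ContDiff ℝ (↑(⊤ : ℕ∞)) fun x => (f x).comp (g x) := by
  have h : IsBoundedBilinearMap ℝ
      fun u : (Form n n' →L[ℂ] Form n l) × (Form n m →L[ℂ] Form n n') =>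
        ((ContinuousLinearMap.compL ℂ (Form n m) (Form n n')
          (Form n l)).bilinearRestrictScalars ℝ) u.1 u.2 :=
    ContinuousLinearMap.isBoundedBilinearMap _
  exact h.contDiff.comp (hf.prodMk hg)

theorem contDiff_intExt (n p : ℕ) : ContDiff ℝ (↑(⊤ : ℕ∞)) (intExt n p) :=
  contDiff_clm_comp contDiff_intMul contDiff_extMul

theorem contDiff_extInt (n p : ℕ) : ContDiff ℝ (↑(⊤ : ℕ∞)) (extInt n p) := by
  cases p with
  | zero => exact contDiff_const
  | succ p => exact contDiff_clm_comp contDiff_extMul contDiff_intMul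

theorem isQuad_intExt (n p : ℕ) : IsQuad (intExt n p) where
  cont := (contDiff_intExt n p).continuous
  hom := intExt_smul

theorem isQuad_extInt (n p : ℕ) : IsQuad (extInt n p) where
  cont := (contDiff_extInt n p).continuous
  hom := extInt_smul

theorem applyForm_apply (β : Form n p) (T : 𝓢'(Euc n, FormEnd n p)) (φ : 𝓢(Euc n, ℂ)) :
    applyForm β T φ = T φ β := rfl

theorem GivenBy.const_smul {F : Type*} [NormedAddCommGroup F] [NormedSpace ℂ F]
    {T : 𝓢'(Euc n, F)} {K : Euc n → F} (h : GivenBy T K) (c : ℂ) :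
    GivenBy (c • T) fun x => c • K x := by
  intro φ
  have h1 : (fun x => φ x • c • K x) = c • fun x => φ x • K x := by
    ext1 x
    rw [smul_comm]
    rfl
  rw [h1]
  refine ⟨(h φ).1.smul c, ?_⟩
  change c • T φ = ∫ x, c • (φ x • K x)
  rw [integral_smul, ← (h φ).2]

/-- Families of tempered distributions that are pointwise holomorphic on `U`. -/
def HolOn {F : Type*} [NormedAddCommGroup F] [NormedSpace ℂ F] (T : ℂ → 𝓢'(Euc n, F))
    (U : Set ℂ) : Prop :=
  ∀ φ : 𝓢(Euc n, ℂ), DifferentiableOn ℂ (fun z => T z φ) U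

theorem HolOn.extD {T : ℂ → 𝓢'(Euc n, Form n p)} {U : Set ℂ} (h : HolOn T U) :
    HolOn (fun z => extD n p (T z)) U := by
  intro φ
  simp only [extD_apply, partialD_apply]
  exact DifferentiableOn.fun_sum fun k _ =>
    ((extMul (stdB n k)).differentiable.comp_differentiableOn (h (partialS k φ)).neg)

theorem HolOn.coD {T : ℂ → 𝓢'(Euc n, Form n (p + 1))} {U : Set ℂ} (h : HolOn T U) :
    HolOn (fun z => coD n p (T z)) U := by
  intro φ
  simp only [coD_apply, partialD_apply]
  exact (DifferentiableOn.fun_sum fun k _ =>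
    ((intMul (stdB n k)).differentiable.comp_differentiableOn (h (partialS k φ)).neg)).neg

theorem HolOn.coDextD {T : ℂ → 𝓢'(Euc n, Form n p)} {U : Set ℂ} (h : HolOn T U) :
    HolOn (fun z => coDextD n p (T z)) U := h.extD.coD

theorem HolOn.extDcoD {T : ℂ → 𝓢'(Euc n, Form n p)} {U : Set ℂ} (h : HolOn T U) :
    HolOn (fun z => extDcoD n p (T z)) U := by
  cases p with
  | zero => exact fun φ => differentiableOn_const 0
  | succ p => exact h.coD.extD

theorem HolOn.comp_add_two {F : Type*} [NormedAddCommGroup F] [NormedSpace ℂ F]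
    {T : ℂ → 𝓢'(Euc n, F)} (h : HolOn T (poleSet n)ᶜ) :
    HolOn (fun z => T (z + 2)) (poleSet n)ᶜ := fun φ =>
  (h φ).comp (f := fun z : ℂ => z + 2) (by fun_prop) fun _ hz => add_two_notMem_poleSet hz

theorem HolOn.eq_of_re {F : Type*} [NormedAddCommGroup F] [NormedSpace ℂ F] [CompleteSpace F]
    {S T : ℂ → 𝓢'(Euc n, F)} (hS : HolOn S (poleSet n)ᶜ) (hT : HolOn T (poleSet n)ᶜ) {γ : ℝ}
    (hγ : -(n : ℝ) ≤ γ) (h : ∀ z : ℂ, γ < z.re → S z = T z) {z : ℂ} (hz : z ∉ poleSet n) :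
    S z = T z := by
  ext φ
  exact eqOn_of_eqOn_re_gt (isOpen_compl_poleSet n) (isPreconnected_compl_poleSet n) (hS φ) (hT φ)
    (fun w hw => notMem_poleSet_of_re (lt_of_le_of_lt hγ hw)) (fun w hw => by rw [h w hw]) hz

theorem HolOn.smul {F : Type*} [NormedAddCommGroup F] [NormedSpace ℂ F]
    {T : ℂ → 𝓢'(Euc n, F)} {U : Set ℂ} (h : HolOn T U) {f : ℂ → ℂ} (hf : Differentiable ℂ f) :
    HolOn (fun z => f z • T z) U := fun φ => hf.differentiableOn.smul (h φ)

variable [NeZero n]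

/-- The continued Riesz distribution with constant coefficients `a` and `b`. -/
noncomputable def rieszR (n p : ℕ) [NeZero n] (a b z : ℂ) : 𝓢'(Euc n, FormEnd n p) :=
  a • rieszDist (isQuad_intExt n p) z + b • rieszDist (isQuad_extInt n p) z

theorem rieszR_apply (a b z : ℂ) (φ : 𝓢(Euc n, ℂ)) :
    rieszR n p a b z φ =
      a • rieszDist (isQuad_intExt n p) z φ + b • rieszDist (isQuad_extInt n p) z φ := rfl

theorem isGivenBy_rieszR (a b : ℂ) {z : ℂ} (hz : -(n : ℝ) < z.re) :
    IsGivenBy (rieszR n p a b z) (rieszKernel n p z a b) := by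
  intro φ
  have h1 := (integrable_schwartz_smul_kern (isQuad_intExt n p) φ hz).smul a
  have h2 := (integrable_schwartz_smul_kern (isQuad_extInt n p) φ hz).smul b
  have h3 : (fun x => φ x • rieszKernel n p z a b x) =
      (a • fun x => φ x • kern (intExt n p) z x) + b • fun x => φ x • kern (extInt n p) z x := by
    ext1 x
    simp only [rieszKernel, kern, Pi.add_apply, Pi.smul_apply]
    module
  rw [h3]
  refine ⟨h1.add h2, ?_⟩
  rw [rieszR_apply, rieszDist_apply _ hz, rieszDist_apply _ hz, integral_add' h1 h2]
  simp only [Pi.smul_apply]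
  rw [integral_smul, integral_smul]
  rfl

theorem givenBy_applyForm_rieszR (a b : ℂ) {z : ℂ} (hz : -(n : ℝ) < z.re) (β : Form n p) :
    GivenBy (applyForm β (rieszR n p a b z)) fun x => ((‖x‖ : ℂ) ^ (z - 2)) • quadForm a b β x := by
  intro φ
  obtain ⟨h1, h2⟩ := isGivenBy_rieszR (p := p) a b hz φ
  have h3 : (fun x => φ x • ((‖x‖ : ℂ) ^ (z - 2)) • quadForm a b β x) =
      fun x => (ContinuousLinearMap.apply ℂ (Form n p) β) (φ x • rieszKernel n p z a b x) := by
    ext1 x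
    simp [rieszKernel, quadForm]
  rw [h3]
  refine ⟨ContinuousLinearMap.integrable_comp _ h1, ?_⟩
  rw [applyForm_apply, h2, ContinuousLinearMap.integral_comp_comm _ h1]
  rfl

/-- The bound on Re z makes |x|^z continuously differentiable, so both derivatives can be taken
pointwise. -/
theorem coDextD_rieszR_of_re {z : ℂ} (hz : 2 < z.re) (a b : ℂ) (β : Form n p) :
    coDextD n p (applyForm β (rieszR n p a b (z + 2))) =
      (-((z + 2 + p) * a - p * b)) • applyForm β (rieszR n p (z + n - p) (n - p) z) := by
  have hn : (0 : ℝ) ≤ n := Nat.cast_nonneg n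
  have h1 := givenBy_applyForm_rieszR (p := p) a b (z := z + 2)
    (by simp only [Complex.add_re, Complex.re_ofNat]; linarith) β
  rw [add_sub_cancel_right] at h1
  have h2 := givenBy_coD_extMulFlip hz (givenBy_extD_quadForm hz h1)
  have h3 := (givenBy_applyForm_rieszR (p := p) (z + n - p) (n - p) (z := z)
    (by linarith) β).const_smul (-((z + 2 + p) * a - p * b))
  exact h2.eq (h3.congr fun x => smul_comm _ _ _)

theorem extDcoD_rieszR_of_re {z : ℂ} (hz : 2 < z.re) (a b : ℂ) (β : Form n p) :
    extDcoD n p (applyForm β (rieszR n p a b (z + 2))) =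
      (-(-((n : ℂ) - p) * a + (z + 2 + n - p) * b)) • applyForm β (rieszR n p p (z + p) z) := by
  have hn : (0 : ℝ) ≤ n := Nat.cast_nonneg n
  have h3 := (givenBy_applyForm_rieszR (p := p) p (z + p) (z := z) (by linarith) β).const_smul
    (-(-((n : ℂ) - p) * a + (z + 2 + n - p) * b))
  cases p with
  | zero =>
    have h0 : GivenBy (0 : 𝓢'(Euc n, Form n 0)) fun _ => 0 := fun φ => by
      simp
    refine (h0.congr fun x => ?_).eq h3
    simp [quadForm, extInt]
  | succ p =>
    have h1 := givenBy_applyForm_rieszR (p := p + 1) a b (z := z + 2)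
      (by simp only [Complex.add_re, Complex.re_ofNat]; linarith) β
    rw [add_sub_cancel_right] at h1
    have h2 := givenBy_extD_intMulFlip hz (givenBy_coD_quadForm hz h1)
    refine h2.eq (h3.congr fun x => ?_)
    push_cast
    exact smul_comm _ _ _

theorem holOn_applyForm_rieszR {f g : ℂ → ℂ} (hf : Differentiable ℂ f) (hg : Differentiable ℂ g)
    (β : Form n p) : HolOn (fun z => applyForm β (rieszR n p (f z) (g z) z)) (poleSet n)ᶜ := by
  intro φ
  have h1 := differentiableOn_rieszDist (isQuad_intExt n p) φ
  have h2 := differentiableOn_rieszDist (isQuad_extInt n p) φ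
  have h3 := (hf.differentiableOn (s := (poleSet n)ᶜ)).smul h1 |>.add
    ((hg.differentiableOn (s := (poleSet n)ᶜ)).smul h2)
  exact (ContinuousLinearMap.apply ℂ (Form n p) β).differentiable.comp_differentiableOn h3

/-- Both sides are holomorphic off the pole set, which is stable enough: z + 2 is regular whenever z
is. Analytic continuation then removes the restriction on Re z. -/
theorem coDextD_rieszR {z : ℂ} (hz : z ∉ poleSet n) (a b : ℂ) (β : Form n p) :
    coDextD n p (applyForm β (rieszR n p a b (z + 2))) =
      (-((z + 2 + p) * a - p * b)) • applyForm β (rieszR n p (z + n - p) (n - p) z) := by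
  have hn : (0 : ℝ) ≤ n := Nat.cast_nonneg n
  exact (holOn_applyForm_rieszR (differentiable_const a) (differentiable_const b)
      β).comp_add_two.coDextD.eq_of_re
    ((holOn_applyForm_rieszR (f := fun z => z + n - p) (by fun_prop)
      (differentiable_const ((n : ℂ) - p)) β).smul (f := fun z => -((z + 2 + p) * a - p * b))
      (by fun_prop)) (γ := 2) (by linarith) (fun w hw => coDextD_rieszR_of_re hw a b β) hz

theorem extDcoD_rieszR {z : ℂ} (hz : z ∉ poleSet n) (a b : ℂ) (β : Form n p) :
    extDcoD n p (applyForm β (rieszR n p a b (z + 2))) =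
      (-(-((n : ℂ) - p) * a + (z + 2 + n - p) * b)) • applyForm β (rieszR n p p (z + p) z) := by
  have hn : (0 : ℝ) ≤ n := Nat.cast_nonneg n
  exact (holOn_applyForm_rieszR (differentiable_const a) (differentiable_const b)
      β).comp_add_two.extDcoD.eq_of_re
    ((holOn_applyForm_rieszR (g := fun z => z + p) (differentiable_const (p : ℂ)) (by fun_prop)
      β).smul (f := fun z => -(-((n : ℂ) - p) * a + (z + 2 + n - p) * b))
      (by fun_prop)) (γ := 2) (by linarith) (fun w hw => extDcoD_rieszR_of_re hw a b β) hz

end Families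

/-! ### Bernstein–Sato identities and their iterates. -/

section BernsteinSato

variable {n p : ℕ} [NeZero n]

theorem smul_rieszR (c a b z : ℂ) : c • rieszR n p a b z = rieszR n p (c * a) (c * b) z := by
  simp only [rieszR, smul_add, smul_smul]

theorem rieszR_add (a b a' b' z : ℂ) :
    rieszR n p a b z + rieszR n p a' b' z = rieszR n p (a + a') (b + b') z := by
  simp only [rieszR]
  module

/-- The product `∏_{j<k} (z+2j)(z+2j+n)`. -/
noncomputable def bernsteinProd (n k : ℕ) (z : ℂ) : ℂ :=
  ∏ j ∈ Finset.range k, ((z + 2 * j) * (z + 2 * j + n))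

theorem bernsteinProd_succ (n k : ℕ) (z : ℂ) :
    bernsteinProd n (k + 1) z = bernsteinProd n k (z + 2) * (z * (z + n)) := by
  rw [bernsteinProd, Finset.prod_range_succ', bernsteinProd]
  congr 1
  · refine Finset.prod_congr rfl fun j _ => ?_
    push_cast
    ring
  · simp

theorem ascPochhammer_mul_eval (n k : ℕ) (z : ℂ) :
    4 ^ k * (ascPochhammer ℂ k).eval (z / 2) * (ascPochhammer ℂ k).eval ((z + n) / 2) =
      bernsteinProd n k z := by
  induction k with
  | zero => simp [bernsteinProd]
  | succ k ih =>
    rw [bernsteinProd, Finset.prod_range_succ, ← bernsteinProd, ← ih, ascPochhammer_succ_eval,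
      ascPochhammer_succ_eval, pow_succ]
    ring

/-- After one application the coefficients are (z+n-p, n-p), for which (z+p)(z+n-p) - p(n-p) =
z(z+n); each further application only multiplies by such a factor with a sign. -/
theorem coDextD_pow_rieszR (k : ℕ) {z : ℂ} (hz : z ∉ poleSet n) (a b : ℂ) (β : Form n p) :
    (coDextD n p ^ (k + 1)) (applyForm β (rieszR n p a b (z + 2 * (k + 1 : ℕ)))) =
      ((-1) ^ (k + 1) * ((z + 2 * (k + 1 : ℕ) + p) * a - p * b) * bernsteinProd n k (z + 2)) •
        applyForm β (rieszR n p (z + n - p) (n - p) z) := by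
  induction k generalizing z with
  | zero =>
    have := coDextD_rieszR hz a b β
    simp only [zero_add, pow_one, Nat.cast_one, mul_one, bernsteinProd, Finset.range_zero,
      Finset.prod_empty, this]
    congr 1
    ring
  | succ k ih =>
    have h1 := ih (add_two_notMem_poleSet hz)
    have h2 : z + 2 * ((k + 1 + 1 : ℕ) : ℂ) = z + 2 + 2 * ((k + 1 : ℕ) : ℂ) := by
      push_cast; ring
    rw [pow_succ', Module.End.mul_apply, h2, h1, map_smul, coDextD_rieszR hz, smul_smul,
      bernsteinProd_succ n k (z + 2)]
    congr 1
    ring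

theorem extDcoD_pow_rieszR (k : ℕ) {z : ℂ} (hz : z ∉ poleSet n) (a b : ℂ) (β : Form n p) :
    (extDcoD n p ^ (k + 1)) (applyForm β (rieszR n p a b (z + 2 * (k + 1 : ℕ)))) =
      ((-1) ^ (k + 1) * (-((n : ℂ) - p) * a + (z + 2 * (k + 1 : ℕ) + n - p) * b) *
        bernsteinProd n k (z + 2)) • applyForm β (rieszR n p p (z + p) z) := by
  induction k generalizing z with
  | zero =>
    have := extDcoD_rieszR hz a b β
    simp only [zero_add, pow_one, Nat.cast_one, mul_one, bernsteinProd, Finset.range_zero,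
      Finset.prod_empty, this]
    congr 1
    ring
  | succ k ih =>
    have h1 := ih (add_two_notMem_poleSet hz)
    have h2 : z + 2 * ((k + 1 + 1 : ℕ) : ℂ) = z + 2 + 2 * ((k + 1 : ℕ) : ℂ) := by
      push_cast; ring
    rw [pow_succ', Module.End.mul_apply, h2, h1, map_smul, extDcoD_rieszR hz, smul_smul,
      bernsteinProd_succ n k (z + 2)]
    congr 1
    ring

/-- Cramer's rule: C_z (z+n-p, n-p) + D_z (p, z+p) = z(z+n) (A_z, B_z), and z(z+n) is the factor
missing from `bernsteinProd n k (z + 2)`. -/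
theorem bernsteinOp_rieszR (A B : ℂ → ℂ) (k : ℕ) {z : ℂ} (hz : z ∉ poleSet n) (β : Form n p) :
    bernsteinOp n p (k + 1) A B z (applyForm β
        (rieszR n p (A (z + 2 * (k + 1 : ℕ))) (B (z + 2 * (k + 1 : ℕ))) (z + 2 * (k + 1 : ℕ)))) =
      ((-1) ^ (k + 1) * bernsteinProd n (k + 1) z * coeffC p A B (z + 2 * (k + 1 : ℕ)) *
        coeffD n p A B (z + 2 * (k + 1 : ℕ))) • applyForm β (rieszR n p (A z) (B z) z) := by
  rw [bernsteinOp, LinearMap.add_apply, LinearMap.smul_apply, LinearMap.smul_apply,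
    coDextD_pow_rieszR k hz, extDcoD_pow_rieszR k hz, smul_smul, smul_smul, ← map_smul, ← map_smul,
    ← map_smul, ← map_add, smul_rieszR, smul_rieszR, smul_rieszR, rieszR_add, bernsteinProd_succ]
  simp only [coeffC, coeffD]
  congr 2 <;> ring

theorem bernsteinSato_rieszR (A B : ℂ → ℂ) {z : ℂ} (hz : z ∉ poleSet n) (β : Form n p) :
    (coeffC p A B z * coeffD n p A B (z + 2)) •
        coDextD n p (applyForm β (rieszR n p (A (z + 2)) (B (z + 2)) (z + 2)))
      + (coeffD n p A B z * coeffC p A B (z + 2)) •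
        extDcoD n p (applyForm β (rieszR n p (A (z + 2)) (B (z + 2)) (z + 2)))
      = (-z * (z + n) * coeffC p A B (z + 2) * coeffD n p A B (z + 2)) •
        applyForm β (rieszR n p (A z) (B z) z) := by
  have h := bernsteinOp_rieszR A B 0 hz β
  simp only [bernsteinOp, zero_add, pow_one, Nat.cast_one, mul_one, LinearMap.add_apply,
    LinearMap.smul_apply, bernsteinProd, Finset.range_one, Finset.prod_singleton, Nat.cast_zero,
    mul_zero, add_zero] at h
  rw [h]
  congr 1
  ring

end BernsteinSato

/-! ### The criterion for a genuine pole. -/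

section Residues

variable {n p : ℕ}

theorem zero_smul_distribution {V : Type*} [NormedAddCommGroup V] [NormedSpace ℂ V]
    (S : 𝓢'(Euc n, V)) : (0 : ℂ) • S = 0 :=
  ContinuousLinearMap.ext fun φ => zero_smul ℂ (S φ)

theorem smul_zero_distribution {V : Type*} [NormedAddCommGroup V] [NormedSpace ℂ V]
    (c : ℂ) : c • (0 : 𝓢'(Euc n, V)) = 0 :=
  ContinuousLinearMap.ext fun _ => smul_zero (A := V) c

/-- A continuous nonnegative function with zero integral vanishes, and the annulus weight is 1 on
the unit sphere. The power of |x| is harmless since the weight vanishes near 0. -/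
theorem eq_zero_of_integral_annulus {w : Euc n → ℝ} (hw : Continuous w) (h0 : ∀ x, 0 ≤ w x) (s : ℝ)
    (h : ∫ x, annulus x * ‖x‖ ^ s * w x = 0) {x : Euc n} (hx : ‖x‖ = 1) : w x = 0 := by
  by_contra hne
  have hc : Continuous fun x : Euc n => annulus x * ‖x‖ ^ s * w x := by
    refine Continuous.mul (continuous_iff_continuousAt.mpr fun y => ?_) hw
    rcases eq_or_ne y 0 with rfl | hy
    · refine (continuousAt_const (y := (0 : ℝ))).congr ?_
      filter_upwards [Metric.ball_mem_nhds (0 : Euc n) (by norm_num : (0 : ℝ) < 1 / 2)] with y hy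
      rw [annulus_eq_zero (mem_ball_zero_iff.mp hy).le, zero_mul]
    · exact continuous_annulus.continuousAt.mul
        (continuous_norm.continuousAt.rpow_const (Or.inl (norm_ne_zero_iff.mpr hy)))
  have hs : HasCompactSupport fun x : Euc n => annulus x * ‖x‖ ^ s * w x :=
    HasCompactSupport.intro (isCompact_closedBall (0 : Euc n) 2) fun y hy => by
      rw [mem_closedBall_zero_iff, not_le] at hy
      rw [annulus_eq_zero' hy.le, zero_mul, zero_mul]
  have hpos := hc.integral_pos_of_hasCompactSupport_nonneg_nonzero (μ := volume) (x := x) hs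
    (fun y => mul_nonneg (mul_nonneg (annulus_nonneg y) (by positivity)) (h0 y))
    (by simpa [annulus_eq_one hx, hx] using hne)
  exact hpos.ne' h

variable [NeZero n]

theorem rieszDist_eq_zero {V : Type*} [NormedAddCommGroup V] [NormedSpace ℂ V] [CompleteSpace V]
    {q : Euc n → V} (hq : IsQuad q) (h0 : ∀ x, q x = 0) {z : ℂ} (hz : z ∉ poleSet n) :
    rieszDist hq z = 0 := by
  ext φ
  obtain ⟨M, hM⟩ := exists_nat_gt (-(n : ℝ) - z.re)
  have hM' : -(n : ℝ) - 2 * M < z.re := by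
    have : (0 : ℝ) ≤ M := Nat.cast_nonneg M
    linarith
  have h := poleProd_smul_rieszDist hq hz hM' φ
  simp only [kernInt, kern, h0, smul_zero, integral_zero] at h
  exact (smul_eq_zero.mp h).resolve_left (poleProd_ne_zero hz M)

theorem residue_eq_zero {q : Euc n → FormEnd n p} (hq : IsQuad q) (h0 : ∀ x, q x = 0) {k : ℕ}
    {S : 𝓢'(Euc n, FormEnd n p)} (hS : HasSimplePoleResidue (rieszDist hq) (-n - 2 * k) S) :
    S = 0 := by
  refine ContinuousLinearMap.ext fun φ => ?_
  refine tendsto_nhds_unique (hS φ) (tendsto_const_nhds.congr' ?_)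
  filter_upwards [eventually_notMem_poleSet n k] with z hz
  rw [rieszDist_eq_zero hq h0 hz]
  exact (smul_zero _).symm

theorem hasSimplePoleResidue_rieszR {A B : ℂ → ℂ} (hA : Continuous A) (hB : Continuous B) {z₀ : ℂ}
    {S T : 𝓢'(Euc n, FormEnd n p)}
    (hS : HasSimplePoleResidue (rieszDist (isQuad_intExt n p)) z₀ S)
    (hT : HasSimplePoleResidue (rieszDist (isQuad_extInt n p)) z₀ T) :
    HasSimplePoleResidue (fun z => rieszR n p (A z) (B z) z) z₀ (A z₀ • S + B z₀ • T) := by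
  intro φ
  have hA' := (hA.tendsto z₀).mono_left (nhdsWithin_le_nhds (s := {z₀}ᶜ))
  have hB' := (hB.tendsto z₀).mono_left (nhdsWithin_le_nhds (s := {z₀}ᶜ))
  refine ((hA'.smul (hS φ)).add (hB'.smul (hT φ))).congr fun z => ?_
  rw [rieszR_apply, smul_add, smul_comm (A z), smul_comm (B z)]

/-- At the first pole the two residues are proportional. -/
theorem smul_residue_eq {S T : 𝓢'(Euc n, FormEnd n p)}
    (hS : HasSimplePoleResidue (rieszDist (isQuad_intExt n p)) (-n - 2 * (0 : ℕ)) S)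
    (hT : HasSimplePoleResidue (rieszDist (isQuad_extInt n p)) (-n - 2 * (0 : ℕ)) T) :
    (p : ℂ) • S = ((n : ℂ) - p) • T := by
  rcases Nat.eq_zero_or_pos p with rfl | hp
  · rw [residue_eq_zero (isQuad_extInt n 0) (fun _ => rfl) hT, Nat.cast_zero]
    rw [zero_smul_distribution, smul_zero_distribution]
  have hp' : (p : ℂ) ≠ 0 := by exact_mod_cast hp.ne'
  ext φ β : 2
  have hR := hasSimplePoleResidue_rieszR (A := fun z => z + n - p) (B := fun _ => (n : ℂ) - p)
    (by fun_prop) (by fun_prop) hS hT φ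
  have hlim := ((ContinuousLinearMap.apply ℂ (Form n p) β).continuous.tendsto _).comp hR
  -- Two to the right of the first pole the family is regular, so δd applied there has no residue;
  -- on the other side of `coDextD_rieszR` this annihilates -p S + (n-p) T.
  have hnot : (-n - 2 * (0 : ℕ) : ℂ) + 2 ∉ poleSet n := notMem_poleSet_of_re (by simp)
  have hcont : ContinuousAt
      (fun z => coDextD n p (applyForm β (rieszR n p 0 1 z)) φ) ((-n - 2 * (0 : ℕ) : ℂ) + 2) :=
    (((holOn_applyForm_rieszR (differentiable_const (0 : ℂ)) (differentiable_const (1 : ℂ))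
      β).coDextD φ).differentiableAt ((isOpen_compl_poleSet n).mem_nhds hnot)).continuousAt
  have hshift : Tendsto (fun z : ℂ => z + 2) (𝓝[≠] (-n - 2 * (0 : ℕ) : ℂ))
      (𝓝 ((-n - 2 * (0 : ℕ) : ℂ) + 2)) :=
    ((continuous_add_const (2 : ℂ)).tendsto _).mono_left nhdsWithin_le_nhds
  have hzero : Tendsto (fun z : ℂ => (z - (-n - 2 * (0 : ℕ)))) (𝓝[≠] (-n - 2 * (0 : ℕ) : ℂ))
      (𝓝 0) := by
    have : Continuous fun z : ℂ => (z - (-n - 2 * (0 : ℕ))) := by fun_prop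
    simpa using (this.tendsto (-n - 2 * (0 : ℕ) : ℂ)).mono_left
      (nhdsWithin_le_nhds (s := {(-n - 2 * (0 : ℕ) : ℂ)}ᶜ))
  have hlim2 := (hzero.smul (hcont.tendsto.comp hshift)).const_smul ((p : ℂ)⁻¹)
  rw [zero_smul, smul_zero] at hlim2
  have hkey := tendsto_nhds_unique hlim (hlim2.congr' (by
    filter_upwards [eventually_notMem_poleSet n 0] with z hz
    -- With a = 0 and b = 1 the scalar is p, invertible and independent of z.
    have h1 : coDextD n p (applyForm β (rieszR n p 0 1 (z + 2))) φ =
        (p : ℂ) • applyForm β (rieszR n p (z + n - p) (n - p) z) φ := by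
      rw [coDextD_rieszR hz]
      simp
    simp only [Function.comp_apply]
    rw [h1, smul_comm _ (p : ℂ), inv_smul_smul₀ hp']
    rfl))
  have h2 : ((-n - 2 * (0 : ℕ) : ℂ) + n - p) • S φ β + ((n : ℂ) - p) • T φ β = 0 := hkey
  rw [Nat.cast_zero, mul_zero, sub_zero, neg_add_cancel, zero_sub, neg_smul, neg_add_eq_zero] at h2
  exact h2

/-- If a combination of the two residues vanishes, then so does every component of the
corresponding quadratic map that can be detected by a homogeneous test function. -/
theorem component_eq_zero_of_residue_eq_zero {k : ℕ} {S T : 𝓢'(Euc n, FormEnd n p)}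
    (hS : HasSimplePoleResidue (rieszDist (isQuad_intExt n p)) (-n - 2 * k) S)
    (hT : HasSimplePoleResidue (rieszDist (isQuad_extInt n p)) (-n - 2 * k) T) {a b : ℂ}
    (h0 : a • S + b • T = 0) {h : Euc n → ℂ} (hs : ContDiff ℝ (↑(⊤ : ℕ∞)) h)
    (hh : ∀ (c : ℝ) x, h (c • x) = (c : ℂ) ^ (2 * k) * h x) (β : Form n p) (v : Fin p → Euc n)
    {w : Euc n → ℝ} (hw : Continuous w) (hw0 : ∀ x, 0 ≤ w x)
    (hwh : ∀ x, h x * evalAt v ((a • intExt n p x + b • extInt n p x) β) = w x)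
    {x : Euc n} (hx : ‖x‖ = 1) : w x = 0 := by
  refine eq_zero_of_integral_annulus hw hw0 (-n - 2 * k - 2) ?_ hx
  set g : Euc n → ℂ := fun x => h x * ((annulus x : ℝ) : ℂ) with hg
  have hgc : Continuous g := hs.continuous.mul
    (Complex.continuous_ofReal.comp continuous_annulus)
  obtain ⟨N, hN⟩ := exists_nat_gt (((2 * k + 1 : ℕ) : ℝ) + (-n - 2 * k : ℂ).re + n)
  obtain ⟨c, hc, hd⟩ := annulus_decayBound hs.continuous hh N
  have hre : -(n : ℝ) - ((2 * k + 1 : ℕ) : ℝ) < (-n - 2 * k : ℂ).re := by simp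
  have i1 := integrable_smul_kern (isQuad_intExt n p) hgc hc hd hre hN
  have i2 := integrable_smul_kern (isQuad_extInt n p) hgc hc hd hre hN
  have e1 := log_two_smul_residue (isQuad_intExt n p) hs hh (hS _)
  have e2 := log_two_smul_residue (isQuad_extInt n p) hs hh (hT _)
  have e3 : a • kernInt (intExt n p) (-n - 2 * k) g + b • kernInt (extInt n p) (-n - 2 * k) g
      = 0 := by
    rw [← e1, ← e2, smul_comm a, smul_comm b, ← smul_add]
    have := congrArg (fun U : 𝓢'(Euc n, FormEnd n p) => U (bumpMul h hs)) h0
    exact (congrArg _ this).trans (smul_zero _)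
  unfold kernInt at e3
  have j1 : Integrable fun x => a • g x • kern (intExt n p) (-n - 2 * k) x := i1.smul a
  have j2 : Integrable fun x => b • g x • kern (extInt n p) (-n - 2 * k) x := i2.smul b
  rw [← integral_smul, ← integral_smul, ← integral_add j1 j2] at e3
  have e4 := congrArg ((evalAt v).comp (ContinuousLinearMap.apply ℂ (Form n p) β)) e3
  rw [← ContinuousLinearMap.integral_comp_comm _ (j1.add j2), map_zero] at e4
  -- At the pole the exponent is real, so the tested component is a real integrand of the form
  -- required by `eq_zero_of_integral_annulus`.
  have e5 : ∀ x, ((evalAt v).comp (ContinuousLinearMap.apply ℂ (Form n p) β))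
      (a • g x • kern (intExt n p) (-n - 2 * k) x + b • g x • kern (extInt n p) (-n - 2 * k) x) =
      ((annulus x * ‖x‖ ^ (-n - 2 * k - 2 : ℝ) * w x : ℝ) : ℂ) := fun x => by
    push_cast
    rw [← hwh, Complex.ofReal_cpow (norm_nonneg x)]
    change evalAt v ((a • g x • kern (intExt n p) (-n - 2 * k) x +
      b • g x • kern (extInt n p) (-n - 2 * k) x) β) = _
    simp only [hg, kern, map_add, map_smul, add_apply, smul_apply, smul_eq_mul]
    push_cast
    ring
  rw [integral_congr_ae (Eventually.of_forall e5), integral_complex_ofReal] at e4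
  exact_mod_cast e4

/-- Since i_x ε_x + ε_x i_x = |x|², this is the residue of |x|^z times the identity. A constant test
function, the conjugate of a component of a nonzero form, makes the integrand nonnegative. -/
theorem residue_add_ne_zero (hp : p ≤ n) {S T : 𝓢'(Euc n, FormEnd n p)}
    (hS : HasSimplePoleResidue (rieszDist (isQuad_intExt n p)) (-n - 2 * (0 : ℕ)) S)
    (hT : HasSimplePoleResidue (rieszDist (isQuad_extInt n p)) (-n - 2 * (0 : ℕ)) T) :
    S + T ≠ 0 := by
  intro h0
  obtain ⟨ω, hω⟩ := nontrivial_form hp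
  refine hω (Form.ext fun v => ?_)
  obtain ⟨x, hx⟩ : ∃ x : Euc n, ‖x‖ = 1 := ⟨stdB n 0, by simp [stdB]⟩
  have := component_eq_zero_of_residue_eq_zero hS hT (a := 1) (b := 1) (by simpa using h0)
    (h := fun _ => (starRingEnd ℂ) (evalAt v ω)) contDiff_const (by simp) ω v
    (w := fun x => ‖x‖ ^ 2 * Complex.normSq (evalAt v ω)) (by fun_prop)
    (fun x => mul_nonneg (by positivity) (Complex.normSq_nonneg _)) (fun x => by
      rw [one_smul, one_smul, add_apply, intExt_add_extInt, map_smul,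
        smul_eq_mul, Complex.ofReal_mul, ← Complex.mul_conj]
      ring) hx
  rw [map_zero]
  simpa [hx] using this

/-- The test function is the conjugate of a component of the quadratic map times |x|^(2k), of total
degree 2(k+1), so the tested integrand is nonnegative. At the first pole no such degree is
available. -/
theorem quad_eq_zero_of_residue_eq_zero {k : ℕ} {S T : 𝓢'(Euc n, FormEnd n p)}
    (hS : HasSimplePoleResidue (rieszDist (isQuad_intExt n p)) (-n - 2 * (k + 1 : ℕ)) S)
    (hT : HasSimplePoleResidue (rieszDist (isQuad_extInt n p)) (-n - 2 * (k + 1 : ℕ)) T) {a b : ℂ}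
    (h0 : a • S + b • T = 0) (x : Euc n) : a • intExt n p x + b • extInt n p x = 0 := by
  have hhom : ∀ (c : ℝ) (x : Euc n), a • intExt n p (c • x) + b • extInt n p (c • x) =
      ((c ^ 2 : ℝ) : ℂ) • (a • intExt n p x + b • extInt n p x) := fun c x => by
    rw [intExt_smul, extInt_smul]
    module
  have hunit : ∀ x : Euc n, ‖x‖ = 1 → a • intExt n p x + b • extInt n p x = 0 := fun x hx => by
    ext1 β
    refine Form.ext fun v => ?_
    set f : Euc n → ℂ := fun x => evalAt v ((a • intExt n p x + b • extInt n p x) β) with hf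
    have hfs : ContDiff ℝ (↑(⊤ : ℕ∞)) f :=
      (((evalAt v).comp (ContinuousLinearMap.apply ℂ (Form n p) β)).restrictScalars
        ℝ).contDiff.comp (((contDiff_intExt n p).const_smul a).add
          ((contDiff_extInt n p).const_smul b))
    have hfh : ∀ (c : ℝ) x, f (c • x) = (c : ℂ) ^ 2 * f x := fun c x => by
      simp only [hf]
      rw [hhom, smul_apply, map_smul, smul_eq_mul, Complex.ofReal_pow]
    have := component_eq_zero_of_residue_eq_zero hS hT h0
      (h := fun x => (starRingEnd ℂ) (f x) * (((‖x‖ ^ 2) ^ k : ℝ) : ℂ))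
      ((Complex.conjCLE.contDiff.comp hfs).mul
        (Complex.ofRealCLM.contDiff.comp ((contDiff_norm_sq ℝ).pow k)))
      (fun c x => by
        rw [hfh, norm_smul, mul_pow, mul_pow, Real.norm_eq_abs, sq_abs]
        simp only [map_mul, map_pow, Complex.conj_ofReal]
        push_cast
        ring) β v (w := fun x => (‖x‖ ^ 2) ^ k * Complex.normSq (f x))
      (by
        have := hfs.continuous
        exact ((continuous_norm.pow 2).pow k).mul (Complex.continuous_normSq.comp this))
      (fun x => mul_nonneg (by positivity) (Complex.normSq_nonneg _)) (fun x => by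
        rw [Complex.ofReal_mul, ← Complex.mul_conj]
        ring) hx
    rw [zero_apply, map_zero]
    simpa only [hx, one_pow, one_mul, Complex.normSq_eq_zero] using this
  rcases eq_or_ne x 0 with rfl | hx
  · simpa using hhom 0 0
  · have hx' : ‖x‖ ≠ 0 := norm_ne_zero_iff.mpr hx
    have h1 : x = ‖x‖ • (‖x‖⁻¹ • x) := by rw [smul_smul, mul_inv_cancel₀ hx', one_smul]
    rw [h1, hhom, hunit _ (by rw [norm_smul, norm_inv, norm_norm, inv_mul_cancel₀ hx']), smul_zero]

/-- At z = -n both C and D equal -((n-p) A + p B), and by `smul_residue_eq` n times the residue is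
((n-p) A + p B) (S + T) with S + T nonzero. -/
theorem residue_ne_zero_iff_of_first_pole (hn : 1 ≤ n) (hp : p ≤ n) {A B : ℂ → ℂ} {z₀ : ℂ}
    (hz₀ : z₀ = -n - 2 * (0 : ℕ)) {S T : 𝓢'(Euc n, FormEnd n p)}
    (hS : HasSimplePoleResidue (rieszDist (isQuad_intExt n p)) z₀ S)
    (hT : HasSimplePoleResidue (rieszDist (isQuad_extInt n p)) z₀ T) :
    A z₀ • S + B z₀ • T ≠ 0 ↔
      (p < n ∧ coeffC p A B z₀ ≠ 0) ∨ (0 < p ∧ coeffD n p A B z₀ ≠ 0) := by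
  subst hz₀
  set z₀ : ℂ := -n - 2 * (0 : ℕ) with hz₀
  have hrel := smul_residue_eq hS hT
  have hne := residue_add_ne_zero hp hS hT
  have hn' : (n : ℂ) ≠ 0 := by exact_mod_cast (by omega : n ≠ 0)
  have hC : coeffC p A B z₀ = -((n - p) * A z₀ + p * B z₀) := by
    rw [coeffC, show z₀ = -n by simp [hz₀]]
    ring
  have hD : coeffD n p A B z₀ = -((n - p) * A z₀ + p * B z₀) := by
    rw [coeffD, show z₀ = -n by simp [hz₀]]
    ring
  have hsum : (n : ℂ) • (A z₀ • S + B z₀ • T) = ((n - p) * A z₀ + p * B z₀) • (S + T) := by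
    refine ContinuousLinearMap.ext fun φ => ?_
    have h1 : (p : ℂ) • S φ = ((n : ℂ) - p) • T φ :=
      congrArg (fun U : 𝓢'(Euc n, FormEnd n p) => U φ) hrel
    change (n : ℂ) • (A z₀ • S φ + B z₀ • T φ) = ((n - p) * A z₀ + p * B z₀) • (S φ + T φ)
    linear_combination (norm := module) (A z₀ - B z₀) • h1
  rw [hC, hD, ← or_and_right, and_iff_right (by omega : p < n ∨ 0 < p), neg_ne_zero,
    ← smul_ne_zero_iff_right hn', hsum, smul_ne_zero_iff_left hne]

/-- The residue vanishes exactly when each coefficient attached to a nonzero quadratic map does. The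
determinant z(z+n) of the passage from (A, B) to (C, D) is nonzero here; the cases p = 0 and p = n
are separate because one map is then zero. -/
theorem residue_ne_zero_iff_of_later_pole (hp : p ≤ n) {A B : ℂ → ℂ} {k : ℕ} {z₀ : ℂ}
    (hz₀ : z₀ = -n - 2 * (k + 1 : ℕ)) {S T : 𝓢'(Euc n, FormEnd n p)}
    (hS : HasSimplePoleResidue (rieszDist (isQuad_intExt n p)) z₀ S)
    (hT : HasSimplePoleResidue (rieszDist (isQuad_extInt n p)) z₀ T) :
    A z₀ • S + B z₀ • T ≠ 0 ↔
      (p < n ∧ coeffC p A B z₀ ≠ 0) ∨ (0 < p ∧ coeffD n p A B z₀ ≠ 0) := by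
  subst hz₀
  set z₀ : ℂ := -n - 2 * (k + 1 : ℕ) with hz₀
  have hdet : z₀ * (z₀ + n) ≠ 0 := by
    have h1 : z₀ = -((n + 2 * (k + 1) : ℕ) : ℂ) := by rw [hz₀]; push_cast; ring
    have h2 : z₀ + n = -((2 * (k + 1) : ℕ) : ℂ) := by rw [hz₀]; push_cast; ring
    rw [h2, h1]
    exact mul_ne_zero (neg_ne_zero.mpr (Nat.cast_ne_zero.mpr (by omega)))
      (neg_ne_zero.mpr (Nat.cast_ne_zero.mpr (by omega)))
  rw [← not_iff_not, not_not]
  simp only [not_or, not_and, not_not]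
  constructor
  · intro h0
    obtain ⟨ha, hb⟩ := coeff_eq_zero_of_forall hp (quad_eq_zero_of_residue_eq_zero hS hT h0)
    have ha' : ((n : ℂ) - p) * A z₀ = 0 := by
      rcases hp.lt_or_eq with h | h
      · rw [ha h, mul_zero]
      · rw [h, sub_self, zero_mul]
    have hb' : (p : ℂ) * B z₀ = 0 := by
      rcases Nat.eq_zero_or_pos p with h | h
      · rw [h, Nat.cast_zero, zero_mul]
      · rw [hb h, mul_zero]
    refine ⟨fun h => ?_, fun h => ?_⟩
    · rw [coeffC, ha h, hb', mul_zero, sub_zero]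
    · rw [coeffD, hb h, neg_mul, ha', mul_zero, neg_zero, add_zero]
  · rintro ⟨hC, hD⟩
    have hC' : ((n : ℂ) - p) * coeffC p A B z₀ = 0 := by
      rcases hp.lt_or_eq with h | h
      · rw [hC h, mul_zero]
      · rw [h, sub_self, zero_mul]
    have hD' : (p : ℂ) * coeffD n p A B z₀ = 0 := by
      rcases Nat.eq_zero_or_pos p with h | h
      · rw [h, Nat.cast_zero, zero_mul]
      · rw [hD h, mul_zero]
    have h1 : A z₀ • S = 0 := by
      rcases hp.lt_or_eq with h | h
      · have : z₀ * (z₀ + n) * A z₀ = 0 := by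
          -- Cramer's rule expressing A through C and D; the analogue for B follows below.
          have hid : z₀ * (z₀ + n) * A z₀ = (z₀ + n - p) * coeffC p A B z₀ +
              p * coeffD n p A B z₀ := by
            simp only [coeffC, coeffD]
            ring
          rw [hid, hC h, hD', mul_zero, add_zero]
        rw [(mul_eq_zero.mp this).resolve_left hdet, zero_smul_distribution]
      · subst h
        rw [residue_eq_zero _ intExt_top hS, smul_zero_distribution]
    have h2 : B z₀ • T = 0 := by
      rcases Nat.eq_zero_or_pos p with h | h
      · subst h
        rw [residue_eq_zero _ (fun _ => rfl) hT, smul_zero_distribution]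
      · have : z₀ * (z₀ + n) * B z₀ = 0 := by
          have hid : z₀ * (z₀ + n) * B z₀ = ((n : ℂ) - p) * coeffC p A B z₀ +
              (z₀ + p) * coeffD n p A B z₀ := by
            simp only [coeffC, coeffD]
            ring
          rw [hid, hC', hD h, mul_zero, add_zero]
        rw [(mul_eq_zero.mp this).resolve_left hdet, zero_smul_distribution]
    rw [h1, h2, add_zero]

end Residues

/-! ### Uniqueness of the continuation and the theorem. -/

section Continuation

variable {n p : ℕ} {A B : ℂ → ℂ}

theorem IsRieszContinuation.eqOn {R R' : ℂ → 𝓢'(Euc n, FormEnd n p)}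
    (hR : IsRieszContinuation n p A B R) (hR' : IsRieszContinuation n p A B R') :
    Set.EqOn R' R (poleSet n)ᶜ := fun _ hz => ContinuousLinearMap.ext fun φ =>
  eqOn_of_eqOn_re_gt (isOpen_compl_poleSet n) (isPreconnected_compl_poleSet n) (hR'.2 φ) (hR.2 φ)
    (fun _ hw => notMem_poleSet_of_re hw)
    (fun w hw => ((hR'.1 w hw) φ).2.trans ((hR.1 w hw) φ).2.symm) hz

variable [NeZero n]

theorem isRieszContinuation_rieszR (hA : Differentiable ℂ A) (hB : Differentiable ℂ B) :
    IsRieszContinuation n p A B fun z => rieszR n p (A z) (B z) z :=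
  ⟨fun z hz => isGivenBy_rieszR (A z) (B z) hz, fun φ =>
    (hA.differentiableOn.smul (differentiableOn_rieszDist (isQuad_intExt n p) φ)).add
      (hB.differentiableOn.smul (differentiableOn_rieszDist (isQuad_extInt n p) φ))⟩

end Continuation

end RieszForms

theorem theorem3p2 (n p : ℕ) (hn : 1 ≤ n) (hp : p ≤ n) (A B : ℂ → ℂ)
    (hA : Differentiable ℂ A) (hB : Differentiable ℂ B) :
    ∃ R : ℂ → 𝓢'(RieszForms.Euc n, RieszForms.FormEnd n p),
      -- `R` continues the family of Riesz distributions, and is the only such continuation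
      RieszForms.IsRieszContinuation n p A B R ∧
      (∀ R' : ℂ → 𝓢'(RieszForms.Euc n, RieszForms.FormEnd n p),
        RieszForms.IsRieszContinuation n p A B R' →
          Set.EqOn R' R (RieszForms.poleSet n)ᶜ) ∧
      -- its singularities are at most simple poles, with an exact criterion for a genuine pole
      (∀ k : ℕ, ∃ S : 𝓢'(RieszForms.Euc n, RieszForms.FormEnd n p),
        RieszForms.HasSimplePoleResidue R (-n - 2 * k) S ∧
        (S ≠ 0 ↔ (p < n ∧ RieszForms.coeffC p A B (-n - 2 * k) ≠ 0) ∨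
          (0 < p ∧ RieszForms.coeffD n p A B (-n - 2 * k) ≠ 0))) ∧
      -- the Bernstein–Sato identity
      (∀ z ∉ RieszForms.poleSet n, ∀ β : RieszForms.Form n p,
        (RieszForms.coeffC p A B z * RieszForms.coeffD n p A B (z + 2)) •
            RieszForms.coDextD n p (RieszForms.applyForm β (R (z + 2)))
          + (RieszForms.coeffD n p A B z * RieszForms.coeffC p A B (z + 2)) •
            RieszForms.extDcoD n p (RieszForms.applyForm β (R (z + 2)))
          = (-z * (z + n) * RieszForms.coeffC p A B (z + 2) * RieszForms.coeffD n p A B (z + 2)) •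
            RieszForms.applyForm β (R z)) ∧
      -- its iterates
      (∀ k : ℕ, 1 ≤ k → ∀ z ∉ RieszForms.poleSet n, ∀ β : RieszForms.Form n p,
        RieszForms.bernsteinOp n p k A B z (RieszForms.applyForm β (R (z + 2 * k)))
          = ((-1) ^ k * 4 ^ k * (ascPochhammer ℂ k).eval (z / 2) *
              (ascPochhammer ℂ k).eval ((z + n) / 2) *
              RieszForms.coeffC p A B (z + 2 * k) * RieszForms.coeffD n p A B (z + 2 * k)) •
            RieszForms.applyForm β (R z)) := by
  have : NeZero n := ⟨by omega⟩
  refine ⟨fun z => RieszForms.rieszR n p (A z) (B z) z,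
    RieszForms.isRieszContinuation_rieszR hA hB,
    fun R' hR' => (RieszForms.isRieszContinuation_rieszR hA hB).eqOn hR', fun k => ?_,
    fun z hz β => RieszForms.bernsteinSato_rieszR A B hz β, fun k hk z hz β => ?_⟩
  · obtain ⟨S, hS⟩ := RieszForms.exists_residue (RieszForms.isQuad_intExt n p) k
    obtain ⟨T, hT⟩ := RieszForms.exists_residue (RieszForms.isQuad_extInt n p) k
    refine ⟨_, RieszForms.hasSimplePoleResidue_rieszR hA.continuous hB.continuous hS hT, ?_⟩
    cases k with
    | zero => exact RieszForms.residue_ne_zero_iff_of_first_pole hn hp rfl hS hT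
    | succ k => exact RieszForms.residue_ne_zero_iff_of_later_pole hp rfl hS hT
  · obtain ⟨k, rfl⟩ := Nat.exists_eq_succ_of_ne_zero (Nat.one_le_iff_ne_zero.mp hk)
    rw [Nat.succ_eq_add_one, RieszForms.bernsteinOp_rieszR A B k hz β,
      ← RieszForms.ascPochhammer_mul_eval]
    congr 1
    ring
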